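/- Let $n\ge 1$, let $\Omega\subset\mathbb R^n$ be a bounded Lipschitz domain with exterior $\Omega_e=\mathbb R^n\setminus\overline\Omega$, let $T>0$ and let $s>0$ be a non-integer. Write $A_T=A\times(0,T)$ and $\psi^\star(x,t)=\psi(x,T-t)$. All functions are real valued. **Spaces.** $H^s(\mathbb R^n)$ is the $L^2$-based Sobolev space and $\widetilde H^s(\Omega)$ is the closure of $C_c^\infty(\Omega)$ in it. For a closed subspace $V\subset H^s(\mathbb R^n)$ let $$\widetilde W(0,T;V)=\{u\in L^2(0,T;V):\ \partial_tu\in L^2(0,T;V),\ \partial_t^2u\in L^2(0,T;V')\},$$ where $w\in V$ is identified with $\langle w,\cdot\rangle_{L^2}\in V'$, with its natural Hilbert norm. Let $\widetilde W_*(0,T;H^s(\mathbb R^n))$ be the set of $\psi\in\widetilde W(0,T;H^s(\mathbb R^n))$ with $\psi(0)\in\widetilde H^s(\Omega)$ and $\partial_t\psi(0)\in L^2(\Omega)$ (functions in $L^2(\Omega)$ being extended by zero to $\mathbb R^n$). Set $\widetilde W_{ext}(0,T;\widetilde H^s(\Omega))=\widetilde W(0,T;\widetilde H^s(\Omega))+\widetilde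 W_*(0,T;H^s(\mathbb R^n))$ with the sum norm, and let $\widetilde W^s_{rest}((\Omega_e)_T)$ be the space of restrictions to $(\Omega_e)_T$ of elements of $\widetilde W_*(0,T;H^s(\mathbb R^n))$ with the quotient norm. **Nonlinearities.** For $j=1,2$ let $f_j:\Omega\times\mathbb R\to\mathbb R$ be a Carathéodory function with $f_j(\cdot,0)=0$, having a partial derivative $\partial_\tau f_j$ which is a Carathéodory function and satisfies, with some constant $C_j$, $$|\partial_\tau f_j(x,\tau)|\le C_j\,(a_j(x)+|\tau|^{r_j})\quad\text{for a.e. }x\in\Omega\text{ and all }\tau\in\mathbb R,$$ where $a_j\in L^\infty(\Omega)$, $0<r_j<\infty$, and $r_j\le \frac{2s}{n-2s}$ if $2s<n$. (As $\Omega$ is bounded, $a_j\in L^{p_j}(\Omega)$ for all admissible exponents $p_j$: $n/s\le p_j\le\infty$ if $2s<n$, $2<p_j\le\infty$ if $2s=n$, $2\le p_j\le\infty$ if $2s>n$.) Write $f_j(u)(x,t)=f_j(x,u(x,t))$. **Solutions.** A solution of $$(\partial_t^2+(-\Delta)^s\partial_t+(-\Delta)^s)u+f(u)=0\ \text{in }\Omega_T,\qquad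 u=\varphi\ \text{in }(\Omega_e)_T,\qquad u(0)=\partial_tu(0)=0\ \text{in }\Omega \tag{1}$$ is a function $u\in\widetilde W_{ext}(0,T;\widetilde H^s(\Omega))$ with $u=\varphi$ a.e. in $(\Omega_e)_T$, $u(0)=0$, $\partial_tu(0)=0$, such that for all $v\in\widetilde H^s(\Omega)$ $$\tfrac{d}{dt}\langle\partial_tu,v\rangle_{L^2(\Omega)}+\langle(-\Delta)^{s/2}\partial_tu,(-\Delta)^{s/2}v\rangle_{L^2(\mathbb R^n)}+\langle(-\Delta)^{s/2}u,(-\Delta)^{s/2}v\rangle_{L^2(\mathbb R^n)}+\langle f(u),v\rangle_{L^2(\Omega)}=0$$ in the sense of distributions on $(0,T)$. **DN maps.** For $j=1,2$ let $U_0^j\subset\widetilde W^s_{rest}((\Omega_e)_T)$ and $U_1^j\subset\widetilde W_{ext}(0,T;\widetilde H^s(\Omega))$ be neighborhoods of the origin such that for every $\varphi\in U_0^j$ problem (1) with $f=f_j$ has a unique solution $u\in U_1^j$. For $\varphi\in U_0^j$ and $\psi\in C_c^\infty((\Omega_e)_T)$ set, with this solution $u$, $$\langle\Lambda_{f_j}\varphi,\psi\rangle=\int_{\mathbb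 R^n_T}(-\Delta)^{s/2}u\,(-\Delta)^{s/2}\psi\,dx\,dt+\int_{\mathbb R^n_T}(-\Delta)^{s/2}\partial_tu\,(-\Delta)^{s/2}\psi\,dx\,dt .$$ **Claim.** Let $\varphi_1\in U_0^1\cap U_0^2\cap C_c^\infty((\Omega_e)_T)$ and $\varphi_2\in C_c^\infty((\Omega_e)_T)$. Let $u_1^{(j)}\in U_1^j$ be the unique solution of (1) with $f=f_j$, $\varphi=\varphi_1$, and let $u_2$ be the solution of the linear problem (1) with $f=0$, $\varphi=\varphi_2$. Then the integral on the right-hand side below converges absolutely and $$\big\langle(\Lambda_{f_1}-\Lambda_{f_2})\varphi_1,\varphi_2^\star\big\rangle=\int_{\Omega_T}\big(f_1(u_1^{(1)})-f_2(u_1^{(2)})\big)\,(u_2-\varphi_2)^\star\,dx\,dt .$$ -/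

import Mathlib

open MeasureTheory Set
open scoped ContDiff ENNReal

noncomputable section

namespace ViscousWave

/-! ### Test functions, domains, nonlinearities -/

/-- Euclidean space `ℝⁿ`. -/
abbrev Rn (n : ℕ) : Type := EuclideanSpace ℝ (Fin n)

/-- `C_c^∞(U)`: real valued smooth functions with compact support contained in `U`
(extended by zero to the whole space). -/
def CcInfty {X : Type*} [NormedAddCommGroup X] [NormedSpace ℝ X] (U : Set X) : Set (X → ℝ) :=
  {g | ContDiff ℝ ∞ g ∧ HasCompactSupport g ∧ tsupport g ⊆ U}

/-- The space-time cylinder `A_T = A × (0,T)`. -/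
def cyl {n : ℕ} (A : Set (Rn n)) (T : ℝ) : Set (Rn n × ℝ) := A ×ˢ Ioo (0 : ℝ) T

/-- The exterior `Ω_e` of `Ω`. -/
def exterior {n : ℕ} (Ω : Set (Rn n)) : Set (Rn n) := (closure Ω)ᶜ

/-- A bounded Lipschitz domain: a nonempty bounded connected open set which near each of its
boundary points is, after a choice of the vertical direction `ν`, the region strictly above the
graph of a Lipschitz function of the horizontal variable `y - ⟪ν, y⟫ ν`. -/
structure IsBoundedLipschitzDomain {n : ℕ} (Ω : Set (Rn n)) : Prop where
  isOpen : IsOpen Ω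
  isConnected : IsConnected Ω
  isBounded : Bornology.IsBounded Ω
  lipschitz_boundary : ∀ x ∈ frontier Ω, ∃ (ν : Rn n) (γ : Rn n → ℝ) (K : NNReal) (ρ : ℝ),
    ‖ν‖ = 1 ∧ LipschitzWith K γ ∧ 0 < ρ ∧
    ∀ y ∈ Metric.ball x ρ, (y ∈ Ω ↔ γ (y - (inner ℝ ν y) • ν) < inner ℝ ν y)

/-- Carathéodory functions on `Ω × ℝ` (values outside `Ω × ℝ` are irrelevant). -/
def IsCaratheodory {n : ℕ} (Ω : Set (Rn n)) (f : Rn n → ℝ → ℝ) : Prop :=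
  (∀ᵐ x ∂(volume.restrict Ω), Continuous (f x)) ∧
  ∀ τ : ℝ, AEMeasurable (fun x => f x τ) (volume.restrict Ω)

/-- The structural assumption on the nonlinearity `f : Ω × ℝ → ℝ`: it is a Carathéodory function,
has a partial derivative `∂_τ f` which is a Carathéodory function, and
`|∂_τ f(x,τ)| ≤ C (a(x) + |τ|^r)` with `a ∈ L^p(Ω)`, where `p` and `r` satisfy the restrictions
coming from the dimension `n` and the order `s`. -/
structure GrowthAssumption {n : ℕ} (Ω : Set (Rn n)) (s : ℝ) (f : Rn n → ℝ → ℝ)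
    (a : Rn n → ℝ) (p : ℝ≥0∞) (r : ℝ) : Prop where
  caratheodory : IsCaratheodory Ω f
  differentiable : ∀ᵐ x ∂(volume.restrict Ω), Differentiable ℝ (f x)
  deriv_caratheodory : IsCaratheodory Ω (fun x τ => deriv (f x) τ)
  memLp : MemLp a p (volume.restrict Ω)
  bound : ∃ C : ℝ, ∀ᵐ x ∂(volume.restrict Ω), ∀ τ : ℝ, |deriv (f x) τ| ≤ C * (a x + |τ| ^ r)
  p_subcritical : 2 * s < n → ENNReal.ofReal (n / s) ≤ p
  p_critical : 2 * s = n → 2 < p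
  p_supercritical : n ≤ 2 * s → 2 ≤ p
  r_nonneg : 0 ≤ r
  r_subcritical : 2 * s < n → r ≤ 2 * s / (n - 2 * s)

/-! ### The fractional Laplacian and the Sobolev spaces `H^s(ℝⁿ)`, `H̃^s(Ω)` -/

/-- Real valued `L²(ℝⁿ)`. -/
abbrev L2 (n : ℕ) : Type := Lp ℝ 2 (volume : Measure (Rn n))

/-- The Fourier transform of a real valued `L²` function, normalised as
`∫ u(x) exp(-2πi x·ξ) dx`. -/
def fourierL2 {n : ℕ} (u : L2 n) : Lp ℂ 2 (volume : Measure (Rn n)) :=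
  Lp.fourierTransformₗᵢ (Rn n) ℂ (Complex.ofRealCLM.compLpL 2 volume u)

/-- `w = (-Δ)^{s/2} u` in `L²(ℝⁿ)`, through the Fourier symbol. With the above normalisation of the
Fourier transform the symbol of `(-Δ)^{s/2}` is `(2π|ξ|)^s`. -/
def IsHalfLaplacian {n : ℕ} (s : ℝ) (u w : L2 n) : Prop :=
  ∀ᵐ ξ : Rn n, fourierL2 w ξ = (((2 * Real.pi * ‖ξ‖) ^ s : ℝ) : ℂ) * fourierL2 u ξ

theorem fourierL2_add {n : ℕ} (u v : L2 n) : fourierL2 (u + v) = fourierL2 u + fourierL2 v := by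
  simp only [fourierL2, map_add]

theorem fourierL2_smul {n : ℕ} (c : ℝ) (u : L2 n) :
    fourierL2 (c • u) = (c : ℂ) • fourierL2 u := by
  have h : (Complex.ofRealCLM.compLpL 2 volume) (c • u) =
      (c : ℂ) • (Complex.ofRealCLM.compLpL 2 volume) u := by
    rw [map_smul]
    ext1
    filter_upwards [Lp.coeFn_smul c ((Complex.ofRealCLM.compLpL 2 volume) u),
      Lp.coeFn_smul (c : ℂ) ((Complex.ofRealCLM.compLpL 2 volume) u)] with x h1 h2
    rw [h1, h2]
    simp
  simp only [fourierL2, h, map_smul]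

theorem continuous_fourierL2 {n : ℕ} : Continuous (fourierL2 : L2 n → _) :=
  (Lp.fourierTransformₗᵢ (Rn n) ℂ).continuous.comp (Complex.ofRealCLM.compLpL 2 volume).continuous

/-- The Sobolev space `H^s(ℝⁿ)`, `s ≥ 0`, of real valued functions, realised as the graph of the
operator `(-Δ)^{s/2}` in `L²(ℝⁿ)`: an element is a pair `(u, (-Δ)^{s/2} u)`. The Hilbert norm is
`(‖u‖² + ‖(-Δ)^{s/2} u‖²)^{1/2}`, which is equivalent to the Bessel potential norm. -/
def sobolev (n : ℕ) (s : ℝ) : Submodule ℝ (WithLp 2 (L2 n × L2 n)) where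
  carrier := {U | IsHalfLaplacian s U.fst U.snd}
  zero_mem' := by
    have h0 : fourierL2 (0 : L2 n) = 0 := by simp [fourierL2]
    change IsHalfLaplacian s (0 : L2 n) (0 : L2 n)
    simp only [IsHalfLaplacian, h0]
    filter_upwards [Lp.coeFn_zero ℂ 2 (volume : Measure (Rn n))] with ξ _
    simp
  add_mem' := by
    intro U V hU hV
    change IsHalfLaplacian s (U.fst + V.fst) (U.snd + V.snd)
    simp only [IsHalfLaplacian, fourierL2_add]
    filter_upwards [hU, hV, Lp.coeFn_add (fourierL2 U.fst) (fourierL2 V.fst),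
      Lp.coeFn_add (fourierL2 U.snd) (fourierL2 V.snd)] with ξ h1 h2 h3 h4
    simp only [h3, h4, Pi.add_apply, h1, h2]
    ring
  smul_mem' := by
    intro c U hU
    change IsHalfLaplacian s (c • U.fst) (c • U.snd)
    simp only [IsHalfLaplacian, fourierL2_smul]
    filter_upwards [hU, Lp.coeFn_smul (c : ℂ) (fourierL2 U.fst),
      Lp.coeFn_smul (c : ℂ) (fourierL2 U.snd)] with ξ h1 h3 h4
    simp only [h3, h4, Pi.smul_apply, h1, smul_eq_mul]
    ring

/-- `H^s(ℝⁿ)` as a type. -/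
abbrev Hs (n : ℕ) (s : ℝ) : Type := sobolev n s

/-- `H^s(ℝⁿ)` is complete. -/
instance completeSpace_Hs (n : ℕ) (s : ℝ) : CompleteSpace (Hs n s) := by
  refine IsClosed.completeSpace_coe (hs := ?_)
  refine isClosed_of_closure_subset fun U hU => ?_
  obtain ⟨V, hV, hlim⟩ := mem_closure_iff_seq_limit.mp hU
  have h1 : Filter.Tendsto (fun k => fourierL2 (V k).fst) Filter.atTop
      (nhds (fourierL2 U.fst)) :=
    ((continuous_fourierL2.comp (WithLp.fstL 2 ℝ (L2 n) (L2 n)).continuous).tendsto U).comp hlim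
  have h2 : Filter.Tendsto (fun k => fourierL2 (V k).snd) Filter.atTop
      (nhds (fourierL2 U.snd)) :=
    ((continuous_fourierL2.comp (WithLp.sndL 2 ℝ (L2 n) (L2 n)).continuous).tendsto U).comp hlim
  obtain ⟨k, hk, hk1⟩ := (tendstoInMeasure_of_tendsto_Lp h1).exists_seq_tendsto_ae
  obtain ⟨l, hl, hl2⟩ :=
    (tendstoInMeasure_of_tendsto_Lp (h2.comp hk.tendsto_atTop)).exists_seq_tendsto_ae
  have hgraph : ∀ᵐ ξ : Rn n, ∀ m, fourierL2 (V m).snd ξ =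
      (((2 * Real.pi * ‖ξ‖) ^ s : ℝ) : ℂ) * fourierL2 (V m).fst ξ :=
    ae_all_iff.mpr fun m => hV m
  change IsHalfLaplacian s U.fst U.snd
  filter_upwards [hk1, hl2, hgraph] with ξ a1 a2 a3
  have a1' := (a1.comp hl.tendsto_atTop).const_mul (((2 * Real.pi * ‖ξ‖) ^ s : ℝ) : ℂ)
  refine tendsto_nhds_unique a2 (a1'.congr fun m => ?_)
  exact (a3 (k (l m))).symm

/-- The underlying `L²(ℝⁿ)` function of an element of `H^s(ℝⁿ)`. -/
def Hs.val {n : ℕ} {s : ℝ} (u : Hs n s) : L2 n := u.1.fst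

/-- The fractional Laplacian `(-Δ)^{s/2} : H^s(ℝⁿ) → L²(ℝⁿ)`. -/
def Hs.lap {n : ℕ} {s : ℝ} (u : Hs n s) : L2 n := u.1.snd

open Classical in
/-- The element of `H^s(ℝⁿ)` given by a function on `ℝⁿ` (zero if the function is not in
`H^s(ℝⁿ)`). -/
def Hs.ofFun {n : ℕ} (s : ℝ) (g : Rn n → ℝ) : Hs n s :=
  if h : ∃ u : Hs n s, u.val =ᵐ[volume] g then h.choose else 0

/-- `H̃^s(Ω)`, the closure of `C_c^∞(Ω)` in `H^s(ℝⁿ)`. -/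
def Htilde {n : ℕ} (s : ℝ) (Ω : Set (Rn n)) : Submodule ℝ (Hs n s) :=
  (Submodule.span ℝ {u : Hs n s | ∃ g ∈ CcInfty Ω, u.val =ᵐ[volume] g}).topologicalClosure

/-! ### Bochner spaces -/

/-- `L²(0,T;H^s(ℝⁿ))`. -/
abbrev L2T (n : ℕ) (s T : ℝ) : Type := Lp (Hs n s) 2 (volume.restrict (Ioo (0 : ℝ) T))

/-- `L²(0,T;V')`, where `V'` is the dual space of the subspace `V` of `H^s(ℝⁿ)`. -/
abbrev L2TDual {n : ℕ} {s : ℝ} (V : Submodule ℝ (Hs n s)) (T : ℝ) : Type :=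
  Lp (V →L[ℝ] ℝ) 2 (volume.restrict (Ioo (0 : ℝ) T))

/-- `u' = ∂_t u` in the sense of distributions on `(0,T)` with values in `H^s(ℝⁿ)`. -/
def IsTimeDeriv {n : ℕ} {s T : ℝ} (u u' : L2T n s T) : Prop :=
  ∀ η ∈ CcInfty (Ioo (0 : ℝ) T),
    ∫ t in Ioo (0 : ℝ) T, deriv η t • u t = - ∫ t in Ioo (0 : ℝ) T, η t • u' t

/-- `F = ∂_t w` in the sense of distributions on `(0,T)` with values in `V'`, where `w(t)` is
regarded as the element `v ↦ ⟨w(t), v⟩_{L²}` of `V'`. -/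
def IsDualTimeDeriv {n : ℕ} {s T : ℝ} (V : Submodule ℝ (Hs n s)) (w : L2T n s T)
    (F : L2TDual V T) : Prop :=
  ∀ η ∈ CcInfty (Ioo (0 : ℝ) T), ∀ v : V,
    ∫ t in Ioo (0 : ℝ) T, deriv η t * ∫ x, (w t).val x * (v : Hs n s).val x =
      - ∫ t in Ioo (0 : ℝ) T, η t * F t v

/-- The (unique) time derivative `∂_t u` of `u ∈ H¹(0,T;H^s(ℝⁿ))`. -/
def dt {n : ℕ} {s T : ℝ} (u : L2T n s T) : L2T n s T :=
  Classical.epsilon (IsTimeDeriv u)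

/-- The (unique) second time derivative `∂_t² u ∈ L²(0,T;V')` of `u ∈ W̃(0,T;V)`. -/
def dtt {n : ℕ} {s T : ℝ} (V : Submodule ℝ (Hs n s)) (u : L2T n s T) : L2TDual V T :=
  Classical.epsilon (IsDualTimeDeriv V (dt u))

/-- `W̃(0,T;V) = {u ∈ L²(0,T;V) : ∂_t u ∈ L²(0,T;V), ∂_t² u ∈ L²(0,T;V')}` for a closed subspace
`V` of `H^s(ℝⁿ)`. -/
def WTilde {n : ℕ} {s : ℝ} (V : Submodule ℝ (Hs n s)) (T : ℝ) : Set (L2T n s T) :=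
  {u | (∀ᵐ t ∂(volume.restrict (Ioo (0 : ℝ) T)), u t ∈ V) ∧
    ∃ u' : L2T n s T, IsTimeDeriv u u' ∧
      (∀ᵐ t ∂(volume.restrict (Ioo (0 : ℝ) T)), u' t ∈ V) ∧
      ∃ u'' : L2TDual V T, IsDualTimeDeriv V u' u''}

/-- The norm of `W̃(0,T;V)`. -/
def wNorm {n : ℕ} {s T : ℝ} (V : Submodule ℝ (Hs n s)) (u : L2T n s T) : ℝ :=
  Real.sqrt (‖u‖ ^ 2 + ‖dt u‖ ^ 2 + ‖dtt V u‖ ^ 2)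

/-- `g(0) = x₀`: the function `g`, defined a.e. on `(0,T)`, has a representative which is
continuous on `[0,T]` and has the value `x₀` at `0`. -/
def HasInitialValue {X : Type*} [TopologicalSpace X] (T : ℝ) (g : ℝ → X) (x₀ : X) : Prop :=
  ∃ h : ℝ → X, ContinuousOn h (Icc 0 T) ∧ g =ᵐ[volume.restrict (Ioo (0 : ℝ) T)] h ∧ h 0 = x₀

/-- `W̃_*(0,T;H^s(ℝⁿ))`: the `ψ ∈ W̃(0,T;H^s(ℝⁿ))` with `ψ(0) ∈ H̃^s(Ω)` and `∂_t ψ(0) ∈ L²(Ω)`,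
where `L²(Ω)` is identified with the functions in `L²(ℝⁿ)` vanishing a.e. outside `Ω`. -/
def WStar {n : ℕ} (s T : ℝ) (Ω : Set (Rn n)) : Set (L2T n s T) :=
  {ψ | ψ ∈ WTilde (⊤ : Submodule ℝ (Hs n s)) T ∧
    (∃ ψ₀ ∈ Htilde s Ω, HasInitialValue T ψ ψ₀) ∧
    ∃ ψ₁ : L2 n, (∀ᵐ x ∂(volume.restrict Ωᶜ), ψ₁ x = 0) ∧
      HasInitialValue T (fun t => (dt ψ t).val) ψ₁}

/-- `W̃_ext(0,T;H̃^s(Ω)) = W̃(0,T;H̃^s(Ω)) + W̃_*(0,T;H^s(ℝⁿ))`. -/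
def WExt {n : ℕ} (s T : ℝ) (Ω : Set (Rn n)) : Set (L2T n s T) :=
  {u | ∃ v ∈ WTilde (Htilde s Ω) T, ∃ ψ ∈ WStar s T Ω, u = v + ψ}

/-- The norm of `W̃_ext(0,T;H̃^s(Ω))`. -/
def extNorm {n : ℕ} {s T : ℝ} (Ω : Set (Rn n)) (u : L2T n s T) : ℝ :=
  sInf {c | ∃ v ∈ WTilde (Htilde s Ω) T, ∃ ψ ∈ WStar s T Ω, u = v + ψ ∧
    c = wNorm (Htilde s Ω) v + wNorm ⊤ ψ}

/-- Measurable functions on `(Ω_e)_T`, modulo equality a.e. -/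
abbrev ExtData {n : ℕ} (Ω : Set (Rn n)) (T : ℝ) : Type :=
  (Rn n × ℝ) →ₘ[volume.restrict (cyl (exterior Ω) T)] ℝ

/-- `u = φ` in `(Ω_e)_T`. -/
def EqOnExt {n : ℕ} {s T : ℝ} {Ω : Set (Rn n)} (u : L2T n s T) (φ : ExtData Ω T) : Prop :=
  ∀ᵐ t ∂(volume.restrict (Ioo (0 : ℝ) T)), ∀ᵐ x ∂(volume.restrict (exterior Ω)),
    (u t).val x = φ (x, t)

/-- `W̃^s_rest((Ω_e)_T)`: the restrictions to `(Ω_e)_T` of the elements of `W̃_*(0,T;H^s(ℝⁿ))`. -/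
def WRest {n : ℕ} (s T : ℝ) (Ω : Set (Rn n)) : Set (ExtData Ω T) :=
  {φ | ∃ ψ ∈ WStar s T Ω, EqOnExt ψ φ}

/-- The quotient norm of `W̃^s_rest((Ω_e)_T)`. -/
def restNorm {n : ℕ} {T : ℝ} (s : ℝ) {Ω : Set (Rn n)} (φ : ExtData Ω T) : ℝ :=
  sInf {c | ∃ ψ ∈ WStar s T Ω, EqOnExt ψ φ ∧ c = wNorm ⊤ ψ}

/-- `U` is a neighborhood of the origin in the space `W` with norm `N`. -/
def IsNhdZero {X : Type*} (W : Set X) (N : X → ℝ) (U : Set X) : Prop :=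
  U ⊆ W ∧ ∃ δ > 0, ∀ u ∈ W, N u < δ → u ∈ U

/-- A test function in `C_c^∞((Ω_e)_T)`, regarded as exterior datum. -/
def toExtData {n : ℕ} {T : ℝ} {Ω : Set (Rn n)} (φ : CcInfty (cyl (exterior Ω) T)) : ExtData Ω T :=
  AEEqFun.mk φ.1 φ.2.1.continuous.aestronglyMeasurable

/-! ### Solutions and the Dirichlet-to-Neumann map -/

/-- `u ∈ W̃_ext(0,T;H̃^s(Ω))` is a solution of
`∂_t² u + (-Δ)^s ∂_t u + (-Δ)^s u + f(u) = 0` in `Ω_T`, `u = φ` in `(Ω_e)_T`,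
`u(0) = ∂_t u(0) = 0` in `Ω`. The equation is tested with `v ∈ H̃^s(Ω)` and holds in the sense of
distributions on `(0,T)`; `f(u)` is the Nemytskii operator. -/
structure IsSolution {n : ℕ} {s T : ℝ} (Ω : Set (Rn n)) (f : Rn n → ℝ → ℝ) (φ : ExtData Ω T)
    (u : L2T n s T) : Prop where
  mem : u ∈ WExt s T Ω
  equation : ∀ v ∈ Htilde s Ω, ∀ η ∈ CcInfty (Ioo (0 : ℝ) T),
    - (∫ t in Ioo (0 : ℝ) T, deriv η t * ∫ x in Ω, (dt u t).val x * v.val x) +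
      ∫ t in Ioo (0 : ℝ) T, η t *
        ((∫ x, (dt u t).lap x * v.lap x) + (∫ x, (u t).lap x * v.lap x) +
          ∫ x in Ω, f x ((u t).val x) * v.val x) = 0
  exterior : EqOnExt u φ
  initial : HasInitialValue T u 0
  initial_deriv : HasInitialValue T (fun t => (dt u t).val) 0

/-- The solution in `U₁` of the problem with nonlinearity `f` and exterior datum `φ`. -/
def solutionMap {n : ℕ} {s T : ℝ} (Ω : Set (Rn n)) (f : Rn n → ℝ → ℝ) (U₁ : Set (L2T n s T))
    (φ : ExtData Ω T) : L2T n s T :=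
  Classical.epsilon fun u => u ∈ U₁ ∧ IsSolution Ω f φ u

/-- The Dirichlet-to-Neumann map `⟨Λ_f φ, ψ⟩`
`= ∫_{ℝⁿ_T} (-Δ)^{s/2}u (-Δ)^{s/2}ψ dx dt + ∫_{ℝⁿ_T} (-Δ)^{s/2}∂_t u (-Δ)^{s/2}ψ dx dt`,
where `u` is the solution in `U₁` with exterior datum `φ`. -/
def dnMap {n : ℕ} {s T : ℝ} (Ω : Set (Rn n)) (f : Rn n → ℝ → ℝ) (U₁ : Set (L2T n s T))
    (φ : ExtData Ω T) (ψ : Rn n × ℝ → ℝ) : ℝ :=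
  (∫ t in Ioo (0 : ℝ) T, ∫ x, (solutionMap Ω f U₁ φ t).lap x *
      (Hs.ofFun s fun y => ψ (y, t)).lap x) +
    ∫ t in Ioo (0 : ℝ) T, ∫ x, (dt (solutionMap Ω f U₁ φ) t).lap x *
      (Hs.ofFun s fun y => ψ (y, t)).lap x

/-- Time reversal `ψ^⋆(x,t) = ψ(x,T-t)`. -/
def timeReversal {n : ℕ} (T : ℝ) (ψ : Rn n × ℝ → ℝ) : Rn n × ℝ → ℝ :=
  fun z => ψ (z.1, T - z.2)

end ViscousWave

end

open ViscousWave

open MeasureTheory Set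
open scoped ContDiff ENNReal

/-! Put U = u₁^{(1)} - u₁^{(2)} and w = u₂ - φ₂. Both take values in H̃^s(Ω): the two nonlinear
solutions share their exterior datum, and on a bounded Lipschitz domain an H^s function vanishing in
the exterior lies in H̃^s(Ω) (`mem_Htilde_of_eq_zero_exterior`). So w may test the difference of the
nonlinear equations and U may test the equation of u₂, the test function being run backwards in
time. For functions with zero initial data the operator ∂_t² + (-Δ)^s ∂_t + (-Δ)^s is symmetric for
the pairing ∫ ⟨·(t), ·(T-t)⟩ dt. Everything therefore cancels except the nonlinear term against w^⋆
and the energy pairings of U and ∂_t U with φ₂^⋆, which make up the difference of the DN maps. No L²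
pairing with φ₂ survives, because φ₂ lives over the exterior.

The second time derivative is avoided. Thanks to the zero initial velocity each equation can be
integrated once in time (`ae_integrated_equation`), and integration by parts becomes associativity
of convolution with the Heaviside function (`integral_bilin_primitive_sub`). The cancellation is
then the abstract computation `duality_identity`.

For the nonlinear term, r ≤ 2s/(n-2s) makes r + 2 strictly smaller than the critical exponent
2n/(n-2s). On the bounded set Ω a weak-type Sobolev inequality (`Hs.measure_gt_le`) is then enough
to make u ↦ (v ↦ f(u) v) continuous from H^s to the operators H^s → L¹(Ω)
(`GrowthAssumption.exists_nemytskii`). Solutions are primitives, hence continuous curves in H^s, so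
the integrand is integrable in time with values in L¹(Ω); this is the absolute convergence.

The remaining material is the theory of H^s needed for these points, obtained from the Fourier
transform: translations, mollification, multiplication by test functions, and smoothness in time of
test functions viewed as curves in H^s. -/

namespace ViscousWave

/-! ### Weak derivatives on an interval -/

section Interval

variable {E F G : Type*} [NormedAddCommGroup E] [NormedSpace ℝ E]
  [NormedAddCommGroup F] [NormedSpace ℝ F] [NormedAddCommGroup G] [NormedSpace ℝ G]

/-- Integration by parts for primitives, in bilinear form. -/
theorem integral_bilin_primitive [CompleteSpace E] [CompleteSpace F] [CompleteSpace G]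
    (B : E →L[ℝ] F →L[ℝ] G) {a : ℝ → E} {b : ℝ → F} {T : ℝ}
    (ha : IntegrableOn a (Ioo 0 T)) (hb : IntegrableOn b (Ioo 0 T)) :
    ∫ t in Ioo 0 T, B (∫ τ in Ioo 0 t, a τ) (b t) =
      ∫ τ in Ioo 0 T, B (a τ) (∫ t in Ioo τ T, b t) := by
  -- Both sides are the integral of B (a τ) (b t) over the triangle τ < t, so the claim is Fubini's
  -- theorem.
  have hint : Integrable (fun z : ℝ × ℝ => B (a z.1) (b z.2))
      ((volume.restrict (Ioo 0 T)).prod (volume.restrict (Ioo 0 T))) :=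
    ha.op_fst_snd (op := fun x y => B x y) (by fun_prop) ⟨‖B‖, B.le_opNorm₂⟩ hb
  have hmeas : MeasurableSet {z : ℝ × ℝ | z.1 < z.2} :=
    measurableSet_lt measurable_fst measurable_snd
  have hint2 := hint.indicator hmeas
  have hswap := integral_integral_swap (f := fun τ t => ({z : ℝ × ℝ | z.1 < z.2}).indicator
    (fun z : ℝ × ℝ => B (a z.1) (b z.2)) (τ, t)) hint2
  refine Eq.trans ?_ (hswap.symm.trans ?_)
  · refine setIntegral_congr_fun measurableSet_Ioo fun t ht => ?_
    have h1 : ∀ τ, ({z : ℝ × ℝ | z.1 < z.2}).indicator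
        (fun z : ℝ × ℝ => B (a z.1) (b z.2)) (τ, t) =
        (Iio t).indicator (fun τ => B.flip (b t) (a τ)) τ := fun τ => by
      by_cases h : τ < t <;> simp [indicator, h]
    simp only [h1]
    rw [setIntegral_indicator measurableSet_Iio]
    have h2 : Ioo 0 T ∩ Iio t = Ioo 0 t := by
      ext x; simp only [mem_inter_iff, mem_Ioo, mem_Iio] at ht ⊢
      constructor
      · rintro ⟨⟨_, _⟩, _⟩; constructor <;> linarith
      · rintro ⟨_, _⟩; refine ⟨⟨?_, ?_⟩, ?_⟩ <;> linarith [ht.2]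
    rw [h2, ContinuousLinearMap.integral_comp_comm _
      (ha.mono_set (Ioo_subset_Ioo_right ht.2.le))]
    rfl
  · refine setIntegral_congr_fun measurableSet_Ioo fun τ ht => ?_
    have h1 : ∀ t, ({z : ℝ × ℝ | z.1 < z.2}).indicator
        (fun z : ℝ × ℝ => B (a z.1) (b z.2)) (τ, t) =
        (Ioi τ).indicator (fun t => B (a τ) (b t)) t := fun t => by
      by_cases h : τ < t <;> simp [indicator, h]
    simp only [h1]
    rw [setIntegral_indicator measurableSet_Ioi]
    have h2 : Ioo 0 T ∩ Ioi τ = Ioo τ T := by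
      ext x; simp only [mem_inter_iff, mem_Ioo, mem_Ioi] at ht ⊢
      constructor
      · rintro ⟨⟨_, _⟩, _⟩; constructor <;> linarith
      · rintro ⟨_, _⟩; refine ⟨⟨?_, ?_⟩, ?_⟩ <;> linarith [ht.1]
    rw [h2, ContinuousLinearMap.integral_comp_comm _
      (hb.mono_set (Ioo_subset_Ioo_left ht.1.le))]

theorem integral_Ioo_comp_sub (T c d : ℝ) (b : ℝ → E) :
    ∫ t in Ioo c d, b (T - t) = ∫ t in Ioo (T - d) (T - c), b t := by
  have h := (volume.measurePreserving_sub_left T).setIntegral_preimage_emb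
    (Homeomorph.subLeft T).measurableEmbedding b (Ioo (T - d) (T - c))
  simpa using h

theorem ae_comp_sub {T : ℝ} {p : ℝ → Prop} (h : ∀ᵐ t ∂(volume.restrict (Ioo 0 T)), p t) :
    ∀ᵐ t ∂(volume.restrict (Ioo 0 T)), p (T - t) := by
  have := (volume.measurePreserving_sub_left T).restrict_preimage
    (s := Ioo 0 T) measurableSet_Ioo
  simp only [preimage_const_sub_Ioo, sub_self, sub_zero] at this
  exact this.quasiMeasurePreserving.ae h

omit [NormedSpace ℝ E] in
theorem integrableOn_comp_sub {T : ℝ} {b : ℝ → E} (h : IntegrableOn b (Ioo 0 T)) :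
    IntegrableOn (fun t => b (T - t)) (Ioo 0 T) := by
  have := (volume.measurePreserving_sub_left T).restrict_preimage
    (s := Ioo 0 T) measurableSet_Ioo
  simp only [preimage_const_sub_Ioo, sub_self, sub_zero] at this
  exact this.integrable_comp_of_integrable h

/-- Associativity of convolution with the Heaviside function on `(0,T)`. -/
theorem integral_bilin_primitive_sub [CompleteSpace E] [CompleteSpace F] [CompleteSpace G]
    (B : E →L[ℝ] F →L[ℝ] G) {a : ℝ → E} {b : ℝ → F} {T : ℝ}
    (ha : IntegrableOn a (Ioo 0 T)) (hb : IntegrableOn b (Ioo 0 T)) :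
    ∫ t in Ioo 0 T, B (∫ τ in Ioo 0 t, a τ) (b (T - t)) =
      ∫ t in Ioo 0 T, B (a t) (∫ τ in Ioo 0 (T - t), b τ) := by
  rw [integral_bilin_primitive B ha (integrableOn_comp_sub hb)]
  simp only [integral_Ioo_comp_sub, sub_self]

/-- A test function with vanishing mean is the derivative of a test function. -/
theorem exists_primitive_testFunction {T : ℝ} {θ : ℝ → ℝ}
    (hθ : θ ∈ CcInfty (Ioo (0 : ℝ) T)) (h0 : ∫ t, θ t = 0) :
    ∃ η ∈ CcInfty (Ioo (0 : ℝ) T), deriv η = θ := by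
  obtain ⟨hsm, hcs, hsub⟩ := hθ
  have hd : ∀ t, HasDerivAt (fun t => ∫ τ in (0 : ℝ)..t, θ τ) (θ t) t := fun t =>
    intervalIntegral.integral_hasDerivAt_right (hsm.continuous.intervalIntegrable _ _)
      hsm.continuous.aestronglyMeasurable.stronglyMeasurableAtFilter hsm.continuous.continuousAt
  have hderiv : deriv (fun t => ∫ τ in (0 : ℝ)..t, θ τ) = θ := funext fun t => (hd t).deriv
  by_cases hne : (tsupport θ).Nonempty
  · obtain ⟨c, hc⟩ := hcs.exists_isLeast hne
    obtain ⟨d, hd'⟩ := hcs.exists_isGreatest hne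
    have hc0 := hsub hc.1
    have hdT := hsub hd'.1
    have hzero : ∀ τ, τ ∉ Icc c d → θ τ = 0 := fun τ hτ => by
      by_contra hne0
      have : τ ∈ tsupport θ := subset_tsupport _ hne0
      exact hτ ⟨hc.2 this, hd'.2 this⟩
    -- To the left of the support the primitive vanishes trivially, to the right of it because θ has
    -- mean zero.
    have hsupp : tsupport (fun t => ∫ τ in (0 : ℝ)..t, θ τ) ⊆ Icc c d := by
      refine closure_minimal ?_ isClosed_Icc
      intro t ht
      by_contra hcd
      apply ht
      change ∫ τ in (0 : ℝ)..t, θ τ = 0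
      rcases lt_or_ge t c with h | h
      · refine intervalIntegral.integral_zero_ae (Filter.Eventually.of_forall fun τ hτ => ?_)
        refine hzero τ fun hh => ?_
        rcases mem_uIoc.mp hτ with h' | h'
        · linarith [h'.2, hh.1]
        · linarith [h'.2, hh.1, hc0.1]
      · have hdt : d < t := by
          by_contra h'
          exact hcd ⟨h, not_lt.mp h'⟩
        rw [intervalIntegral.integral_of_le (by linarith [hdT.1]), ← h0]
        refine setIntegral_eq_integral_of_forall_compl_eq_zero fun τ hτ => hzero τ fun hh => hτ ?_
        exact ⟨by linarith [hh.1, hc0.1], by linarith [hh.2]⟩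
    refine ⟨_, ⟨?_, ?_, ?_⟩, hderiv⟩
    · rw [contDiff_infty_iff_deriv, hderiv]
      exact ⟨fun t => (hd t).differentiableAt, hsm⟩
    · exact isCompact_Icc.of_isClosed_subset (isClosed_tsupport _) hsupp
    · exact hsupp.trans (Icc_subset_Ioo hc0.1 hdT.2)
  · have hz : θ = 0 := by
      rw [not_nonempty_iff_eq_empty] at hne
      exact tsupport_eq_empty_iff.mp hne
    refine ⟨0, ⟨contDiff_const, HasCompactSupport.zero, by simp [tsupport]⟩, ?_⟩
    rw [hz]; ext t; simp

theorem CcInfty.integrable {X : Type*} [NormedAddCommGroup X] [NormedSpace ℝ X]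
    [MeasurableSpace X] [OpensMeasurableSpace X] {μ : Measure X} [IsFiniteMeasureOnCompacts μ]
    {U : Set X} {g : X → ℝ} (hg : g ∈ CcInfty U) : Integrable g μ :=
  hg.1.continuous.integrable_of_hasCompactSupport hg.2.1

theorem CcInfty.eq_zero {X : Type*} [NormedAddCommGroup X] [NormedSpace ℝ X]
    {U : Set X} {g : X → ℝ} (hg : g ∈ CcInfty U) {x : X} (hx : x ∉ U) : g x = 0 :=
  image_eq_zero_of_notMem_tsupport fun h => hx (hg.2.2 h)

theorem CcInfty.deriv_mem {U : Set ℝ} {g : ℝ → ℝ} (hg : g ∈ CcInfty U) : deriv g ∈ CcInfty U :=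
  ⟨(contDiff_infty_iff_deriv.mp hg.1).2, hg.2.1.deriv,
    (tsupport_deriv_subset).trans hg.2.2⟩

theorem CcInfty.sub_mem {X : Type*} [NormedAddCommGroup X] [NormedSpace ℝ X]
    {U : Set X} {g h : X → ℝ} (hg : g ∈ CcInfty U) (hh : h ∈ CcInfty U) : g - h ∈ CcInfty U :=
  ⟨hg.1.sub hh.1, hg.2.1.sub hh.2.1,
    (tsupport_sub g h).trans (union_subset hg.2.2 hh.2.2)⟩

theorem CcInfty.const_smul_mem {X : Type*} [NormedAddCommGroup X] [NormedSpace ℝ X]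
    {U : Set X} {g : X → ℝ} (c : ℝ) (hg : g ∈ CcInfty U) : c • g ∈ CcInfty U :=
  ⟨hg.1.const_smul c, hg.2.1.mono' (subset_tsupport _ |>.trans' (by
    intro x hx; simp only [Function.mem_support, Pi.smul_apply, smul_eq_mul] at hx ⊢
    exact right_ne_zero_of_mul hx)),
    (closure_mono (by
      intro x hx; simp only [Function.mem_support, Pi.smul_apply, smul_eq_mul] at hx ⊢
      exact right_ne_zero_of_mul hx)).trans hg.2.2⟩

theorem CcInfty.bounded {X : Type*} [NormedAddCommGroup X] [NormedSpace ℝ X]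
    {U : Set X} {g : X → ℝ} (hg : g ∈ CcInfty U) : ∃ C, ∀ x, ‖g x‖ ≤ C :=
  hg.2.1.exists_bound_of_continuous hg.1.continuous

theorem CcInfty.integrable_smul {U S : Set ℝ} {η : ℝ → ℝ} (hη : η ∈ CcInfty U) {h : ℝ → E}
    (hh : IntegrableOn h S) : IntegrableOn (fun t => η t • h t) S := by
  obtain ⟨C, hC⟩ := CcInfty.bounded hη
  exact hh.bdd_smul C hη.1.continuous.aestronglyMeasurable (Filter.Eventually.of_forall hC)

theorem CcInfty.setIntegral_smul {T : ℝ} {η : ℝ → ℝ} (hη : η ∈ CcInfty (Ioo (0 : ℝ) T))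
    (h : ℝ → E) : ∫ t in Ioo (0 : ℝ) T, η t • h t = ∫ t, η t • h t :=
  setIntegral_eq_integral_of_forall_compl_eq_zero fun t ht => by
    rw [CcInfty.eq_zero hη ht, zero_smul]

theorem exists_testFunction_integral_eq_one {T : ℝ} (hT : 0 < T) :
    ∃ ρ ∈ CcInfty (Ioo (0 : ℝ) T), ∫ t, ρ t = 1 := by
  let f : ContDiffBump (T / 2) := ⟨T / 8, T / 4, by positivity, by linarith⟩
  refine ⟨f.normed volume, ⟨f.contDiff_normed, f.hasCompactSupport_normed, ?_⟩,
    f.integral_normed⟩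
  rw [f.tsupport_normed_eq, Real.closedBall_eq_Icc]
  refine Icc_subset_Ioo ?_ ?_ <;> simp only [f] <;> linarith

theorem ae_eq_zero_of_testFunctions [CompleteSpace E] {T : ℝ} {h : ℝ → E}
    (hh : IntegrableOn h (Ioo 0 T))
    (h0 : ∀ η ∈ CcInfty (Ioo (0 : ℝ) T), ∫ t in Ioo (0 : ℝ) T, η t • h t = 0) :
    ∀ᵐ t ∂(volume.restrict (Ioo (0 : ℝ) T)), h t = 0 := by
  rw [ae_restrict_iff' measurableSet_Ioo]
  refine isOpen_Ioo.ae_eq_zero_of_integral_contDiff_smul_eq_zero hh.locallyIntegrableOn ?_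
  intro g h1 h2 h3
  rw [← CcInfty.setIntegral_smul ⟨h1, h2, h3⟩, h0 g ⟨h1, h2, h3⟩]

/-- The lemma of du Bois-Reymond. -/
theorem ae_eq_const_of_weakDeriv_eq_zero [CompleteSpace E] {T : ℝ} (hT : 0 < T) {h : ℝ → E}
    (hh : IntegrableOn h (Ioo 0 T))
    (h0 : ∀ η ∈ CcInfty (Ioo (0 : ℝ) T), ∫ t in Ioo (0 : ℝ) T, deriv η t • h t = 0) :
    ∃ c : E, ∀ᵐ t ∂(volume.restrict (Ioo (0 : ℝ) T)), h t = c := by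
  obtain ⟨ρ, hρ, hρ1⟩ := exists_testFunction_integral_eq_one hT
  set c : E := ∫ t in Ioo (0 : ℝ) T, ρ t • h t with hc
  refine ⟨c, ?_⟩
  have hci : IntegrableOn (fun _ : ℝ => c) (Ioo 0 T) := integrableOn_const (by simp)
  have := ae_eq_zero_of_testFunctions (h := fun t => h t - c) (hh.sub hci) ?_
  · filter_upwards [this] with t ht using sub_eq_zero.mp ht
  intro θ hθ
  -- θ - mρ has mean zero, hence is the derivative of a test function. The hypothesis then gives ∫ θ
  -- h = m ∫ ρ h = m c.
  set m : ℝ := ∫ t, θ t with hm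
  have hθ' : θ - m • ρ ∈ CcInfty (Ioo (0 : ℝ) T) := CcInfty.sub_mem hθ (CcInfty.const_smul_mem m hρ)
  obtain ⟨η, hη, hηd⟩ := exists_primitive_testFunction hθ' (by
    simp only [Pi.sub_apply, Pi.smul_apply, smul_eq_mul]
    rw [integral_sub (CcInfty.integrable hθ) ((CcInfty.integrable hρ).const_mul _),
      integral_const_mul, hρ1, mul_one, hm, sub_self])
  have h1 := h0 η hη
  simp only [hηd, Pi.sub_apply, Pi.smul_apply, smul_eq_mul, sub_smul, mul_smul] at h1
  have hmi : IntegrableOn (fun t => m • ρ t • h t) (Ioo 0 T) :=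
    Integrable.fun_smul m (CcInfty.integrable_smul hρ hh)
  rw [integral_sub (CcInfty.integrable_smul hθ hh) hmi, integral_smul, ← hc, sub_eq_zero] at h1
  simp only [smul_sub]
  rw [integral_sub (CcInfty.integrable_smul hθ hh) (CcInfty.integrable_smul hθ hci), h1,
    CcInfty.setIntegral_smul hθ, integral_smul_const, ← hm, sub_self]

theorem setIntegral_Ioo_deriv {T : ℝ} {η : ℝ → ℝ} (hη : η ∈ CcInfty (Ioo (0 : ℝ) T))
    {t : ℝ} (ht : t ≤ T) : ∫ τ in Ioo t T, deriv η τ = - η t := by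
  rw [← integral_Ioc_eq_integral_Ioo, ← intervalIntegral.integral_of_le ht,
    intervalIntegral.integral_deriv_eq_sub]
  · rw [CcInfty.eq_zero hη (by simp), zero_sub]
  · exact fun x _ => (hη.1.differentiable (by simp)).differentiableAt
  · exact (CcInfty.deriv_mem hη).1.continuous.intervalIntegrable _ _

/-- The primitive of an integrable function has that function as weak derivative. -/
theorem weakDeriv_primitive [CompleteSpace E] {T : ℝ} {h : ℝ → E} (hh : IntegrableOn h (Ioo 0 T))
    {η : ℝ → ℝ} (hη : η ∈ CcInfty (Ioo (0 : ℝ) T)) :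
    ∫ t in Ioo (0 : ℝ) T, deriv η t • ∫ τ in Ioo 0 t, h τ =
      - ∫ t in Ioo (0 : ℝ) T, η t • h t := by
  have h1 := integral_bilin_primitive ((ContinuousLinearMap.lsmul ℝ ℝ : ℝ →L[ℝ] E →L[ℝ] E).flip)
    hh (CcInfty.integrable (μ := volume) (CcInfty.deriv_mem hη)).integrableOn
  simp only [ContinuousLinearMap.flip_apply, ContinuousLinearMap.lsmul_apply] at h1
  rw [h1, ← integral_neg]
  refine setIntegral_congr_fun measurableSet_Ioo fun t ht => ?_
  rw [setIntegral_Ioo_deriv hη ht.2.le, neg_smul]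

theorem continuous_primitive {h : ℝ → E} {T : ℝ} (hh : IntegrableOn h (Ioo 0 T)) :
    ContinuousOn (fun t => ∫ τ in Ioo 0 t, h τ) (Icc 0 T) := by
  have := intervalIntegral.continuousOn_primitive (a := 0) (b := T) (f := h) (μ := volume)
    ((integrableOn_Icc_iff_integrableOn_Ioo (by simp)).mpr hh)
  simpa only [integral_Ioc_eq_integral_Ioo] using this

theorem integrableOn_primitive {h : ℝ → E} {T : ℝ} (hh : IntegrableOn h (Ioo 0 T)) :
    IntegrableOn (fun t => ∫ τ in Ioo 0 t, h τ) (Ioo 0 T) :=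
  ((continuous_primitive hh).integrableOn_compact isCompact_Icc).mono_set Ioo_subset_Icc_self

theorem eq_of_ae_eq_const {X : Type*} [TopologicalSpace X] [T2Space X] {T : ℝ} (hT : 0 < T)
    {g : ℝ → X} {c : X} (hg : ContinuousOn g (Icc 0 T))
    (h : ∀ᵐ t ∂(volume.restrict (Ioo (0 : ℝ) T)), g t = c) : g 0 = c := by
  have h1 : EqOn g (fun _ => c) (Ioo 0 T) :=
    Measure.eqOn_open_of_ae_eq h isOpen_Ioo (hg.mono Ioo_subset_Icc_self) continuousOn_const
  have h2 : EqOn g (fun _ => c) (Icc 0 T) :=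
    h1.of_subset_closure hg continuousOn_const Ioo_subset_Icc_self
      (by rw [closure_Ioo hT.ne])
  exact h2 (left_mem_Icc.mpr hT.le)

/-- A function with integrable weak derivative and initial value zero is the primitive of its weak
derivative. -/
theorem ae_eq_primitive_of_weakDeriv [CompleteSpace E] {T : ℝ} (hT : 0 < T) {g h : ℝ → E}
    (hg : IntegrableOn g (Ioo 0 T)) (hh : IntegrableOn h (Ioo 0 T))
    (hw : ∀ η ∈ CcInfty (Ioo (0 : ℝ) T),
      ∫ t in Ioo (0 : ℝ) T, deriv η t • g t = - ∫ t in Ioo (0 : ℝ) T, η t • h t)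
    (h0 : HasInitialValue T g 0) :
    ∀ᵐ t ∂(volume.restrict (Ioo (0 : ℝ) T)), g t = ∫ τ in Ioo 0 t, h τ := by
  obtain ⟨c, hc⟩ := ae_eq_const_of_weakDeriv_eq_zero hT
    (h := fun t => g t - ∫ τ in Ioo 0 t, h τ) (hg.sub (integrableOn_primitive hh)) (by
      intro η hη
      simp only [smul_sub]
      rw [integral_sub (CcInfty.integrable_smul (CcInfty.deriv_mem hη) hg)
        (CcInfty.integrable_smul (CcInfty.deriv_mem hη) (integrableOn_primitive hh)), hw η hη,
        weakDeriv_primitive hh hη, sub_self])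
  obtain ⟨k, hk, hgk, hk0⟩ := h0
  -- The continuous representative minus the primitive is constant on all of [0,T], and both vanish
  -- at 0.
  have hc0 : c = 0 := by
    have := eq_of_ae_eq_const hT (g := fun t => k t - ∫ τ in Ioo 0 t, h τ) (c := c)
      (hk.sub (continuous_primitive hh)) (by
        filter_upwards [hc, hgk] with t h1 h2; rw [← h2, h1])
    simpa [hk0] using this.symm
  filter_upwards [hc] with t ht
  rw [hc0] at ht
  exact sub_eq_zero.mp ht

end Interval

/-! ### The Fourier transform on `L²` -/

section Fourier

open scoped FourierTransform SchwartzMap ComplexConjugate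

variable {n : ℕ}

/-- Complex valued `L²(ℝⁿ)`. -/
abbrev L2C (n : ℕ) : Type := Lp ℂ 2 (volume : Measure (Rn n))

theorem integral_mul_fourier_L2 (u : L2C n) {θ : Rn n → ℂ} (h1 : ContDiff ℝ ∞ θ)
    (h2 : HasCompactSupport θ) :
    ∫ ξ, θ ξ * (Lp.fourierTransformₗᵢ (Rn n) ℂ u : L2C n) ξ = ∫ x, 𝓕 θ x * u x := by
  have h := congrArg (fun F => F (h2.toSchwartzMap h1)) (Lp.fourier_toTemperedDistribution_eq u)
  simp only [TemperedDistribution.fourier_apply, Lp.toTemperedDistribution_apply,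
    SchwartzMap.fourier_coe, smul_eq_mul] at h
  exact h.symm

theorem Lp.locallyIntegrable_two (u : L2C n) : LocallyIntegrable u volume :=
  (Lp.memLp u).locallyIntegrable (by norm_num)

/-- A locally integrable function is determined by its pairings with real test functions, and
duality moves the transform onto the test function, where it is an honest integral. This is how
explicit formulas for the L² transform are obtained. -/
theorem fourier_L2_ae_eq (u : L2C n) {g : Rn n → ℂ} (hg : LocallyIntegrable g volume)
    (h : ∀ θ : Rn n → ℝ, ContDiff ℝ ∞ θ → HasCompactSupport θ →
      ∫ ξ, (θ ξ : ℂ) * g ξ = ∫ x, 𝓕 (fun ξ => (θ ξ : ℂ)) x * u x) :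
    (Lp.fourierTransformₗᵢ (Rn n) ℂ u : L2C n) =ᵐ[volume] g := by
  refine ae_eq_of_integral_contDiff_smul_eq (Lp.locallyIntegrable_two _) hg fun θ h1 h2 => ?_
  simp only [Complex.real_smul]
  rw [h θ h1 h2]
  exact integral_mul_fourier_L2 u (Complex.ofRealCLM.contDiff.comp h1)
    (h2.comp_left (g := Complex.ofReal) Complex.ofReal_zero)

theorem fourier_L2_toLp {g : Rn n → ℂ} (hg : Integrable g) (hg2 : MemLp g 2) :
    (Lp.fourierTransformₗᵢ (Rn n) ℂ (hg2.toLp g) : L2C n) =ᵐ[volume] 𝓕 g := by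
  have hcont : Continuous (𝓕 g) :=
    VectorFourier.fourierIntegral_continuous Real.continuous_fourierChar
      (by exact continuous_inner) hg
  refine fourier_L2_ae_eq _ hcont.locallyIntegrable fun θ h1 h2 => ?_
  have hθ : Integrable (fun ξ => (θ ξ : ℂ)) (volume : Measure (Rn n)) :=
    (h1.continuous.integrable_of_hasCompactSupport h2).ofReal
  have h := VectorFourier.integral_fourierIntegral_smul_eq_flip (L := innerₗ (Rn n))
    Real.continuous_fourierChar (by exact continuous_inner) hθ hg
  rw [flip_innerₗ] at h
  refine h.symm.trans (integral_congr_ae ?_)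
  filter_upwards [hg2.coeFn_toLp] with x hx
  rw [hx]; rfl

theorem fourier_ofReal_neg (θ : Rn n → ℝ) (x : Rn n) :
    𝓕 (fun ξ => ((θ (-ξ) : ℝ) : ℂ)) x = conj (𝓕 (fun ξ => ((θ ξ : ℝ) : ℂ)) x) := by
  rw [Real.fourier_eq', Real.fourier_eq', ← integral_conj, ← integral_neg_eq_self]
  refine integral_congr_ae (Filter.Eventually.of_forall fun ξ => ?_)
  simp [← Complex.exp_conj, Complex.conj_ofNat]

/-- Complex conjugation on `L²`. -/
noncomputable def conjL2 (u : L2C n) : L2C n := (Complex.conjCLE : ℂ →L[ℝ] ℂ).compLp u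

theorem coeFn_conjL2 (u : L2C n) : ∀ᵐ x, conjL2 u x = conj (u x) := by
  filter_upwards [(Complex.conjCLE : ℂ →L[ℝ] ℂ).coeFn_compLp u] with x hx
  rw [conjL2, hx]; rfl

theorem ae_neg {p : Rn n → Prop} (h : ∀ᵐ x, p x) : ∀ᵐ x, p (-x) :=
  (Measure.measurePreserving_neg (volume : Measure (Rn n))).quasiMeasurePreserving.ae h

/-- Obtained by conjugating the duality formula for the reflected test function θ(-ξ). Since real
functions are the fixed points of `conjL2`, this identifies their transforms with the Hermitian
symmetric ones and allows Fourier multipliers to be inverted within real L². -/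
theorem fourier_conjL2 (u : L2C n) : ∀ᵐ ξ, (Lp.fourierTransformₗᵢ (Rn n) ℂ (conjL2 u) : L2C n) ξ =
    conj ((Lp.fourierTransformₗᵢ (Rn n) ℂ u : L2C n) (-ξ)) := by
  set U : L2C n := Lp.fourierTransformₗᵢ (Rn n) ℂ u with hU
  have hli : LocallyIntegrable (fun ξ => conj (U (-ξ))) volume := by
    have h1 : MemLp (fun ξ => U (-ξ)) 2 volume :=
      (Lp.memLp U).comp_measurePreserving (Measure.measurePreserving_neg _)
    exact h1.star.locallyIntegrable (by norm_num)
  refine fourier_L2_ae_eq _ hli fun θ h1 h2 => ?_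
  have h := congrArg conj (integral_mul_fourier_L2 u (θ := fun ξ => ((θ (-ξ) : ℝ) : ℂ))
    (Complex.ofRealCLM.contDiff.comp (h1.comp contDiff_neg))
    ((h2.comp_homeomorph (Homeomorph.neg _)).comp_left (g := Complex.ofReal) Complex.ofReal_zero))
  rw [← integral_conj, ← integral_conj, ← integral_neg_eq_self] at h
  simp only [map_mul, neg_neg, Complex.conj_ofReal, fourier_ofReal_neg, Complex.conj_conj] at h
  rw [← hU] at h
  rw [h]
  refine integral_congr_ae ?_
  filter_upwards [coeFn_conjL2 u] with x hx
  rw [hx]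

/-- The complexification of a real `L²` function. -/
noncomputable def cplx (u : L2 n) : L2C n := Complex.ofRealCLM.compLpL 2 volume u

theorem coeFn_cplx (u : L2 n) : ∀ᵐ x, cplx u x = (u x : ℂ) := by
  filter_upwards [Complex.ofRealCLM.coeFn_compLpL u] with x hx
  rw [cplx, hx]; rfl

theorem fourierL2_eq (u : L2 n) : fourierL2 u = Lp.fourierTransformₗᵢ (Rn n) ℂ (cplx u) := rfl

theorem norm_cplx (u : L2 n) : ‖cplx u‖ = ‖u‖ := by
  rw [Lp.norm_def, Lp.norm_def]
  congr 1
  refine eLpNorm_congr_norm_ae ?_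
  filter_upwards [coeFn_cplx u] with x hx
  rw [hx]; simp

theorem norm_fourierL2 (u : L2 n) : ‖fourierL2 u‖ = ‖u‖ := by
  rw [fourierL2_eq, LinearIsometryEquiv.norm_map, norm_cplx]

theorem exists_cplx_eq {W : L2C n} (hW : conjL2 W = W) : ∃ w : L2 n, cplx w = W := by
  refine ⟨Complex.reCLM.compLp W, ?_⟩
  ext1
  have h := coeFn_conjL2 W
  rw [hW] at h
  filter_upwards [coeFn_cplx (Complex.reCLM.compLp W), Complex.reCLM.coeFn_compLp W, h]
    with x h1 h2 h3
  rw [h1, h2]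
  exact Complex.conj_eq_iff_re.mp h3.symm

theorem conjL2_cplx (u : L2 n) : conjL2 (cplx u) = cplx u := by
  ext1
  filter_upwards [coeFn_conjL2 (cplx u), coeFn_cplx u] with x h1 h2
  rw [h1, h2, Complex.conj_ofReal]

theorem fourierL2_neg (u : L2 n) : ∀ᵐ ξ, fourierL2 u ξ = conj (fourierL2 u (-ξ)) := by
  have := fourier_conjL2 (cplx u)
  rwa [conjL2_cplx] at this

/-- A real `L²` function with a given Hermitian Fourier transform. -/
theorem exists_fourierL2_eq {g : Rn n → ℂ} (hg : MemLp g 2)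
    (hsymm : ∀ᵐ ξ, g ξ = conj (g (-ξ))) : ∃ w : L2 n, fourierL2 w =ᵐ[volume] g := by
  set W : L2C n := (Lp.fourierTransformₗᵢ (Rn n) ℂ).symm (hg.toLp g) with hW
  have hFW : Lp.fourierTransformₗᵢ (Rn n) ℂ W = hg.toLp g := by simp [hW]
  have hconj : conjL2 W = W := by
    apply (Lp.fourierTransformₗᵢ (Rn n) ℂ).injective
    ext1
    have h := fourier_conjL2 W
    rw [hFW] at h ⊢
    filter_upwards [h, hsymm, hg.coeFn_toLp, ae_neg hg.coeFn_toLp] with ξ h1 h2 h3 h4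
    rw [h1, h3, h4, ← h2]
  obtain ⟨w, hw⟩ := exists_cplx_eq hconj
  refine ⟨w, ?_⟩
  rw [fourierL2_eq, hw, hFW]
  exact hg.coeFn_toLp

theorem fourierL2_injective : Function.Injective (fourierL2 : L2 n → L2C n) := by
  intro u v h
  have h1 : fourierL2 (u - v) = 0 := by
    have := fourierL2_add (u - v) v
    rw [sub_add_cancel, h] at this
    exact left_eq_add.mp (this.trans (add_comm _ _))
  rw [← sub_eq_zero, ← norm_eq_zero, ← norm_fourierL2, h1, norm_zero]

end Fourier

/-! ### The space `H^s(ℝⁿ)` -/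

section Sobolev

open scoped FourierTransform SchwartzMap ComplexConjugate

variable {n : ℕ} {s : ℝ}

/-- The symbol of `(-Δ)^{s/2}`. -/
noncomputable def lapSymbol (s : ℝ) (ξ : Rn n) : ℝ := (2 * Real.pi * ‖ξ‖) ^ s

theorem lapSymbol_nonneg (ξ : Rn n) : 0 ≤ lapSymbol s ξ := by
  unfold lapSymbol; positivity

theorem lapSymbol_neg (ξ : Rn n) : lapSymbol s (-ξ) = lapSymbol s ξ := by
  simp [lapSymbol]

theorem continuous_lapSymbol (hs : 0 < s) : Continuous (lapSymbol (n := n) s) := by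
  unfold lapSymbol
  exact (continuous_const.mul continuous_norm).rpow_const fun _ => Or.inr hs.le

theorem Hs.fourier_lap (u : Hs n s) :
    ∀ᵐ ξ, fourierL2 u.lap ξ = (lapSymbol s ξ : ℂ) * fourierL2 u.val ξ := u.2

/-- The element of `H^s` with given components. -/
noncomputable def Hs.mk (u w : L2 n) (h : IsHalfLaplacian s u w) : Hs n s := ⟨WithLp.toLp 2 (u, w), h⟩

/-- The second component is determined by the first because its Fourier transform is prescribed by
the symbol. -/
theorem Hs.ext_val {u v : Hs n s} (h : u.val = v.val) : u = v := by
  have h2 : u.lap = v.lap := by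
    apply fourierL2_injective
    ext1
    filter_upwards [u.fourier_lap, v.fourier_lap] with ξ h1 h2
    rw [h1, h2, h]
  apply Subtype.ext
  apply (WithLp.equiv 2 _).injective
  exact Prod.ext h h2

theorem Hs.norm_sq (u : Hs n s) : ‖u‖ ^ 2 = ‖u.val‖ ^ 2 + ‖u.lap‖ ^ 2 := by
  have := WithLp.prod_norm_sq_eq_of_L2 (u : WithLp 2 (L2 n × L2 n))
  exact this

/-- `H^s(ℝⁿ) → L²(ℝⁿ)`. -/
noncomputable def Hs.valL (n : ℕ) (s : ℝ) : Hs n s →L[ℝ] L2 n :=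
  (WithLp.fstL 2 ℝ (L2 n) (L2 n)).comp (sobolev n s).subtypeL

/-- `(-Δ)^{s/2} : H^s(ℝⁿ) → L²(ℝⁿ)`. -/
noncomputable def Hs.lapL (n : ℕ) (s : ℝ) : Hs n s →L[ℝ] L2 n :=
  (WithLp.sndL 2 ℝ (L2 n) (L2 n)).comp (sobolev n s).subtypeL

theorem Hs.valL_apply (u : Hs n s) : Hs.valL n s u = u.val := rfl

theorem Hs.val_add (u v : Hs n s) : (u + v).val = u.val + v.val := rfl
theorem Hs.val_sub (u v : Hs n s) : (u - v).val = u.val - v.val := rfl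

theorem Hs.norm_val_le (u : Hs n s) : ‖u.val‖ ≤ ‖u‖ := by
  nlinarith [u.norm_sq, norm_nonneg u, norm_nonneg u.val, sq_nonneg ‖u.lap‖]

theorem Hs.norm_lap_le (u : Hs n s) : ‖u.lap‖ ≤ ‖u‖ := by
  nlinarith [u.norm_sq, norm_nonneg u, norm_nonneg u.lap, sq_nonneg ‖u.val‖]

theorem Hs.norm_le (u : Hs n s) : ‖u‖ ≤ ‖u.val‖ + ‖u.lap‖ := by
  nlinarith [u.norm_sq, norm_nonneg u, norm_nonneg u.lap, norm_nonneg u.val]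

/-- An `L²` function belongs to `H^s` as soon as its Fourier transform has enough decay. -/
theorem Hs.exists_val_eq (u : L2 n)
    (hu : MemLp (fun ξ => (lapSymbol s ξ : ℂ) * fourierL2 u ξ) 2) : ∃ v : Hs n s, v.val = u := by
  obtain ⟨w, hw⟩ := exists_fourierL2_eq hu (by
    filter_upwards [fourierL2_neg u] with ξ h1
    rw [h1, lapSymbol_neg, map_mul, Complex.conj_ofReal, ← h1])
  exact ⟨Hs.mk u w hw, rfl⟩

theorem Hs.memLp_symbol (u : Hs n s) :
    MemLp (fun ξ => (lapSymbol s ξ : ℂ) * fourierL2 u.val ξ) 2 :=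
  (memLp_congr_ae u.fourier_lap).mp (Lp.memLp (fourierL2 u.lap))

end Sobolev

/-! ### The subcritical Sobolev embedding -/

section Embedding

open scoped FourierTransform SchwartzMap ComplexConjugate

variable {n : ℕ} {s : ℝ}

theorem lintegral_enorm_mul_le {α E F : Type*} [MeasurableSpace α] {μ : Measure α}
    [NormedAddCommGroup E] [NormedAddCommGroup F] {f : α → E} {g : α → F}
    (hf : AEStronglyMeasurable f μ) (hg : AEStronglyMeasurable g μ) :
    ∫⁻ x, ‖f x‖ₑ * ‖g x‖ₑ ∂μ ≤ eLpNorm f 2 μ * eLpNorm g 2 μ := by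
  have h := ENNReal.lintegral_mul_le_Lp_mul_Lq μ Real.HolderConjugate.two_two
    hf.enorm hg.enorm
  rw [eLpNorm_eq_lintegral_rpow_enorm_toReal (by simp) (by simp),
    eLpNorm_eq_lintegral_rpow_enorm_toReal (by simp) (by simp)]
  simpa using h

theorem eLpNorm_fourierL2 (u : L2 n) : eLpNorm (fourierL2 u) 2 volume = ENNReal.ofReal ‖u‖ := by
  rw [← norm_fourierL2, Lp.norm_def, ENNReal.ofReal_toReal (Lp.eLpNorm_ne_top _)]

theorem inner_cplx (u v : L2 n) : inner ℂ (cplx u) (cplx v) = ((∫ x, u x * v x : ℝ) : ℂ) := by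
  rw [L2.inner_def, ← integral_complex_ofReal]
  refine integral_congr_ae ?_
  filter_upwards [coeFn_cplx u, coeFn_cplx v] with x h1 h2
  rw [h1, h2]
  simp [mul_comm]

/-- Plancherel, followed by the triangle inequality; the right-hand side can be split into low and
high frequencies. -/
theorem ofReal_integral_mul_le (u v : L2 n) :
    ENNReal.ofReal (∫ x, u x * v x) ≤ ∫⁻ ξ, ‖fourierL2 u ξ‖ₑ * ‖fourierL2 v ξ‖ₑ := by
  have h1 : ((∫ x, u x * v x : ℝ) : ℂ) = ∫ ξ, inner ℂ (fourierL2 u ξ) (fourierL2 v ξ) := by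
    rw [← inner_cplx, ← L2.inner_def, fourierL2_eq, fourierL2_eq, LinearIsometryEquiv.inner_map_map]
  have h2 : ENNReal.ofReal (∫ x, u x * v x) ≤ ‖((∫ x, u x * v x : ℝ) : ℂ)‖ₑ := by
    rw [← ofReal_norm, Complex.norm_real]
    exact ENNReal.ofReal_le_ofReal (le_abs_self _)
  refine h2.trans ?_
  rw [h1]
  refine (enorm_integral_le_lintegral_enorm _).trans (lintegral_mono fun ξ => ?_)
  rw [← enorm_mul, RCLike.inner_apply, enorm_mul, mul_comm, enorm_mul]
  simp [enorm_eq_nnnorm]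

theorem rpow_le_one_add_rpow {x σ s : ℝ} (hx : 0 ≤ x) (hσ : 0 < σ) (hσs : σ ≤ s) :
    x ^ σ ≤ 1 + x ^ s := by
  rcases le_total x 1 with h | h
  · have := Real.rpow_le_one hx h hσ.le
    have := Real.rpow_nonneg hx s
    linarith
  · have := Real.rpow_le_rpow_of_exponent_le h hσs
    linarith

theorem norm_rpow_le_lapSymbol {σ : ℝ} (hσ : 0 < σ) (hσs : σ ≤ s) (ξ : Rn n) :
    ‖ξ‖ ^ σ ≤ 1 + lapSymbol s ξ := by
  refine (rpow_le_one_add_rpow (norm_nonneg ξ) hσ hσs).trans ?_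
  have : ‖ξ‖ ^ s ≤ lapSymbol s ξ := by
    refine Real.rpow_le_rpow (norm_nonneg _) ?_ (hσ.trans_le hσs).le
    nlinarith [Real.pi_gt_three, norm_nonneg ξ]
  linarith

/-- Orders σ smaller than s are allowed so that the case 2s ≥ n can be reduced to some σ with 2σ <
n. -/
theorem Hs.eLpNorm_weight_le {σ : ℝ} (hσ : 0 < σ) (hσs : σ ≤ s) (u : Hs n s) :
    eLpNorm (fun ξ => ((‖ξ‖ ^ σ : ℝ) : ℂ) * fourierL2 u.val ξ) 2 volume ≤
      ENNReal.ofReal (2 * ‖u‖) := by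
  have h1 : eLpNorm (fun ξ => ((‖ξ‖ ^ σ : ℝ) : ℂ) * fourierL2 u.val ξ) 2 volume ≤
      eLpNorm ((fun ξ => ‖fourierL2 u.val ξ‖) + fun ξ => ‖fourierL2 u.lap ξ‖) 2 volume := by
    refine eLpNorm_mono_ae ?_
    filter_upwards [u.fourier_lap] with ξ hξ
    have hw := norm_rpow_le_lapSymbol hσ hσs ξ
    have h0 : 0 ≤ ‖ξ‖ ^ σ := by positivity
    simp only [Pi.add_apply]
    rw [hξ, norm_mul, norm_mul, Complex.norm_real, Complex.norm_real,
      Real.norm_of_nonneg h0, Real.norm_of_nonneg (lapSymbol_nonneg ξ), Real.norm_of_nonneg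
        (add_nonneg (norm_nonneg _) (mul_nonneg (lapSymbol_nonneg ξ) (norm_nonneg _)))]
    nlinarith [norm_nonneg (fourierL2 u.val ξ)]
  refine h1.trans ((eLpNorm_add_le (Lp.aestronglyMeasurable _).norm
    (Lp.aestronglyMeasurable _).norm (by norm_num)).trans ?_)
  rw [eLpNorm_norm, eLpNorm_norm, eLpNorm_fourierL2, eLpNorm_fourierL2, ← ENNReal.ofReal_add
    (norm_nonneg _) (norm_nonneg _)]
  refine ENNReal.ofReal_le_ofReal ?_
  linarith [u.norm_val_le, u.norm_lap_le]

/-- In polar coordinates ‖ξ‖^(-2σ) is integrable near 0 because 2σ < n, and by homogeneity its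
integral over the ball of radius A is A^(n-2σ) times that over the unit ball. -/
theorem exists_eLpNorm_ball_rpow (hn : 0 < n) {σ : ℝ} (hσn : 2 * σ < n) :
    ∃ κ : ℝ, 0 < κ ∧ ∀ A > 0, eLpNorm (fun ξ : Rn n => ‖ξ‖ ^ (-σ)) 2
      (volume.restrict (Metric.ball 0 A)) ≤ ENNReal.ofReal (κ * A ^ (n / 2 - σ)) := by
  have : Nonempty (Fin n) := ⟨⟨0, hn⟩⟩
  have hsq : ∀ A : ℝ, eLpNorm (fun ξ : Rn n => ‖ξ‖ ^ (-σ)) 2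
      (volume.restrict (Metric.ball 0 A)) =
        (∫⁻ ξ in Metric.ball (0 : Rn n) A, ENNReal.ofReal (‖ξ‖ ^ (-(2 * σ)))) ^ (1 / 2 : ℝ) := by
    intro A
    rw [eLpNorm_eq_lintegral_rpow_enorm_toReal (by simp) (by simp)]
    simp only [ENNReal.toReal_ofNat]
    congr 1
    refine lintegral_congr fun ξ => ?_
    rw [← ofReal_norm, Real.norm_of_nonneg (by positivity),
      ENNReal.ofReal_rpow_of_nonneg (by positivity) (by norm_num), ← Real.rpow_mul (norm_nonneg _)]
    congr 2; ring
  have hint : ∀ A : ℝ, 0 < A →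
      IntegrableOn (fun ξ : Rn n => ‖ξ‖ ^ (-(2 * σ))) (Metric.ball 0 A) := by
    intro A hA
    rw [integrableOn_fun_norm_addHaar volume (f := fun y : ℝ => y ^ (-(2 * σ)))]
    have : IntegrableOn (fun y : ℝ => y ^ ((n : ℝ) - 1 - 2 * σ)) (Ioo 0 A) :=
      (intervalIntegral.integrableOn_Ioo_rpow_iff hA).mpr (by linarith)
    refine this.congr_fun (fun y hy => ?_) measurableSet_Ioo
    simp only [finrank_euclideanSpace, Fintype.card_fin, smul_eq_mul]
    rw [← Real.rpow_natCast, ← Real.rpow_add hy.1, Nat.cast_sub hn, Nat.cast_one]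
    congr 1
  set I : ℝ := ∫ ξ in Metric.ball (0 : Rn n) 1, ‖ξ‖ ^ (-(2 * σ)) with hI
  have hI0 : 0 ≤ I := setIntegral_nonneg measurableSet_ball fun ξ _ => by positivity
  have hscale : ∀ A : ℝ, 0 < A → ∫ ξ in Metric.ball (0 : Rn n) A, ‖ξ‖ ^ (-(2 * σ)) =
      A ^ ((n : ℝ) - 2 * σ) * I := by
    intro A hA
    have h := Measure.setIntegral_comp_smul_of_pos (volume : Measure (Rn n))
      (fun ξ => ‖ξ‖ ^ (-(2 * σ))) (Metric.ball (0 : Rn n) 1) hA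
    rw [smul_unitBall_of_pos hA] at h
    simp only [finrank_euclideanSpace, Fintype.card_fin, smul_eq_mul, norm_smul,
      Real.norm_of_nonneg hA.le, Real.mul_rpow hA.le (norm_nonneg _)] at h
    rw [integral_const_mul, ← hI] at h
    have hA' : (A ^ n)⁻¹ ≠ 0 := by positivity
    have h2 : (A : ℝ) ^ ((n : ℝ) - 2 * σ) = A ^ n * A ^ (-(2 * σ)) := by
      rw [sub_eq_add_neg, Real.rpow_add hA, Real.rpow_natCast]
    rw [h2, mul_assoc, h]
    field_simp
  -- √I is the true constant; the added 1 makes κ positive without a lower bound on I.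
  refine ⟨Real.sqrt I + 1, by positivity, fun A hA => ?_⟩
  rw [hsq, ← ofReal_integral_eq_lintegral_ofReal (hint A hA)
    (Filter.Eventually.of_forall fun ξ => by positivity), hscale A hA,
    ENNReal.ofReal_rpow_of_nonneg (by positivity) (by norm_num)]
  refine ENNReal.ofReal_le_ofReal ?_
  rw [Real.mul_rpow (by positivity) hI0, ← Real.rpow_mul hA.le, ← Real.sqrt_eq_rpow, mul_comm]
  have : ((n : ℝ) - 2 * σ) * (1 / 2) = n / 2 - σ := by ring
  rw [this]
  have := Real.rpow_nonneg hA.le ((n : ℝ) / 2 - σ)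
  nlinarith

/-- The weak-type form of the Sobolev inequality. -/
theorem Hs.measure_gt_le (hn : 0 < n) {σ : ℝ} (hσ : 0 < σ) (hσs : σ ≤ s) (hσn : 2 * σ < n) :
    ∃ C : ℝ, 0 ≤ C ∧ ∀ u : Hs n s, ‖u‖ ≤ 1 → ∀ l : ℝ, 0 < l →
      volume {x | l < |u.val x|} ≤ ENNReal.ofReal (C * l ^ (-(2 * n / (n - 2 * σ)))) := by
  obtain ⟨κ, hκ, hball⟩ := exists_eLpNorm_ball_rpow hn hσn
  have hd : 0 < (n : ℝ) / 2 - σ := by linarith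
  refine ⟨16 * (4 * κ) ^ (2 * σ / (n / 2 - σ)), by positivity, fun u hu l hl => ?_⟩
  set E : Set (Rn n) := {x | l < |u.val x|} with hE
  have hum : StronglyMeasurable (u.val : Rn n → ℝ) := Lp.stronglyMeasurable _
  have hEm : MeasurableSet E := measurableSet_lt measurable_const hum.norm.measurable
  have hEfin : volume E < ⊤ := by
    have h1 := (Lp.memLp u.val).meas_ge_lt_top (by simp) (by simp) (ε := l.toNNReal)
      (by simpa using hl)
    refine (measure_mono fun x hx => ?_).trans_lt h1
    have hx' : l < |u.val x| := hx
    rw [mem_ofPred_eq, ← NNReal.coe_le_coe, Real.coe_toNNReal _ hl.le, coe_nnnorm, Real.norm_eq_abs]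
    exact hx'.le
  set m : ℝ := (volume E).toReal with hm
  have hm0 : 0 ≤ m := ENNReal.toReal_nonneg
  have hEm' : volume E = ENNReal.ofReal m := (ENNReal.ofReal_toReal hEfin.ne).symm
  -- Testing u with its sign on the level set E bounds l·m from above by ∫ g u. The transform of g
  -- is at most ‖g‖_{L¹} ≤ m pointwise and at most √m in L².
  set g : Rn n → ℝ := E.indicator (fun x => (SignType.sign (u.val x) : ℝ)) with hg
  have hgm : AEStronglyMeasurable g volume := by
    refine (Measurable.indicator ?_ hEm).aestronglyMeasurable
    have : Measurable (fun x : ℝ => (SignType.sign x : ℝ)) := by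
      have : (fun x : ℝ => (SignType.sign x : ℝ)) =
          fun x => if 0 < x then 1 else if x < 0 then -1 else 0 := by
        ext x; rw [sign_apply]; split_ifs <;> simp
      rw [this]
      exact Measurable.ite measurableSet_Ioi measurable_const
        (Measurable.ite measurableSet_Iio measurable_const measurable_const)
    exact this.comp hum.measurable
  have hgle : ∀ x, ‖g x‖ ≤ E.indicator (fun _ => (1 : ℝ)) x := by
    intro x
    by_cases hx : x ∈ E
    · simp only [hg, indicator_of_mem hx, Real.norm_eq_abs]
      rcases lt_trichotomy (u.val x) 0 with h | h | h <;> simp [h]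
    · simp [hg, indicator_of_notMem hx]
  have hgLp : ∀ p : ℝ≥0∞, MemLp g p volume := fun p =>
    (memLp_indicator_const p hEm (1 : ℝ) (Or.inr hEfin.ne)).mono hgm
      (Filter.Eventually.of_forall fun x => (hgle x).trans (le_abs_self _))
  set G : L2 n := (hgLp 2).toLp g with hG
  have hGn : eLpNorm (fourierL2 G) 2 volume ≤ ENNReal.ofReal (Real.sqrt m) := by
    rw [eLpNorm_fourierL2, Lp.norm_toLp, ENNReal.ofReal_toReal (hgLp 2).2.ne]
    refine (eLpNorm_mono_real hgle).trans ?_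
    rw [eLpNorm_indicator_const hEm (by simp) (by simp), hEm',
      ENNReal.ofReal_rpow_of_nonneg hm0 (by simp), Real.sqrt_eq_rpow]
    simp
  have hGsup : ∀ᵐ ξ, ‖fourierL2 G ξ‖ₑ ≤ ENNReal.ofReal m := by
    have hgi : Integrable (fun x => (g x : ℂ)) := (memLp_one_iff_integrable.mp (hgLp 1)).ofReal
    have hg2 : MemLp (fun x => (g x : ℂ)) 2 := (hgLp 2).ofReal
    have hGc : cplx G = hg2.toLp _ := by
      ext1
      filter_upwards [coeFn_cplx G, (hgLp 2).coeFn_toLp, hg2.coeFn_toLp] with x h1 h2 h3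
      rw [h1, h3, hG, h2]
    have h := fourier_L2_toLp hgi hg2
    rw [← hGc, ← fourierL2_eq] at h
    filter_upwards [h] with ξ hξ
    rw [hξ, ← ofReal_norm]
    refine ENNReal.ofReal_le_ofReal ?_
    refine (VectorFourier.norm_fourierIntegral_le_integral_norm _ _ _ _ _).trans ?_
    have : ∫ x, E.indicator (fun _ => (1 : ℝ)) x = m := by
      rw [integral_indicator hEm, setIntegral_const, smul_eq_mul, mul_one]; rfl
    rw [← this]
    refine integral_mono hgi.norm ?_ fun x => ?_
    · exact (integrable_indicator_iff hEm).mpr (integrableOn_const hEfin.ne)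
    · simpa using hgle x
  have hlow : l * m ≤ ∫ x, G x * u.val x := by
    have hgu : ∀ᵐ x, G x * u.val x = E.indicator (fun x => |u.val x|) x := by
      filter_upwards [(hgLp 2).coeFn_toLp] with x hx
      rw [hG, hx, hg]
      by_cases hxE : x ∈ E
      · simp [indicator_of_mem hxE, sign_mul_self]
      · simp [indicator_of_notMem hxE]
    rw [integral_congr_ae hgu, integral_indicator hEm]
    have hui : IntegrableOn (fun x => |u.val x|) E := by
      have : IsFiniteMeasure (volume.restrict E) := ⟨by simpa using hEfin⟩
      exact (((Lp.memLp u.val).restrict E).integrable (by norm_num)).abs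
    have := setIntegral_mono_on (integrableOn_const (C := l) hEfin.ne) hui hEm
      (fun x hx => le_of_lt hx)
    rw [setIntegral_const, smul_eq_mul, mul_comm] at this
    exact this
  set û := fourierL2 u.val with hû
  set ĝ := fourierL2 G with hĝ
  have hûm : AEStronglyMeasurable û volume := Lp.aestronglyMeasurable _
  have hĝm : AEStronglyMeasurable ĝ volume := Lp.aestronglyMeasurable _
  have hwm : AEStronglyMeasurable (fun ξ => ((‖ξ‖ ^ σ : ℝ) : ℂ) * û ξ) volume := by
    refine AEStronglyMeasurable.mul ?_ hûm
    exact (Complex.continuous_ofReal.comp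
      (continuous_norm.rpow_const fun _ => Or.inr hσ.le)).aestronglyMeasurable
  have hw2 : eLpNorm (fun ξ => ((‖ξ‖ ^ σ : ℝ) : ℂ) * û ξ) 2 volume ≤ 2 := by
    refine (u.eLpNorm_weight_le hσ hσs).trans ?_
    exact (ENNReal.ofReal_le_ofReal (by linarith : 2 * ‖u‖ ≤ 2)).trans_eq (by simp)
  have : Nontrivial (Rn n) := by
    have : Nonempty (Fin n) := ⟨⟨0, hn⟩⟩
    infer_instance
  -- Frequencies are split at radius A. Low ones use the pointwise bound m on ĝ together with
  -- Cauchy–Schwarz for ‖ξ‖^(-σ) against ‖ξ‖^σ û. High ones use the gain A^(-σ) and the L² bound √m.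
  have key : ∀ A : ℝ, 0 < A →
      l * m ≤ 2 * m * (κ * A ^ (n / 2 - σ)) + 2 * A ^ (-σ) * Real.sqrt m := by
    intro A hA
    have h1 : ∫⁻ ξ in Metric.ball 0 A, ‖ĝ ξ‖ₑ * ‖û ξ‖ₑ ≤
        ENNReal.ofReal (2 * m * (κ * A ^ (n / 2 - σ))) := by
      calc ∫⁻ ξ in Metric.ball 0 A, ‖ĝ ξ‖ₑ * ‖û ξ‖ₑ
          ≤ ∫⁻ ξ in Metric.ball 0 A, ENNReal.ofReal m *
            (‖‖ξ‖ ^ (-σ)‖ₑ * ‖((‖ξ‖ ^ σ : ℝ) : ℂ) * û ξ‖ₑ) := by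
            refine lintegral_mono_ae (ae_restrict_of_ae ?_)
            filter_upwards [hGsup, Measure.ae_ne volume (0 : Rn n)] with ξ hξ h0
            refine mul_le_mul' hξ (le_of_eq ?_)
            have h0' : 0 < ‖ξ‖ := norm_pos_iff.mpr h0
            rw [enorm_mul, ← mul_assoc, ← ofReal_norm (‖ξ‖ ^ (-σ)),
              ← ofReal_norm (((‖ξ‖ ^ σ : ℝ) : ℂ)), Complex.norm_real, ← ENNReal.ofReal_mul (norm_nonneg _), ← norm_mul,
              ← Real.rpow_add h0']
            simp
        _ ≤ ENNReal.ofReal m * (ENNReal.ofReal (κ * A ^ (n / 2 - σ)) * 2) := by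
            rw [lintegral_const_mul' _ _ ENNReal.ofReal_ne_top]
            gcongr
            refine (lintegral_enorm_mul_le ?_ hwm.restrict).trans ?_
            · exact (measurable_norm.pow_const _).aestronglyMeasurable
            · exact mul_le_mul' (hball A hA)
                ((eLpNorm_mono_measure _ Measure.restrict_le_self).trans hw2)
        _ = ENNReal.ofReal (2 * m * (κ * A ^ (n / 2 - σ))) := by
            rw [← ENNReal.ofReal_ofNat 2, ← ENNReal.ofReal_mul (by positivity),
              ← ENNReal.ofReal_mul hm0]
            congr 1; ring
    have h2 : ∫⁻ ξ in (Metric.ball 0 A)ᶜ, ‖ĝ ξ‖ₑ * ‖û ξ‖ₑ ≤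
        ENNReal.ofReal (2 * A ^ (-σ) * Real.sqrt m) := by
      calc ∫⁻ ξ in (Metric.ball 0 A)ᶜ, ‖ĝ ξ‖ₑ * ‖û ξ‖ₑ
          ≤ ∫⁻ ξ in (Metric.ball 0 A)ᶜ, ENNReal.ofReal (A ^ (-σ)) *
            (‖ĝ ξ‖ₑ * ‖((‖ξ‖ ^ σ : ℝ) : ℂ) * û ξ‖ₑ) := by
            refine setLIntegral_mono_ae' measurableSet_ball.compl
              (Filter.Eventually.of_forall fun ξ hξ => ?_)
            rw [mul_left_comm]
            gcongr
            have hξ' : A ≤ ‖ξ‖ := by simpa using hξ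
            rw [enorm_mul, ← mul_assoc, ← ofReal_norm (((‖ξ‖ ^ σ : ℝ) : ℂ)),
              Complex.norm_real, Real.norm_of_nonneg (by positivity),
              ← ENNReal.ofReal_mul (by positivity)]
            refine le_mul_of_one_le_left' ?_
            rw [ENNReal.one_le_ofReal, Real.rpow_neg hA.le, inv_mul_eq_div,
              one_le_div (by positivity)]
            exact Real.rpow_le_rpow hA.le hξ' hσ.le
        _ ≤ ENNReal.ofReal (A ^ (-σ)) * (ENNReal.ofReal (Real.sqrt m) * 2) := by
            rw [lintegral_const_mul' _ _ ENNReal.ofReal_ne_top]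
            gcongr
            refine (lintegral_enorm_mul_le hĝm.restrict hwm.restrict).trans ?_
            exact mul_le_mul' ((eLpNorm_mono_measure _ Measure.restrict_le_self).trans hGn)
                ((eLpNorm_mono_measure _ Measure.restrict_le_self).trans hw2)
        _ = ENNReal.ofReal (2 * A ^ (-σ) * Real.sqrt m) := by
            rw [← ENNReal.ofReal_ofNat 2, ← ENNReal.ofReal_mul (by positivity),
              ← ENNReal.ofReal_mul (by positivity)]
            congr 1; ring
    have h3 := (ENNReal.ofReal_le_ofReal hlow).trans (ofReal_integral_mul_le G u.val)
    rw [← lintegral_add_compl _ (measurableSet_ball (x := (0 : Rn n)) (ε := A))] at h3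
    have h4 := h3.trans (add_le_add h1 h2)
    rw [← ENNReal.ofReal_add (by positivity) (by positivity)] at h4
    exact (ENNReal.ofReal_le_ofReal_iff (by positivity)).mp h4
  rw [hEm']
  refine ENNReal.ofReal_le_ofReal ?_
  set d : ℝ := (n : ℝ) / 2 - σ with hdd
  -- With this radius the low-frequency term is exactly l·m/2 and is absorbed on the left.
  set A : ℝ := (l / (4 * κ)) ^ (1 / d) with hA
  have hA0 : 0 < A := by positivity
  have hAd : A ^ d = l / (4 * κ) := by
    rw [hA, ← Real.rpow_mul (by positivity), one_div_mul_cancel hd.ne', Real.rpow_one]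
  have hk := key A hA0
  rw [hAd] at hk
  have hk1 : 2 * m * (κ * (l / (4 * κ))) = l * m / 2 := by field_simp; ring
  rw [hk1] at hk
  have hm4 : l * Real.sqrt m ≤ 4 * A ^ (-σ) := by
    rcases hm0.eq_or_lt with h | h
    · rw [← h]; simp; positivity
    · have hsm : 0 < Real.sqrt m := Real.sqrt_pos.mpr h
      have h5 : Real.sqrt m * Real.sqrt m = m := Real.mul_self_sqrt hm0
      have : l * (Real.sqrt m * Real.sqrt m) ≤ 4 * A ^ (-σ) * Real.sqrt m := by
        rw [h5]; linarith
      nlinarith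
  have hm5 : l ^ 2 * m ≤ 16 * A ^ (-(2 * σ)) := by
    have h5 : Real.sqrt m * Real.sqrt m = m := Real.mul_self_sqrt hm0
    have h6 : A ^ (-(2 * σ)) = A ^ (-σ) * A ^ (-σ) := by
      rw [← Real.rpow_add hA0]; congr 1; ring
    have h7 : 0 ≤ l * Real.sqrt m := by positivity
    rw [h6]
    calc l ^ 2 * m = (l * Real.sqrt m) * (l * Real.sqrt m) := by rw [← h5]; ring_nf; simp
      _ ≤ (4 * A ^ (-σ)) * (4 * A ^ (-σ)) := mul_le_mul hm4 hm4 h7 (by positivity)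
      _ = _ := by ring
  have hA2 : A ^ (-(2 * σ)) = (4 * κ) ^ (2 * σ / d) * l ^ (-(2 * σ / d)) := by
    rw [hA, ← Real.rpow_mul (by positivity), Real.div_rpow hl.le (by positivity),
      show 1 / d * -(2 * σ) = -(2 * σ / d) by ring, Real.rpow_neg (by positivity : 0 ≤ 4 * κ)]
    field_simp
  have hexp : -(2 * (n : ℝ) / (n - 2 * σ)) = -(2 * σ / d) + (-2 : ℝ) := by
    have h8 : (n : ℝ) - 2 * σ = 2 * d := by rw [hdd]; ring
    rw [h8]
    have : (n : ℝ) = 2 * d + 2 * σ := by rw [hdd]; ring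
    rw [this]
    field_simp
    ring
  rw [hexp, Real.rpow_add hl, show (-2 : ℝ) = ((-2 : ℤ) : ℝ) by norm_num, Real.rpow_intCast,
    zpow_neg]
  rw [hA2] at hm5
  have hl2 : (0 : ℝ) < l ^ 2 := by positivity
  rw [← le_div_iff₀' hl2] at hm5
  refine hm5.trans (le_of_eq ?_)
  rw [div_eq_mul_inv]
  norm_cast
  ring

end Embedding

/-! ### Subcritical integrability on sets of finite measure -/

section Subcritical

variable {n : ℕ} {s : ℝ}

/-- Layer-cake formula. Levels below 1 are controlled by the finite measure of Ω, levels above 1 by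
the weak-type bound, whose decay is integrable because q is strictly below the critical exponent.
Thus no strong-type Sobolev inequality is required. -/
theorem Hs.exists_lintegral_rpow_le_of_lt (hn : 0 < n) {σ q : ℝ} (hσ : 0 < σ) (hσs : σ ≤ s)
    (hσn : 2 * σ < n) (hq : 0 < q) (hqσ : q < 2 * n / (n - 2 * σ)) {Ω : Set (Rn n)}
    (hΩ : volume Ω ≠ ⊤) :
    ∃ C : ℝ, 0 ≤ C ∧ ∀ u : Hs n s, ‖u‖ ≤ 1 →
      ∫⁻ x in Ω, ENNReal.ofReal (|u.val x| ^ q) ≤ ENNReal.ofReal C := by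
  obtain ⟨C, hC, hweak⟩ := Hs.measure_gt_le (s := s) hn hσ hσs hσn
  set p : ℝ := 2 * n / (n - 2 * σ) with hp
  set c : ℝ≥0∞ := ENNReal.ofReal q * (∫⁻ t in Ioc (0 : ℝ) 1, volume Ω * ENNReal.ofReal (t ^ (q - 1)))
    + ENNReal.ofReal q * (∫⁻ t in Ioi (1 : ℝ), ENNReal.ofReal (C * t ^ (-p + (q - 1)))) with hc
  have hcfin : c ≠ ⊤ := by
    have h1 : IntegrableOn (fun t : ℝ => t ^ (q - 1)) (Ioc 0 1) :=
      (integrableOn_Ioc_iff_integrableOn_Ioo (by simp)).mpr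
        ((intervalIntegral.integrableOn_Ioo_rpow_iff one_pos).mpr (by linarith))
    have h2 : IntegrableOn (fun t : ℝ => C * t ^ (-p + (q - 1))) (Ioi 1) :=
      (integrableOn_Ioi_rpow_of_lt (by linarith) one_pos).const_mul C
    refine ENNReal.add_ne_top.mpr ⟨ENNReal.mul_ne_top ENNReal.ofReal_ne_top ?_,
      ENNReal.mul_ne_top ENNReal.ofReal_ne_top ?_⟩
    · rw [lintegral_const_mul' _ _ hΩ]
      exact ENNReal.mul_ne_top hΩ h1.lintegral_lt_top.ne
    · exact h2.lintegral_lt_top.ne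
  refine ⟨c.toReal, ENNReal.toReal_nonneg, fun u hu => ?_⟩
  rw [ENNReal.ofReal_toReal hcfin]
  have hum : AEMeasurable (fun x => |u.val x|) (volume.restrict Ω) :=
    (Lp.aestronglyMeasurable u.val).aemeasurable.abs.restrict
  rw [lintegral_rpow_eq_lintegral_meas_lt_mul _ (Filter.Eventually.of_forall fun x => abs_nonneg _)
    hum hq, ← Ioc_union_Ioi_eq_Ioi (zero_le_one (α := ℝ)),
    lintegral_union measurableSet_Ioi (Ioc_disjoint_Ioi le_rfl), mul_add, hc]
  refine add_le_add (mul_le_mul' le_rfl (lintegral_mono fun t => mul_le_mul' ?_ le_rfl))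
    (mul_le_mul' le_rfl ?_)
  · refine (measure_mono (subset_univ _)).trans ?_
    rw [Measure.restrict_apply_univ]
  · refine setLIntegral_mono' measurableSet_Ioi fun t ht => ?_
    have ht0 : 0 < t := lt_trans one_pos ht
    rw [Real.rpow_add ht0, ← mul_assoc, ENNReal.ofReal_mul (by positivity)]
    gcongr
    exact (Measure.restrict_le_self _).trans (hweak u hu t ht0)

theorem Hs.exists_lintegral_rpow_le (hn : 0 < n) (hs : 0 < s) {q : ℝ} (hq : 0 < q)
    (hsub : 2 * s < n → q < 2 * n / (n - 2 * s)) {Ω : Set (Rn n)} (hΩ : volume Ω ≠ ⊤) :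
    ∃ C : ℝ, 0 ≤ C ∧ ∀ u : Hs n s, ‖u‖ ≤ 1 →
      ∫⁻ x in Ω, ENNReal.ofReal (|u.val x| ^ q) ≤ ENNReal.ofReal C := by
  by_cases h : 2 * s < n
  · exact Hs.exists_lintegral_rpow_le_of_lt hn hs le_rfl h hq (hsub h) hΩ
  · have hn' : (0 : ℝ) < n := Nat.cast_pos.mpr hn
    -- For σ = n/2 - δ the critical exponent is n/δ ≥ 2q > q. The bound δ ≤ n/4 keeps σ positive,
    -- and σ ≤ s follows from 2s ≥ n.
    set δ : ℝ := min (n / 4) (n / (2 * q)) with hδ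
    have hδ0 : 0 < δ := lt_min (by positivity) (by positivity)
    have h1 : δ ≤ n / 4 := min_le_left _ _
    have h2 : δ ≤ n / (2 * q) := min_le_right _ _
    refine Hs.exists_lintegral_rpow_le_of_lt (σ := n / 2 - δ) hn (by linarith) (by linarith)
      (by linarith) hq ?_ hΩ
    rw [show (n : ℝ) - 2 * (n / 2 - δ) = 2 * δ by ring, lt_div_iff₀ (by positivity)]
    rw [le_div_iff₀ (by positivity)] at h2
    nlinarith

theorem Hs.smul_val_ae (c : ℝ) (u : Hs n s) : ∀ᵐ x, (c • u).val x = c * u.val x :=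
  Lp.coeFn_smul c u.val

theorem Hs.val_ae_eq_zero {u : Hs n s} (hu : ‖u‖ = 0) : ∀ᵐ x, u.val x = 0 := by
  rw [norm_eq_zero] at hu
  rw [hu]
  exact Lp.coeFn_zero ℝ 2 volume

theorem rpow_mul_mul_le {a b c r : ℝ} (ha : 0 ≤ a) (hb : 0 ≤ b) (hc : 0 ≤ c) (hr : 0 < r) :
    a ^ r * b * c ≤ a ^ (r + 2) + b ^ (r + 2) + c ^ (r + 2) := by
  set m := max a (max b c) with hm
  have h1 : a ≤ m := le_max_left _ _
  have h2 : b ≤ m := (le_max_left _ _).trans (le_max_right _ _)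
  have h3 : c ≤ m := (le_max_right _ _).trans (le_max_right _ _)
  have hm0 : 0 ≤ m := ha.trans h1
  have h4 : a ^ r * b * c ≤ m ^ r * m * m := by
    gcongr
  have h5 : m ^ r * m * m = m ^ (r + 2) := by
    rw [Real.rpow_add' hm0 (by linarith)]; norm_cast; ring
  have h6 : 0 ≤ a ^ (r + 2) := by positivity
  have h7 : 0 ≤ b ^ (r + 2) := by positivity
  have h8 : 0 ≤ c ^ (r + 2) := by positivity
  rw [h5] at h4
  refine h4.trans ?_
  rcases max_cases a (max b c) with h | h
  · rw [hm, h.1]; linarith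
  · rcases max_cases b c with h' | h'
    · rw [hm, h.1, h'.1]; linarith
    · rw [hm, h.1, h'.1]; linarith

/-- The trilinear estimate behind the continuity of the Nemytskii operator. -/
theorem Hs.exists_lintegral_rpow_mul_mul_le (hn : 0 < n) (hs : 0 < s) {r : ℝ} (hr : 0 < r)
    (hsub : 2 * s < n → r ≤ 2 * s / (n - 2 * s)) {Ω : Set (Rn n)} (hΩ : volume Ω ≠ ⊤) :
    ∃ K : ℝ, 0 ≤ K ∧ ∀ a b c : Hs n s,
      ∫⁻ x in Ω, ENNReal.ofReal (|a.val x| ^ r * |b.val x| * |c.val x|) ≤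
        ENNReal.ofReal (K * (‖a‖ ^ r * ‖b‖ * ‖c‖)) := by
  -- The growth restriction gives r + 2 ≤ (2n - 2s)/(n - 2s) < 2n/(n - 2s), so the exponent is
  -- strictly subcritical.
  obtain ⟨C, hC, hle⟩ := Hs.exists_lintegral_rpow_le (s := s) (q := r + 2) hn hs (by linarith)
    (fun h => by
      have h1 := hsub h
      have h2 : 0 < (n : ℝ) - 2 * s := by linarith
      rw [le_div_iff₀ h2] at h1
      rw [lt_div_iff₀ h2]
      nlinarith) hΩ
  refine ⟨3 * C, by positivity, fun a b c => ?_⟩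
  by_cases h0 : ‖a‖ = 0 ∨ ‖b‖ = 0 ∨ ‖c‖ = 0
  · have : ∫⁻ x in Ω, ENNReal.ofReal (|a.val x| ^ r * |b.val x| * |c.val x|) = 0 := by
      rw [← lintegral_zero]
      refine lintegral_congr_ae (ae_restrict_of_ae ?_)
      rcases h0 with h | h | h
      · filter_upwards [Hs.val_ae_eq_zero h] with x hx
        simp [hx, Real.zero_rpow hr.ne']
      · filter_upwards [Hs.val_ae_eq_zero h] with x hx
        simp [hx]
      · filter_upwards [Hs.val_ae_eq_zero h] with x hx
        simp [hx]
    rw [this]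
    exact zero_le
  · simp only [not_or] at h0
    have ha : 0 < ‖a‖ := lt_of_le_of_ne (norm_nonneg _) (Ne.symm h0.1)
    have hb : 0 < ‖b‖ := lt_of_le_of_ne (norm_nonneg _) (Ne.symm h0.2.1)
    have hc : 0 < ‖c‖ := lt_of_le_of_ne (norm_nonneg _) (Ne.symm h0.2.2)
    have hnorm : ∀ u : Hs n s, 0 < ‖u‖ → ‖‖u‖⁻¹ • u‖ ≤ 1 := fun u hu => by
      rw [norm_smul, norm_inv, norm_norm, inv_mul_cancel₀ hu.ne']
    have hmeas : ∀ u : Hs n s, AEMeasurable (fun x => ENNReal.ofReal (|u.val x| ^ (r + 2)))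
        (volume.restrict Ω) := fun u =>
      ((Lp.aestronglyMeasurable u.val).aemeasurable.abs.pow_const _).ennreal_ofReal.restrict
    set N : ℝ := ‖a‖ ^ r * ‖b‖ * ‖c‖ with hN
    have hN0 : 0 ≤ N := by positivity
    -- Both sides have the same homogeneity in each argument, so a, b, c may be normalised; the
    -- product is then bounded by a sum of three powers of exponent r + 2, which accounts for the
    -- constant 3C.
    calc ∫⁻ x in Ω, ENNReal.ofReal (|a.val x| ^ r * |b.val x| * |c.val x|)
        ≤ ∫⁻ x in Ω, ENNReal.ofReal N *
          ((ENNReal.ofReal (|(‖a‖⁻¹ • a).val x| ^ (r + 2)) +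
            ENNReal.ofReal (|(‖b‖⁻¹ • b).val x| ^ (r + 2))) +
            ENNReal.ofReal (|(‖c‖⁻¹ • c).val x| ^ (r + 2))) := by
          refine lintegral_mono_ae (ae_restrict_of_ae ?_)
          filter_upwards [Hs.smul_val_ae ‖a‖⁻¹ a, Hs.smul_val_ae ‖b‖⁻¹ b,
            Hs.smul_val_ae ‖c‖⁻¹ c] with x h1 h2 h3
          rw [h1, h2, h3, ← ENNReal.ofReal_add (by positivity) (by positivity),
            ← ENNReal.ofReal_add (by positivity) (by positivity), ← ENNReal.ofReal_mul hN0]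
          refine ENNReal.ofReal_le_ofReal ?_
          have h4 := rpow_mul_mul_le (abs_nonneg (‖a‖⁻¹ * a.val x)) (abs_nonneg (‖b‖⁻¹ * b.val x))
            (abs_nonneg (‖c‖⁻¹ * c.val x)) hr
          refine le_trans (le_of_eq ?_) (mul_le_mul_of_nonneg_left h4 hN0)
          rw [abs_mul, abs_mul, abs_mul, abs_inv, abs_inv, abs_inv, abs_norm, abs_norm, abs_norm,
            Real.mul_rpow (by positivity) (abs_nonneg _), Real.inv_rpow ha.le, hN]
          have : ‖a‖ ^ r ≠ 0 := by positivity
          field_simp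
      _ ≤ ENNReal.ofReal N * ((ENNReal.ofReal C + ENNReal.ofReal C) + ENNReal.ofReal C) := by
          rw [lintegral_const_mul' _ _ ENNReal.ofReal_ne_top,
            lintegral_add_right' _ (hmeas _), lintegral_add_right' _ (hmeas _)]
          gcongr <;> exact hle _ (hnorm _ ‹_›)
      _ = ENNReal.ofReal (3 * C * N) := by
          rw [← ENNReal.ofReal_add hC hC, ← ENNReal.ofReal_add (by positivity) hC,
            ← ENNReal.ofReal_mul hN0]
          congr 1; ring

theorem Hs.lintegral_mul_le (Ω : Set (Rn n)) (b c : Hs n s) :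
    ∫⁻ x in Ω, ENNReal.ofReal (|b.val x| * |c.val x|) ≤ ENNReal.ofReal (‖b‖ * ‖c‖) := by
  have h := (lintegral_enorm_mul_le (μ := volume.restrict Ω)
    (Lp.aestronglyMeasurable b.val).restrict (Lp.aestronglyMeasurable c.val).restrict)
  have h1 : ∀ u : Hs n s, eLpNorm u.val 2 (volume.restrict Ω) ≤ ENNReal.ofReal ‖u‖ := fun u => by
    refine (eLpNorm_mono_measure _ Measure.restrict_le_self).trans ?_
    rw [← ENNReal.ofReal_toReal (Lp.eLpNorm_ne_top u.val), ← Lp.norm_def]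
    exact ENNReal.ofReal_le_ofReal u.norm_val_le
  rw [ENNReal.ofReal_mul (norm_nonneg _)]
  refine le_trans (le_of_eq ?_) (h.trans (mul_le_mul' (h1 b) (h1 c)))
  refine lintegral_congr fun x => ?_
  rw [ENNReal.ofReal_mul (abs_nonneg _), Real.enorm_eq_ofReal_abs, Real.enorm_eq_ofReal_abs]

end Subcritical

/-! ### The Nemytskii operator -/

section Nemytskii

variable {n : ℕ} {s : ℝ} {Ω : Set (Rn n)} {f : Rn n → ℝ → ℝ}

/-- For simple u the composition is a finite sum over the fibres of u; the general case is a limit,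
by continuity of f in the second variable. -/
theorem IsCaratheodory.aemeasurable_comp (hf : IsCaratheodory Ω f) {u : Rn n → ℝ}
    (hu : StronglyMeasurable u) : AEMeasurable (fun x => f x (u x)) (volume.restrict Ω) := by
  refine aemeasurable_of_tendsto_metrizable_ae (u := Filter.atTop)
    (f := fun (k : ℕ) x => f x (hu.approx k x)) (fun k => ?_) ?_
  · have h : (fun x => f x (hu.approx k x)) = fun x => ∑ τ ∈ (hu.approx k).range,
        (hu.approx k ⁻¹' {τ}).indicator (fun x => f x τ) x := by
      ext x
      rw [Finset.sum_eq_single (hu.approx k x)]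
      · rw [indicator_of_mem (by simp)]
      · intro τ _ hτ
        rw [indicator_of_notMem (by simpa using hτ.symm)]
      · intro h
        exact absurd (SimpleFunc.mem_range_self _ x) h
    rw [h]
    exact Finset.aemeasurable_fun_sum _ fun τ _ =>
      (hf.2 τ).indicator ((hu.approx k).measurableSet_fiber τ)
  · filter_upwards [hf.1] with x hx
    exact (hx.tendsto _).comp (hu.tendsto_approx x)

/-- Under the structural assumption the nonlinearity is locally Lipschitz in `τ`. -/
theorem GrowthAssumption.exists_lipschitz {a : Rn n → ℝ} {p : ℝ≥0∞} {r : ℝ}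
    (hf : GrowthAssumption Ω s f a p r) (hr : 0 < r) (ha : MemLp a ⊤ (volume.restrict Ω)) :
    ∃ M : ℝ, 0 ≤ M ∧ ∀ᵐ x ∂(volume.restrict Ω), ∀ τ τ' : ℝ,
      |f x τ - f x τ'| ≤ M * ((1 + |τ| ^ r + |τ'| ^ r) * |τ - τ'|) := by
  obtain ⟨C, hC⟩ := hf.bound
  set A : ℝ := (eLpNormEssSup a (volume.restrict Ω)).toReal with hA
  have haA : ∀ᵐ x ∂(volume.restrict Ω), |a x| ≤ A := by
    have hfin : eLpNormEssSup a (volume.restrict Ω) ≠ ⊤ := by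
      have := ha.2.ne; rwa [eLpNorm_exponent_top] at this
    filter_upwards [enorm_ae_le_eLpNormEssSup a (volume.restrict Ω)] with x hx
    have := ENNReal.toReal_mono hfin hx
    simpa using this
  have hA0 : 0 ≤ A := ENNReal.toReal_nonneg
  refine ⟨|C| * (A + 1), by positivity, ?_⟩
  filter_upwards [hC, haA, hf.differentiable] with x h1 h2 h3 τ τ'
  -- Between τ' and τ the growth of the derivative is governed by the endpoints, so the mean value
  -- inequality applies with a constant bound.
  have h4 : ∀ z ∈ uIcc τ' τ, ‖deriv (f x) z‖ ≤ |C| * (A + 1) * (1 + |τ| ^ r + |τ'| ^ r) := by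
    intro z hz
    have hz' : |z| ^ r ≤ |τ| ^ r + |τ'| ^ r := by
      have : |z| ≤ max |τ| |τ'| := by
        rcases mem_uIcc.mp hz with h | h
        · exact (abs_le_max_abs_abs h.1 h.2).trans_eq (max_comm _ _)
        · exact abs_le_max_abs_abs h.1 h.2
      refine (Real.rpow_le_rpow (abs_nonneg _) this hr.le).trans ?_
      have h5 : 0 ≤ |τ| ^ r := by positivity
      have h6 : 0 ≤ |τ'| ^ r := by positivity
      rcases max_cases |τ| |τ'| with h | h <;> rw [h.1] <;> linarith
    have h5 : 0 ≤ |z| ^ r := by positivity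
    rw [Real.norm_eq_abs]
    calc |deriv (f x) z| ≤ C * (a x + |z| ^ r) := h1 z
      _ ≤ |C| * (A + |z| ^ r) := by
          have h6 : |a x + |z| ^ r| ≤ A + |z| ^ r := by
            refine (abs_add_le _ _).trans ?_
            rw [abs_of_nonneg h5]; linarith
          refine (le_abs_self _).trans ?_
          rw [abs_mul]
          gcongr
      _ ≤ |C| * (A + 1) * (1 + |τ| ^ r + |τ'| ^ r) := by
          rw [mul_assoc]
          gcongr
          have h7 : 0 ≤ |τ| ^ r + |τ'| ^ r := h5.trans hz'
          nlinarith
  have h5 := Convex.norm_image_sub_le_of_norm_deriv_le (𝕜 := ℝ) (fun z _ => h3.differentiableAt) h4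
    (convex_uIcc τ' τ) left_mem_uIcc right_mem_uIcc
  rw [Real.norm_eq_abs, Real.norm_eq_abs] at h5
  rw [← mul_assoc]
  exact h5

/-- The Lipschitz bound splits into a bilinear term, handled by Cauchy–Schwarz, and two terms
covered by the trilinear estimate. The same inequality yields boundedness in v (taking u' = 0) and
continuity in u. -/
theorem GrowthAssumption.exists_lintegral_sub_le {a : Rn n → ℝ} {p : ℝ≥0∞} {r : ℝ}
    (hf : GrowthAssumption Ω s f a p r) (hn : 0 < n) (hs : 0 < s) (hr : 0 < r)
    (ha : MemLp a ⊤ (volume.restrict Ω)) (hΩ : volume Ω ≠ ⊤) :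
    ∃ M K : ℝ, 0 ≤ M ∧ 0 ≤ K ∧ ∀ u u' v : Hs n s,
      ∫⁻ x in Ω, ‖f x (u.val x) * v.val x - f x (u'.val x) * v.val x‖ₑ ≤
        ENNReal.ofReal (M * ((1 + K * ‖u‖ ^ r + K * ‖u'‖ ^ r) * ‖u - u'‖) * ‖v‖) := by
  obtain ⟨M, hM, hlip⟩ := hf.exists_lipschitz hr ha
  obtain ⟨K, hK, htri⟩ := Hs.exists_lintegral_rpow_mul_mul_le hn hs hr hf.r_subcritical hΩ
  have hmeas' : ∀ u : Hs n s, AEMeasurable (fun x => |u.val x|) (volume.restrict Ω) :=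
    fun u => (Lp.aestronglyMeasurable u.val).aemeasurable.abs.restrict
  refine ⟨M, K, hM, hK, ?_⟩
  intro u u' v
  calc ∫⁻ x in Ω, ‖f x (u.val x) * v.val x - f x (u'.val x) * v.val x‖ₑ
      ≤ ∫⁻ x in Ω, ENNReal.ofReal M * ((ENNReal.ofReal (|(u - u').val x| * |v.val x|) +
        ENNReal.ofReal (|u.val x| ^ r * |(u - u').val x| * |v.val x|)) +
        ENNReal.ofReal (|u'.val x| ^ r * |(u - u').val x| * |v.val x|)) := by
        refine lintegral_mono_ae ?_
        filter_upwards [hlip, ae_restrict_of_ae (Lp.coeFn_sub u.val u'.val)] with x h1 h2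
        rw [← ENNReal.ofReal_add (by positivity) (by positivity),
          ← ENNReal.ofReal_add (by positivity) (by positivity), ← ENNReal.ofReal_mul hM,
          Real.enorm_eq_ofReal_abs, ← sub_mul, abs_mul]
        refine ENNReal.ofReal_le_ofReal ?_
        rw [Hs.val_sub, h2, Pi.sub_apply]
        calc _ ≤ M * ((1 + |u.val x| ^ r + |u'.val x| ^ r) * |u.val x - u'.val x|) *
              |v.val x| := mul_le_mul_of_nonneg_right (h1 _ _) (abs_nonneg _)
          _ = _ := by ring
    _ ≤ ENNReal.ofReal M * ((ENNReal.ofReal (‖u - u'‖ * ‖v‖) +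
        ENNReal.ofReal (K * (‖u‖ ^ r * ‖u - u'‖ * ‖v‖))) +
        ENNReal.ofReal (K * (‖u'‖ ^ r * ‖u - u'‖ * ‖v‖))) := by
        rw [lintegral_const_mul' _ _ ENNReal.ofReal_ne_top, lintegral_add_right',
          lintegral_add_right']
        · gcongr
          · exact Hs.lintegral_mul_le Ω _ _
          · exact htri _ _ _
          · exact htri _ _ _
        · exact ((((hmeas' u).pow_const _).mul (hmeas' _)).mul (hmeas' v)).ennreal_ofReal
        · exact ((((hmeas' u').pow_const _).mul (hmeas' _)).mul (hmeas' v)).ennreal_ofReal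
    _ = _ := by
        rw [← ENNReal.ofReal_add (by positivity) (by positivity),
          ← ENNReal.ofReal_add (by positivity) (by positivity), ← ENNReal.ofReal_mul hM]
        congr 1; ring

theorem continuous_of_norm_sub_le {E F : Type*} [NormedAddCommGroup E] [NormedAddCommGroup F]
    {J : E → F} {b : E → E → ℝ} (hJ : ∀ u u', ‖J u - J u'‖ ≤ b u u')
    (hb : ∀ u', Continuous fun u => b u u') (hb0 : ∀ u', b u' u' = 0) : Continuous J := by
  refine continuous_iff_continuousAt.mpr fun u' => tendsto_iff_norm_sub_tendsto_zero.mpr ?_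
  refine squeeze_zero (fun _ => norm_nonneg _) (fun u => hJ u u') ?_
  have := (hb u').tendsto u'
  rwa [hb0] at this

/-- The Nemytskii operator `u ↦ (v ↦ f(u) v)` is continuous with values in the operators from
`H^s(ℝⁿ)` to `L¹(Ω)`. -/
theorem GrowthAssumption.exists_nemytskii {a : Rn n → ℝ} {p : ℝ≥0∞} {r : ℝ}
    (hf : GrowthAssumption Ω s f a p r) (hn : 0 < n) (hs : 0 < s) (hr : 0 < r)
    (ha : MemLp a ⊤ (volume.restrict Ω)) (hf0 : ∀ᵐ x ∂(volume.restrict Ω), f x 0 = 0)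
    (hΩ : volume Ω ≠ ⊤) :
    ∃ J : Hs n s → (Hs n s →L[ℝ] Lp ℝ 1 (volume.restrict Ω)), Continuous J ∧
      ∀ u v : Hs n s, ∀ᵐ x ∂(volume.restrict Ω), J u v x = f x (u.val x) * v.val x := by
  obtain ⟨M, K, hM, hK, hdiff⟩ := hf.exists_lintegral_sub_le hn hs hr ha hΩ
  have hmeas : ∀ u v : Hs n s, AEStronglyMeasurable (fun x => f x (u.val x) * v.val x)
      (volume.restrict Ω) := fun u v =>
    (hf.caratheodory.aemeasurable_comp (Lp.stronglyMeasurable u.val)).aestronglyMeasurable.mul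
      (Lp.aestronglyMeasurable v.val).restrict
  have hzero : ∀ᵐ x, (0 : Hs n s).val x = 0 := Lp.coeFn_zero ℝ 2 volume
  have hbd : ∀ u v : Hs n s, ∫⁻ x in Ω, ‖f x (u.val x) * v.val x‖ₑ ≤
      ENNReal.ofReal (M * ((1 + K * ‖u‖ ^ r) * ‖u‖) * ‖v‖) := by
    intro u v
    -- Comparison with u' = 0 bounds f(u) v itself, because f(·,0) = 0.
    have h := hdiff u 0 v
    rw [norm_zero, Real.zero_rpow hr.ne', mul_zero, add_zero, sub_zero] at h
    refine le_trans (le_of_eq (lintegral_congr_ae ?_)) h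
    filter_upwards [hf0, ae_restrict_of_ae hzero] with x h1 h2
    rw [h2, h1, zero_mul, sub_zero]
  have hint : ∀ u v : Hs n s, MemLp (fun x => f x (u.val x) * v.val x) 1 (volume.restrict Ω) :=
    fun u v => memLp_one_iff_integrable.mpr
      ⟨hmeas u v, (hbd u v).trans_lt ENNReal.ofReal_lt_top⟩
  have hae : ∀ u v : Hs n s, ∀ᵐ x ∂(volume.restrict Ω),
      (hint u v).toLp _ x = f x (u.val x) * v.val x := fun u v => (hint u v).coeFn_toLp
  obtain ⟨J, hJae⟩ : ∃ J : Hs n s → (Hs n s →L[ℝ] Lp ℝ 1 (volume.restrict Ω)), ∀ u v : Hs n s,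
      ∀ᵐ x ∂(volume.restrict Ω), J u v x = f x (u.val x) * v.val x := by
    let Jlin : Hs n s → (Hs n s →ₗ[ℝ] Lp ℝ 1 (volume.restrict Ω)) := fun u =>
      { toFun := fun v => (hint u v).toLp _
        map_add' := fun v w => by
          ext1
          filter_upwards [hae u (v + w), hae u v, hae u w, Lp.coeFn_add ((hint u v).toLp _)
            ((hint u w).toLp _), ae_restrict_of_ae (Lp.coeFn_add v.val w.val)] with x h1 h2 h3 h4 h5
          rw [h1, h4, Pi.add_apply, h2, h3, Hs.val_add, h5, Pi.add_apply, mul_add]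
        map_smul' := fun c v => by
          ext1
          filter_upwards [hae u (c • v), hae u v, Lp.coeFn_smul c ((hint u v).toLp _),
            ae_restrict_of_ae (Hs.smul_val_ae c v)] with x h1 h2 h3 h4
          rw [h1, RingHom.id_apply, h3, Pi.smul_apply, h2, h4, smul_eq_mul]
          ring }
    have hnorm1 : ∀ u v : Hs n s, ‖Jlin u v‖ ≤ M * ((1 + K * ‖u‖ ^ r) * ‖u‖) * ‖v‖ := by
      intro u v
      change ‖(hint u v).toLp _‖ ≤ _
      rw [Lp.norm_toLp, eLpNorm_one_eq_lintegral_enorm]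
      exact ENNReal.toReal_le_of_le_ofReal (by positivity) (hbd u v)
    let J : Hs n s → (Hs n s →L[ℝ] Lp ℝ 1 (volume.restrict Ω)) := fun u =>
      (Jlin u).mkContinuous _ (hnorm1 u)
    exact ⟨J, hae⟩
  refine ⟨J, ?_, hJae⟩
  have hJ : ∀ u u' : Hs n s,
      ‖J u - J u'‖ ≤ M * ((1 + K * ‖u‖ ^ r + K * ‖u'‖ ^ r) * ‖u - u'‖) := by
    intro u u'
    refine ContinuousLinearMap.opNorm_le_bound _ (by positivity) fun v => ?_
    rw [sub_apply, Lp.norm_def, eLpNorm_one_eq_lintegral_enorm]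
    refine ENNReal.toReal_le_of_le_ofReal (by positivity) (le_trans (le_of_eq ?_) (hdiff u u' v))
    refine lintegral_congr_ae ?_
    filter_upwards [hJae u v, hJae u' v, Lp.coeFn_sub (J u v) (J u' v)] with x h1 h2 h3
    rw [h3, Pi.sub_apply, h1, h2]
  refine continuous_of_norm_sub_le (F := Hs n s →L[ℝ] Lp ℝ 1 (volume.restrict Ω))
    (b := fun u u' => M * ((1 + K * ‖u‖ ^ r + K * ‖u'‖ ^ r) * ‖u - u'‖)) hJ (fun u' => ?_)
    fun u' => by simp
  have : Continuous fun u : Hs n s => ‖u‖ ^ r :=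
    continuous_norm.rpow_const fun _ => Or.inr hr.le
  fun_prop

end Nemytskii

/-! ### Translations -/

section Translation

open scoped FourierTransform SchwartzMap ComplexConjugate

variable {n : ℕ} {s : ℝ}

/-- Translation `u ↦ u(· - h)` on `L²(ℝⁿ)`. -/
noncomputable def translateL2 (h : Rn n) (u : L2 n) : L2 n :=
  Lp.compMeasurePreserving (fun x => x - h) (measurePreserving_sub_right volume h) u

theorem coeFn_translateL2 (h : Rn n) (u : L2 n) : ∀ᵐ x, translateL2 h u x = u (x - h) :=
  Lp.coeFn_compMeasurePreserving u (measurePreserving_sub_right volume h)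

theorem ae_sub_right {p : Rn n → Prop} (h : Rn n) (hp : ∀ᵐ x, p x) : ∀ᵐ x, p (x - h) :=
  (measurePreserving_sub_right volume h).quasiMeasurePreserving.ae hp

/-- The character `ξ ↦ exp(-2πi⟨h,ξ⟩)`. -/
noncomputable def phase (h ξ : Rn n) : ℂ :=
  Complex.exp (((-(2 * Real.pi * inner ℝ h ξ) : ℝ) : ℂ) * Complex.I)

theorem norm_phase (h ξ : Rn n) : ‖phase h ξ‖ = 1 := Complex.norm_exp_ofReal_mul_I _

theorem contDiff_phase (h : Rn n) : ContDiff ℝ ∞ (phase h) := by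
  unfold phase
  refine ContDiff.cexp (ContDiff.mul (Complex.ofRealCLM.contDiff.comp ?_) contDiff_const)
  exact (contDiff_const.mul (contDiff_const.inner ℝ contDiff_id)).neg

theorem phase_comm (h ξ : Rn n) : phase h ξ = phase ξ h := by
  simp [phase, real_inner_comm]

theorem fourier_eq_integral_phase (g : Rn n → ℂ) (x : Rn n) :
    𝓕 g x = ∫ ξ, phase ξ x * g ξ := by
  rw [Real.fourier_eq']
  simp only [phase, smul_eq_mul]
  simp

theorem phase_add (ξ x h : Rn n) : phase ξ (x + h) = phase ξ x * phase ξ h := by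
  simp only [phase, ← Complex.exp_add, inner_add_right]
  congr 1; push_cast; ring

/-- By duality: multiplying a test function by the phase shifts its Fourier integral, and the shift
passes to u by a change of variables. -/
theorem fourierL2_translate (h : Rn n) (u : L2 n) :
    ∀ᵐ ξ, fourierL2 (translateL2 h u) ξ = phase h ξ * fourierL2 u ξ := by
  rw [fourierL2_eq]
  have hmem : MemLp (fun ξ => phase h ξ * fourierL2 u ξ) 2 volume := by
    refine (Lp.memLp (fourierL2 u)).mono
      ((contDiff_phase h).continuous.aestronglyMeasurable.mul (Lp.aestronglyMeasurable _))
      (Filter.Eventually.of_forall fun ξ => ?_)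
    rw [norm_mul, norm_phase, one_mul]
  refine fourier_L2_ae_eq _ (hmem.locallyIntegrable (by norm_num)) fun θ h1 h2 => ?_
  have hθ1 : ContDiff ℝ ∞ fun ξ => (θ ξ : ℂ) * phase h ξ :=
    (Complex.ofRealCLM.contDiff.comp h1).mul (contDiff_phase h)
  have hθ2 : HasCompactSupport fun ξ => (θ ξ : ℂ) * phase h ξ :=
    (h2.comp_left (g := Complex.ofReal) Complex.ofReal_zero).mul_right
  have h3 := integral_mul_fourier_L2 (cplx u) hθ1 hθ2
  rw [← fourierL2_eq] at h3
  have h4 : ∀ x, 𝓕 (fun ξ => (θ ξ : ℂ) * phase h ξ) x = 𝓕 (fun ξ => (θ ξ : ℂ)) (x + h) := by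
    intro x
    rw [fourier_eq_integral_phase, fourier_eq_integral_phase]
    refine integral_congr_ae (Filter.Eventually.of_forall fun ξ => ?_)
    simp only [phase_add, phase_comm h ξ]
    ring
  simp only [h4, mul_assoc] at h3
  rw [h3, ← integral_sub_right_eq_self _ h]
  simp only [sub_add_cancel]
  refine integral_congr_ae ?_
  filter_upwards [ae_sub_right h (coeFn_cplx u), coeFn_cplx (translateL2 h u),
    coeFn_translateL2 h u] with x h5 h6 h7
  rw [h5, h6, h7]

/-- Translation on `H^s(ℝⁿ)`. -/
noncomputable def Hs.translate (h : Rn n) (u : Hs n s) : Hs n s :=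
  Hs.mk (translateL2 h u.val) (translateL2 h u.lap) (by
    filter_upwards [fourierL2_translate h u.val, fourierL2_translate h u.lap, u.fourier_lap]
      with ξ h1 h2 h3
    rw [h1, h2, h3, lapSymbol]
    ring)

theorem Hs.translate_val (h : Rn n) (u : Hs n s) :
    (Hs.translate h u).val = translateL2 h u.val := rfl

theorem Hs.coeFn_translate (h : Rn n) (u : Hs n s) :
    ∀ᵐ x, (Hs.translate h u).val x = u.val (x - h) := coeFn_translateL2 h u.val

theorem continuous_translateL2 (u : L2 n) : Continuous fun h => translateL2 h u := by
  refine Continuous.compMeasurePreservingLp (continuous_const (y := u))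
    (g := fun h => (⟨fun x => x - h, by fun_prop⟩ : C(Rn n, Rn n))) ?_
    (fun h => measurePreserving_sub_right volume h) (by simp)
  exact ContinuousMap.continuous_of_continuous_uncurry _ (by
    change Continuous fun p : Rn n × Rn n => p.2 - p.1
    fun_prop)

theorem Hs.continuous_translate (u : Hs n s) : Continuous fun h => Hs.translate h u := by
  refine Continuous.subtype_mk ?_ _
  exact (WithLp.prod_continuous_toLp 2 _ _).comp
    ((continuous_translateL2 u.val).prodMk (continuous_translateL2 u.lap))

theorem Hs.translate_zero (u : Hs n s) : Hs.translate 0 u = u := by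
  apply Hs.ext_val
  ext1
  filter_upwards [Hs.coeFn_translate 0 u] with x hx
  rw [hx, sub_zero]

end Translation

/-! ### Mollification -/

section Mollification

open scoped FourierTransform SchwartzMap ComplexConjugate

variable {n : ℕ} {s : ℝ}

open scoped Convolution

theorem Htilde.isClosed (s : ℝ) (Ω : Set (Rn n)) : IsClosed (Htilde s Ω : Set (Hs n s)) :=
  Submodule.isClosed_topologicalClosure _

theorem mem_Htilde_of_testFunction {Ω : Set (Rn n)} {u : Hs n s} {g : Rn n → ℝ}
    (hg : g ∈ CcInfty Ω) (hu : u.val =ᵐ[volume] g) : u ∈ Htilde s Ω :=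
  Submodule.le_topologicalClosure _ (Submodule.subset_span ⟨g, hg, hu⟩)

/-- The Bochner integral in `L²(ℝⁿ)` is computed pointwise. -/
theorem coeFn_integral_L2 {α : Type*} [MeasurableSpace α] {μ : Measure α} [SFinite μ]
    {F : α → L2 n} (hF : Integrable F μ) {f : Rn n → α → ℝ}
    (hf : Integrable (Function.uncurry f) (volume.prod μ))
    (hFf : ∀ᵐ a ∂μ, ∀ᵐ x, F a x = f x a) :
    ∀ᵐ x, (∫ a, F a ∂μ) x = ∫ a, f x a ∂μ := by
  refine ae_eq_of_integral_contDiff_smul_eq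
    ((Lp.memLp _).locallyIntegrable (by norm_num)) hf.integral_prod_left.locallyIntegrable
    fun g h1 h2 => ?_
  have hgm : MemLp g 2 volume := h1.continuous.memLp_of_hasCompactSupport h2
  obtain ⟨C, hC⟩ := h2.exists_bound_of_continuous h1.continuous
  have hinner : ∀ w : L2 n, inner ℝ (hgm.toLp g) w = ∫ x, g x * w x := fun w => by
    rw [L2.inner_def]
    refine integral_congr_ae ?_
    filter_upwards [hgm.coeFn_toLp] with x hx
    rw [hx]; simp [mul_comm]
  simp only [smul_eq_mul]
  rw [← hinner, ← integral_inner hF]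
  have h3 : ∀ᵐ a ∂μ, inner ℝ (hgm.toLp g) (F a) = ∫ x, g x * f x a := by
    filter_upwards [hFf] with a ha
    rw [hinner]
    refine integral_congr_ae ?_
    filter_upwards [ha] with x h4
    rw [h4]
  rw [integral_congr_ae h3, ← integral_integral_swap (f := fun x a => g x * f x a)]
  · simp only [integral_const_mul]
  · refine Integrable.bdd_mul (c := C) hf ?_ (Filter.Eventually.of_forall fun p => hC p.1)
    exact (h1.continuous.measurable.comp measurable_fst).aestronglyMeasurable

/-- A mollification is an average of translates. Read as a Bochner integral it can be estimated in
H^s, read pointwise it is a smooth convolution; this lemma identifies the two. -/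
theorem integral_translateL2_ae_eq {u : L2 n} {v : Rn n → ℝ} (hv : Integrable v)
    (huv : ∀ᵐ x, u x = v x) (φ : ContDiffBump (0 : Rn n)) :
    ∀ᵐ x, (∫ h, φ.normed volume h • translateL2 h u) x =
      (φ.normed volume ⋆[ContinuousLinearMap.lsmul ℝ ℝ] v) x := by
  have hprod : Integrable (fun p : Rn n × Rn n => φ.normed volume p.2 • v (p.1 - p.2))
      (volume.prod volume) :=
    φ.integrable_normed.convolution_integrand (ContinuousLinearMap.lsmul ℝ ℝ) hv
  refine coeFn_integral_L2 ?_ (f := fun x h => φ.normed volume h • v (x - h)) hprod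
    (Filter.Eventually.of_forall fun h => ?_)
  · exact (φ.continuous_normed.smul (continuous_translateL2 u)).integrable_of_hasCompactSupport
      φ.hasCompactSupport_normed.smul_right
  · filter_upwards [Lp.coeFn_smul (φ.normed volume h) (translateL2 h u), coeFn_translateL2 h u,
      ae_sub_right h huv] with x h3 h4 h5
    rw [h3, Pi.smul_apply, h4, h5]

/-- An element of `H^s(ℝⁿ)` supported in a compact subset of `Ω` belongs to `H̃^s(Ω)`. -/
theorem mem_Htilde_of_isCompact {Ω K : Set (Rn n)} (hΩ : IsOpen Ω) (hK : IsCompact K)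
    (hKΩ : K ⊆ Ω) (u : Hs n s) (hu : ∀ᵐ x, x ∉ K → u.val x = 0) : u ∈ Htilde s Ω := by
  obtain ⟨δ, hδ, hδΩ⟩ := hK.exists_cthickening_subset_open hΩ hKΩ
  -- This representative vanishes everywhere outside K, so the support of the convolution can be
  -- located pointwise.
  set v : Rn n → ℝ := K.indicator u.val with hv
  have hvi : Integrable v := by
    rw [hv, integrable_indicator_iff hK.measurableSet]
    exact ((Lp.memLp u.val).locallyIntegrable (by norm_num)).integrableOn_isCompact hK
  have huv : ∀ᵐ x, u.val x = v x := by
    filter_upwards [hu] with x hx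
    by_cases h : x ∈ K
    · simp [hv, h]
    · simp [hv, h, hx h]
  refine (Htilde.isClosed s Ω).closure_subset (Metric.mem_closure_iff.mpr fun ε hε => ?_)
  have hcont := (Hs.continuous_translate u).continuousAt (x := 0)
  rw [Metric.continuousAt_iff] at hcont
  obtain ⟨η, hη, hηε⟩ := hcont (ε / 2) (half_pos hε)
  set r : ℝ := min δ η with hr
  have hr0 : 0 < r := lt_min hδ hη
  let φ : ContDiffBump (0 : Rn n) := ⟨r / 2, r, half_pos hr0, half_lt_self hr0⟩
  have hint : Integrable (fun h => φ.normed volume h • Hs.translate h u) :=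
    (φ.continuous_normed.smul (Hs.continuous_translate u)).integrable_of_hasCompactSupport
      φ.hasCompactSupport_normed.smul_right
  refine ⟨∫ h, φ.normed volume h • Hs.translate h u, ?_, ?_⟩
  · refine mem_Htilde_of_testFunction
      (g := (φ.normed volume ⋆[ContinuousLinearMap.lsmul ℝ ℝ] v)) ⟨?_, ?_, ?_⟩ ?_
    · exact φ.hasCompactSupport_normed.contDiff_convolution_left _ φ.contDiff_normed
        hvi.locallyIntegrable
    · exact φ.hasCompactSupport_normed.convolution _ (HasCompactSupport.intro hK fun x hx => by
        simp [hv, hx])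
    · refine (closure_minimal ?_ Metric.isClosed_cthickening).trans hδΩ
      refine (support_convolution_subset _).trans ?_
      rw [φ.support_normed_eq]
      rintro _ ⟨a, ha, b, hb, rfl⟩
      have hb' : b ∈ K := by
        by_contra h; exact hb (by simp [hv, h])
      refine Metric.mem_cthickening_of_dist_le _ b _ _ hb' ?_
      have : ‖a‖ < r := by simpa using ha
      rw [dist_eq_norm, add_sub_cancel_right]
      exact this.le.trans (min_le_left _ _)
    · have h1 := (Hs.valL n s).integral_comp_comm hint
      simp only [map_smul, Hs.valL_apply, Hs.translate_val] at h1
      rw [← h1]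
      exact integral_translateL2_ae_eq hvi huv φ
  · have : SecondCountableTopologyEither (Rn n) (Hs n s) := secondCountableTopologyEither_of_left _ _
    -- The average of translates is the value at 0 of the H^s-valued convolution of φ with y ↦ u(· +
    -- y); continuity of translations in H^s makes it close to u.
    have h := φ.dist_normed_convolution_le (μ := volume) (x₀ := (0 : Rn n)) (ε := ε / 2)
      (g := fun y => Hs.translate (-y) u)
      ((Hs.continuous_translate u).comp continuous_neg).aestronglyMeasurable (by
        intro x hx
        have hx' : ‖x‖ < r := by simpa using hx
        rw [neg_zero]
        refine (hηε ?_).le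
        rw [dist_zero_right, norm_neg]
        exact hx'.trans_le (min_le_right _ _))
    simp only [convolution, ContinuousLinearMap.lsmul_apply, zero_sub, neg_neg, neg_zero,
      Hs.translate_zero] at h
    rw [dist_comm]
    exact h.trans_lt (half_lt_self hε)

end Mollification

/-! ### Multiplication by test functions -/

section Multiplication

open scoped FourierTransform SchwartzMap ComplexConjugate

variable {n : ℕ} {s : ℝ}

/-- Cauchy–Schwarz for the measure k dμ, through the factorisation k h = k^(1/2) · (k^(1/2) h). -/
theorem sq_lintegral_mul_le {α : Type*} [MeasurableSpace α] {μ : Measure α} {k h : α → ℝ≥0∞}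
    (hk : AEMeasurable k μ) (hh : AEMeasurable h μ) :
    (∫⁻ x, k x * h x ∂μ) ^ 2 ≤ (∫⁻ x, k x ∂μ) * ∫⁻ x, k x * h x ^ 2 ∂μ := by
  have h1 := ENNReal.lintegral_mul_le_Lp_mul_Lq μ Real.HolderConjugate.two_two
    (hk.pow_const (1 / 2 : ℝ)) ((hk.pow_const (1 / 2 : ℝ)).mul hh)
  have h2 : ∀ x, (((fun x => k x ^ (1 / 2 : ℝ)) * ((fun x => k x ^ (1 / 2 : ℝ)) * h)) x) =
      k x * h x := fun x => by
    simp only [Pi.mul_apply]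
    rw [← mul_assoc, ← ENNReal.rpow_add_of_nonneg _ _ (by norm_num) (by norm_num)]
    norm_num
  have h3 : ∀ x, (k x ^ (1 / 2 : ℝ)) ^ (2 : ℝ) = k x := fun x => by
    rw [← ENNReal.rpow_mul]; norm_num
  have h4 : ∀ x, (((fun x => k x ^ (1 / 2 : ℝ)) * h) x) ^ (2 : ℝ) = k x * h x ^ 2 := fun x => by
    rw [Pi.mul_apply, ENNReal.mul_rpow_of_nonneg _ _ (by norm_num), h3]
    norm_cast
  simp only [h2, h3, h4] at h1
  calc (∫⁻ x, k x * h x ∂μ) ^ 2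
      ≤ ((∫⁻ x, k x ∂μ) ^ (1 / 2 : ℝ) * (∫⁻ x, k x * h x ^ 2 ∂μ) ^ (1 / 2 : ℝ)) ^ 2 := by
        gcongr
    _ = _ := by
        rw [mul_pow, ← ENNReal.rpow_natCast, ← ENNReal.rpow_natCast, ← ENNReal.rpow_mul,
          ← ENNReal.rpow_mul]
        norm_num

/-- Young's inequality for the convolution of an `L¹` function with an `L²` function. -/
theorem lintegral_conv_sq_le {k h : Rn n → ℝ≥0∞} (hk : Measurable k) (hh : Measurable h) :
    ∫⁻ ξ, (∫⁻ η, k (ξ - η) * h η) ^ 2 ≤ (∫⁻ ξ, k ξ) ^ 2 * ∫⁻ ξ, h ξ ^ 2 := by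
  have hk' : ∀ ξ : Rn n, Measurable fun η => k (ξ - η) := fun ξ =>
    hk.comp (measurable_const.sub measurable_id)
  calc ∫⁻ ξ, (∫⁻ η, k (ξ - η) * h η) ^ 2
      ≤ ∫⁻ ξ, (∫⁻ η, k η) * ∫⁻ η, k (ξ - η) * h η ^ 2 := by
        refine lintegral_mono fun ξ => ?_
        refine (sq_lintegral_mul_le (hk' ξ).aemeasurable hh.aemeasurable).trans ?_
        rw [lintegral_sub_left_eq_self]
    _ = (∫⁻ η, k η) * ∫⁻ η, ∫⁻ ξ, k (ξ - η) * h η ^ 2 := by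
        have hjoint : Measurable (Function.uncurry fun ξ η : Rn n => k (ξ - η) * h η ^ 2) :=
          (hk.comp (measurable_fst.sub measurable_snd)).mul ((hh.comp measurable_snd).pow_const 2)
        rw [lintegral_const_mul _ (f := fun ξ => ∫⁻ η, k (ξ - η) * h η ^ 2) hjoint.lintegral_prod_right',
          lintegral_lintegral_swap hjoint.aemeasurable]
    _ = _ := by
        have : ∀ η, ∫⁻ ξ, k (ξ - η) * h η ^ 2 = (∫⁻ ξ, k ξ) * h η ^ 2 := fun η => by
          rw [lintegral_mul_const _ (f := fun ξ => k (ξ - η)) (hk.comp (measurable_id.sub measurable_const)),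
            lintegral_sub_right_eq_self]
        simp only [this]
        rw [lintegral_const_mul _ (hh.pow_const 2), sq, mul_assoc]

theorem integral_mul_fourier_L2_schwartz (u : L2C n) (θ : 𝓢(Rn n, ℂ)) :
    ∫ ξ, θ ξ * (Lp.fourierTransformₗᵢ (Rn n) ℂ u : L2C n) ξ = ∫ x, 𝓕 (θ : Rn n → ℂ) x * u x := by
  have h := congrArg (fun F => F θ) (Lp.fourier_toTemperedDistribution_eq u)
  simp only [TemperedDistribution.fourier_apply, Lp.toTemperedDistribution_apply,
    SchwartzMap.fourier_coe, smul_eq_mul] at h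
  exact h.symm

/-- One of ξ - η and η has norm at least ‖ξ‖/2. This lets the weight be distributed over the two
factors of a convolution. -/
theorem lapSymbol_le_mul (hs : 0 < s) (ξ η : Rn n) :
    lapSymbol s ξ ≤ 2 ^ s * ((1 + lapSymbol s (ξ - η)) * (1 + lapSymbol s η)) := by
  have h1 : ‖ξ‖ ≤ 2 * max ‖ξ - η‖ ‖η‖ := by
    have : ‖ξ‖ ≤ ‖ξ - η‖ + ‖η‖ := by simpa using norm_add_le (ξ - η) η
    linarith [le_max_left ‖ξ - η‖ ‖η‖, le_max_right ‖ξ - η‖ ‖η‖]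
  have h2 : lapSymbol s ξ ≤ 2 ^ s * (2 * Real.pi * max ‖ξ - η‖ ‖η‖) ^ s := by
    rw [← Real.mul_rpow (by positivity) (by positivity)]
    refine Real.rpow_le_rpow (by positivity) ?_ hs.le
    nlinarith [Real.pi_pos]
  refine h2.trans ?_
  gcongr
  have h3 := lapSymbol_nonneg (s := s) (ξ - η)
  have h4 := lapSymbol_nonneg (s := s) η
  have h5 : 0 ≤ lapSymbol s (ξ - η) * lapSymbol s η := mul_nonneg h3 h4
  rcases max_cases ‖ξ - η‖ ‖η‖ with h | h
  · rw [h.1]; change lapSymbol s (ξ - η) ≤ _; linarith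
  · rw [h.1]; change lapSymbol s η ≤ _; linarith

theorem lapSymbol_le_pow (hs : 0 < s) : ∃ m : ℕ, ∀ ξ : Rn n,
    lapSymbol s ξ ≤ 1 + (2 * Real.pi) ^ m * ‖ξ‖ ^ m := by
  obtain ⟨m, hm⟩ := exists_nat_ge s
  refine ⟨m, fun ξ => ?_⟩
  have := rpow_le_one_add_rpow (x := 2 * Real.pi * ‖ξ‖) (by positivity) hs hm
  rwa [Real.rpow_natCast, mul_pow] at this

theorem integrable_lapSymbol_mul_schwartz (hs : 0 < s) (ψ : 𝓢(Rn n, ℂ)) :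
    Integrable fun ξ => (1 + lapSymbol s ξ) * ‖ψ ξ‖ := by
  obtain ⟨m, hm⟩ := lapSymbol_le_pow (n := n) hs
  have h1 : Integrable fun ξ => 2 * ‖ψ ξ‖ + (2 * Real.pi) ^ m * (‖ξ‖ ^ m * ‖ψ ξ‖) :=
    (ψ.integrable.norm.const_mul 2).add ((ψ.integrable_pow_mul volume m).const_mul _)
  refine h1.mono' ?_ (Filter.Eventually.of_forall fun ξ => ?_)
  · exact ((continuous_const.add (continuous_lapSymbol hs)).mul
      ψ.continuous.norm).aestronglyMeasurable
  · have h2 := lapSymbol_nonneg (s := s) ξ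
    rw [Real.norm_of_nonneg (by positivity)]
    nlinarith [hm ξ, norm_nonneg (ψ ξ)]

/-- The product χu is integrable, so its transform is an honest integral. For fixed ξ it pairs u
with a smooth compactly supported function, and duality turns this into a convolution with ψ, the
transform of χ. -/
theorem fourierL2_mul {χ : Rn n → ℝ} (h1 : ContDiff ℝ ∞ χ) (h2 : HasCompactSupport χ)
    (u w : L2 n) (hw : ∀ᵐ x, w x = χ x * u x) :
    ∃ ψ : 𝓢(Rn n, ℂ), ∀ᵐ ξ, fourierL2 w ξ = ∫ η, ψ (ξ - η) * fourierL2 u η := by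
  have hc1 : ContDiff ℝ ∞ fun x => (χ x : ℂ) := Complex.ofRealCLM.contDiff.comp h1
  have hc2 : HasCompactSupport fun x => (χ x : ℂ) :=
    h2.comp_left (g := Complex.ofReal) Complex.ofReal_zero
  refine ⟨𝓕 (hc2.toSchwartzMap hc1), ?_⟩
  have hχ2 : MemLp χ 2 volume := h1.continuous.memLp_of_hasCompactSupport h2
  have hwi : Integrable (fun x => (w x : ℂ)) := by
    have : Integrable fun x => χ x * u x := hχ2.integrable_mul (Lp.memLp u)
    exact (this.congr (by filter_upwards [hw] with x hx; exact hx.symm)).ofReal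
  have hw2 : MemLp (fun x => (w x : ℂ)) 2 volume := (Lp.memLp w).ofReal
  have hwc : cplx w = hw2.toLp _ := by
    ext1
    filter_upwards [coeFn_cplx w, hw2.coeFn_toLp] with x h3 h4
    rw [h3, h4]
  have h := fourier_L2_toLp hwi hw2
  rw [← hwc, ← fourierL2_eq] at h
  filter_upwards [h] with ξ hξ
  rw [hξ, fourier_eq_integral_phase]
  have hp1 : ContDiff ℝ ∞ fun x => phase x ξ * (χ x : ℂ) := by
    simp only [phase_comm _ ξ]
    exact (contDiff_phase ξ).mul hc1
  have hp2 : HasCompactSupport fun x => phase x ξ * (χ x : ℂ) := hc2.mul_left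
  -- The inverse transform of the modulated cutoff is the Schwartz function whose transform pairs
  -- with u; it equals η ↦ ψ(ξ - η).
  have h5 := integral_mul_fourier_L2_schwartz (cplx u) (𝓕⁻ (hp2.toSchwartzMap hp1))
  rw [← SchwartzMap.fourier_coe, FourierTransform.fourier_fourierInv_eq, ← fourierL2_eq] at h5
  have h6 : ∀ η, (𝓕⁻ (hp2.toSchwartzMap hp1)) η = (𝓕 (hc2.toSchwartzMap hc1)) (ξ - η) := by
    intro η
    rw [SchwartzMap.fourierInv_coe, SchwartzMap.fourier_coe, Real.fourierInv_eq_fourier_neg,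
      fourier_eq_integral_phase, fourier_eq_integral_phase]
    refine integral_congr_ae (Filter.Eventually.of_forall fun x => ?_)
    change phase x (-η) * (phase x ξ * (χ x : ℂ)) = phase x (ξ - η) * (χ x : ℂ)
    rw [sub_eq_add_neg, phase_add]
    ring
  simp only [h6] at h5
  rw [h5]
  refine integral_congr_ae ?_
  filter_upwards [hw, coeFn_cplx u] with x h7 h8
  change _ = (phase x ξ * (χ x : ℂ)) * _
  rw [h7, h8]
  push_cast
  ring

/-- `H^s(ℝⁿ)` is stable under multiplication by test functions. -/
theorem Hs.exists_mul (hs : 0 < s) {χ : Rn n → ℝ} (h1 : ContDiff ℝ ∞ χ)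
    (h2 : HasCompactSupport χ) (u : Hs n s) :
    ∃ v : Hs n s, ∀ᵐ x, v.val x = χ x * u.val x := by
  obtain ⟨C, hC⟩ := h2.exists_bound_of_continuous h1.continuous
  have hmem : MemLp (fun x => χ x * u.val x) 2 volume := by
    refine (Lp.memLp u.val).of_le_mul (c := C) (h1.continuous.aestronglyMeasurable.mul
      (Lp.aestronglyMeasurable _)) (Filter.Eventually.of_forall fun x => ?_)
    rw [norm_mul]
    exact mul_le_mul_of_nonneg_right (hC x) (norm_nonneg _)
  set w : L2 n := hmem.toLp _ with hw
  have hwae : ∀ᵐ x, w x = χ x * u.val x := hmem.coeFn_toLp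
  obtain ⟨ψ, hψ⟩ := fourierL2_mul h1 h2 u.val w hwae
  suffices hmain : MemLp (fun ξ => (lapSymbol s ξ : ℂ) * fourierL2 w ξ) 2 by
    obtain ⟨v, hv⟩ := Hs.exists_val_eq w hmain
    exact ⟨v, by rw [hv]; exact hwae⟩
  set k : Rn n → ℝ≥0∞ := fun ξ => ENNReal.ofReal ((1 + lapSymbol s ξ) * ‖ψ ξ‖) with hk
  set h : Rn n → ℝ≥0∞ := fun ξ => ENNReal.ofReal ((1 + lapSymbol s ξ) * ‖fourierL2 u.val ξ‖) with hh
  have hJ : Measurable fun ξ : Rn n => 1 + lapSymbol s ξ :=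
    (continuous_const.add (continuous_lapSymbol hs)).measurable
  have hkm : Measurable k := (hJ.mul ψ.continuous.norm.measurable).ennreal_ofReal
  have hhm : Measurable h :=
    (hJ.mul (Lp.stronglyMeasurable (fourierL2 u.val)).norm.measurable).ennreal_ofReal
  have hkfin : ∫⁻ ξ, k ξ < ⊤ := (integrable_lapSymbol_mul_schwartz hs ψ).lintegral_lt_top
  have hhfin : ∫⁻ ξ, h ξ ^ 2 < ⊤ := by
    have h3 : MemLp (fun ξ => ‖fourierL2 u.val ξ‖ + ‖(lapSymbol s ξ : ℂ) * fourierL2 u.val ξ‖) 2 :=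
      (Lp.memLp (fourierL2 u.val)).norm.add u.memLp_symbol.norm
    have h4 := lintegral_rpow_enorm_lt_top_of_eLpNorm_lt_top (by simp) (by simp) h3.2
    refine lt_of_eq_of_lt (lintegral_congr fun ξ => ?_) h4
    rw [ENNReal.toReal_ofNat, ENNReal.rpow_ofNat, hh, Real.enorm_of_nonneg (by positivity),
      norm_mul, Complex.norm_real, Real.norm_of_nonneg (lapSymbol_nonneg ξ)]
    ring_nf
  -- Each factor of the convolution receives its own weight. The weighted ψ is in L¹ and the
  -- weighted û in L², so Young's inequality finishes.
  have hbound : ∀ᵐ ξ, ‖(lapSymbol s ξ : ℂ) * fourierL2 w ξ‖ₑ ≤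
      ENNReal.ofReal (2 ^ s) * ∫⁻ η, k (ξ - η) * h η := by
    filter_upwards [hψ] with ξ hξ
    rw [hξ, enorm_mul, ← ofReal_norm, Complex.norm_real, Real.norm_of_nonneg (lapSymbol_nonneg ξ)]
    calc ENNReal.ofReal (lapSymbol s ξ) * ‖∫ η, ψ (ξ - η) * fourierL2 u.val η‖ₑ
        ≤ ENNReal.ofReal (lapSymbol s ξ) * ∫⁻ η, ‖ψ (ξ - η) * fourierL2 u.val η‖ₑ := by
          gcongr
          exact enorm_integral_le_lintegral_enorm _
      _ = ∫⁻ η, ENNReal.ofReal (lapSymbol s ξ) * ‖ψ (ξ - η) * fourierL2 u.val η‖ₑ :=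
          (lintegral_const_mul' _ _ ENNReal.ofReal_ne_top).symm
      _ ≤ ∫⁻ η, ENNReal.ofReal (2 ^ s) * (k (ξ - η) * h η) := by
          refine lintegral_mono fun η => ?_
          have h5 := lapSymbol_nonneg (s := s) η
          have h6 := lapSymbol_nonneg (s := s) (ξ - η)
          simp only [hk, hh]
          rw [← ofReal_norm, norm_mul, ← ENNReal.ofReal_mul (lapSymbol_nonneg ξ),
            ← ENNReal.ofReal_mul (by positivity), ← ENNReal.ofReal_mul (by positivity)]
          refine ENNReal.ofReal_le_ofReal ?_
          calc _ ≤ 2 ^ s * ((1 + lapSymbol s (ξ - η)) * (1 + lapSymbol s η)) *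
                (‖ψ (ξ - η)‖ * ‖fourierL2 u.val η‖) :=
              mul_le_mul_of_nonneg_right (lapSymbol_le_mul hs ξ η) (by positivity)
            _ = _ := by ring
      _ = _ := lintegral_const_mul' _ _ ENNReal.ofReal_ne_top
  refine ⟨((Complex.continuous_ofReal.comp (continuous_lapSymbol hs)).aestronglyMeasurable).mul
    (Lp.aestronglyMeasurable _), ?_⟩
  rw [eLpNorm_lt_top_iff_lintegral_rpow_enorm_lt_top (by simp) (by simp)]
  calc ∫⁻ ξ, ‖(lapSymbol s ξ : ℂ) * fourierL2 w ξ‖ₑ ^ (2 : ℝ≥0∞).toReal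
      ≤ ∫⁻ ξ, ENNReal.ofReal (2 ^ s) ^ 2 * (∫⁻ η, k (ξ - η) * h η) ^ 2 := by
        refine lintegral_mono_ae ?_
        filter_upwards [hbound] with ξ hξ
        rw [ENNReal.toReal_ofNat, ENNReal.rpow_ofNat, ← mul_pow]
        gcongr
    _ = ENNReal.ofReal (2 ^ s) ^ 2 * ∫⁻ ξ, (∫⁻ η, k (ξ - η) * h η) ^ 2 :=
        lintegral_const_mul' _ _ (by finiteness)
    _ ≤ ENNReal.ofReal (2 ^ s) ^ 2 * ((∫⁻ ξ, k ξ) ^ 2 * ∫⁻ ξ, h ξ ^ 2) := by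
        gcongr
        exact lintegral_conv_sq_le hkm hhm
    _ < ⊤ := by finiteness

end Multiplication

/-! ### The characterisation of `H̃^s(Ω)` for Lipschitz domains -/

section Density

variable {n : ℕ} {s : ℝ}

theorem graph_le_of_mem_closure {Ω : Set (Rn n)} {x ν : Rn n} {γ : Rn n → ℝ} {ρ : ℝ}
    (hγ : Continuous γ)
    (hΩ : ∀ y ∈ Metric.ball x ρ, (y ∈ Ω ↔ γ (y - (inner ℝ ν y) • ν) < inner ℝ ν y))
    {z : Rn n} (hz : z ∈ closure Ω) (hzx : z ∈ Metric.ball x ρ) :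
    γ (z - (inner ℝ ν z) • ν) ≤ inner ℝ ν z := by
  have h1 : z ∈ closure (Metric.ball x ρ ∩ Ω) := Metric.isOpen_ball.inter_closure ⟨hzx, hz⟩
  have hclosed : IsClosed {y : Rn n | γ (y - (inner ℝ ν y) • ν) ≤ inner ℝ ν y} :=
    isClosed_le (by fun_prop) (by fun_prop)
  exact closure_minimal (fun y hy => ((hΩ y hy.1).mp hy.2).le) hclosed h1

/-- Ω lies above the graph, so shifting upwards by a small h > 0 moves the closed support of v
strictly inside Ω, where mollification applies. Letting h → 0 recovers v, since H̃^s(Ω) is closed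
and translations are continuous. -/
theorem mem_Htilde_of_graph {Ω : Set (Rn n)} (hΩo : IsOpen Ω) {x ν : Rn n} {γ : Rn n → ℝ} {ρ : ℝ}
    (hν : ‖ν‖ = 1) (hγ : Continuous γ)
    (hΩ : ∀ y ∈ Metric.ball x ρ, (y ∈ Ω ↔ γ (y - (inner ℝ ν y) • ν) < inner ℝ ν y))
    {K : Set (Rn n)} (hK : IsCompact K) (hKx : K ⊆ Metric.ball x ρ) (v : Hs n s)
    (hv : ∀ᵐ y, y ∉ closure Ω ∩ K → v.val y = 0) : v ∈ Htilde s Ω := by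
  obtain ⟨δ, hδ, hδK⟩ := hK.exists_cthickening_subset_open Metric.isOpen_ball hKx
  have htend : Filter.Tendsto (fun h : ℝ => Hs.translate (h • ν) v) (nhdsWithin 0 (Ioi 0))
      (nhds v) := by
    have h1 : Continuous fun h : ℝ => Hs.translate (h • ν) v :=
      (Hs.continuous_translate v).comp (continuous_id.smul continuous_const)
    have h2 := h1.tendsto 0
    rw [zero_smul, Hs.translate_zero] at h2
    exact h2.mono_left nhdsWithin_le_nhds
  refine (Htilde.isClosed s Ω).mem_of_tendsto htend ?_
  filter_upwards [Ioc_mem_nhdsGT hδ] with h hh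
  have hνν : inner ℝ ν ν = (1 : ℝ) := by rw [real_inner_self_eq_norm_sq, hν, one_pow]
  refine mem_Htilde_of_isCompact hΩo
    ((hK.inter_left (isClosed_closure (s := Ω))).image (f := fun z => z + h • ν) (by fun_prop)) ?_ _ ?_
  · rintro _ ⟨z, ⟨hz1, hz2⟩, rfl⟩
    have hle := graph_le_of_mem_closure hγ hΩ hz1 (hKx hz2)
    have hmem : z + h • ν ∈ Metric.ball x ρ := by
      refine hδK (Metric.mem_cthickening_of_dist_le _ z _ _ hz2 ?_)
      rw [dist_eq_norm, add_sub_cancel_left, norm_smul, hν, mul_one, Real.norm_of_nonneg hh.1.le]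
      exact hh.2
    rw [hΩ _ hmem, inner_add_right, inner_smul_right, hνν, mul_one]
    have : z + h • ν - (inner ℝ ν z + h) • ν = z - (inner ℝ ν z : ℝ) • ν := by module
    rw [this]
    linarith [hh.1]
  · filter_upwards [Hs.coeFn_translate (h • ν) v, ae_sub_right (h • ν) hv] with y h1 h2 hy
    rw [h1]
    exact h2 fun hmem => hy ⟨_, hmem, sub_add_cancel _ _⟩

open scoped Manifold in
-- Boundedness of the cover makes the cutoffs compactly supported; compactness of K leaves only
-- finitely many of them that do not vanish identically on K.
theorem exists_smooth_partition {K : Set (Rn n)} (hK : IsCompact K) {U : K → Set (Rn n)}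
    (hUo : ∀ i, IsOpen (U i)) (hUb : ∀ i, Bornology.IsBounded (U i)) (hU : ∀ i : K, (i : Rn n) ∈ U i) :
    ∃ (t : Finset K) (χ : K → Rn n → ℝ), (∀ i, χ i ∈ CcInfty (U i)) ∧
      ∀ x ∈ K, ∑ i ∈ t, χ i x = 1 := by
  obtain ⟨f, hf⟩ := SmoothPartitionOfUnity.exists_isSubordinate 𝓘(ℝ, Rn n) hK.isClosed U hUo
    (fun x hx => mem_iUnion.mpr ⟨⟨x, hx⟩, hU ⟨x, hx⟩⟩)
  have hfin := f.locallyFinite.finite_nonempty_inter_compact hK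
  refine ⟨hfin.toFinset, fun i => f i, fun i => ⟨(f i).contMDiff.contDiff, ?_, hf i⟩,
    fun x hx => ?_⟩
  · exact Metric.isCompact_of_isClosed_isBounded (isClosed_tsupport _) ((hUb i).subset (hf i))
  · rw [← f.sum_eq_one hx]
    refine (finsum_eq_sum_of_support_subset _ fun i hi => ?_).symm
    simp only [Finite.coe_toFinset]
    exact ⟨x, hi, hx⟩

theorem Hs.coeFn_sum {ι : Type*} (t : Finset ι) (v : ι → Hs n s) (g : ι → Rn n → ℝ)
    (h : ∀ i ∈ t, ∀ᵐ x, (v i).val x = g i x) :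
    ∀ᵐ x, (∑ i ∈ t, v i).val x = ∑ i ∈ t, g i x := by
  classical
  induction t using Finset.induction_on with
  | empty =>
    simp only [Finset.sum_empty]
    exact Lp.coeFn_zero ℝ 2 (volume : Measure (Rn n))
  | insert i t hi ih =>
    rw [Finset.sum_insert hi]
    filter_upwards [Lp.coeFn_add (v i).val (∑ j ∈ t, v j).val, h i (Finset.mem_insert_self _ _),
      ih fun j hj => h j (Finset.mem_insert_of_mem hj)] with x h1 h2 h3
    rw [Hs.val_add, h1, Pi.add_apply, h2, h3, Finset.sum_insert hi]

/-- On a bounded Lipschitz domain every `u ∈ H^s(ℝⁿ)` vanishing in the exterior belongs to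
`H̃^s(Ω)`. -/
theorem mem_Htilde_of_eq_zero_exterior (hs : 0 < s) {Ω : Set (Rn n)}
    (hΩ : IsBoundedLipschitzDomain Ω) (u : Hs n s)
    (hu : ∀ᵐ x ∂(volume.restrict (exterior Ω)), u.val x = 0) : u ∈ Htilde s Ω := by
  have hu' : ∀ᵐ x, x ∉ closure Ω → u.val x = 0 := by
    exact (ae_restrict_iff' (isClosed_closure (s := Ω)).isOpen_compl.measurableSet).mp hu
  have hK : IsCompact (closure Ω) := hΩ.isBounded.isCompact_closure
  choose ν γ C ρ hν hγ hρ hgraph using hΩ.lipschitz_boundary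
  have hfr : ∀ x ∈ closure Ω, x ∉ Ω → x ∈ frontier Ω := fun x h1 h2 => by
    rw [frontier, hΩ.isOpen.interior_eq]; exact ⟨h1, h2⟩
  classical
  -- The cover uses Ω itself around interior points and a graph neighbourhood around boundary
  -- points; the two kinds of pieces are treated by `mem_Htilde_of_isCompact` and
  -- `mem_Htilde_of_graph`.
  let U : closure Ω → Set (Rn n) := fun i =>
    if h : (i : Rn n) ∈ Ω then Ω else Metric.ball (i : Rn n) (ρ i (hfr i i.2 h))
  obtain ⟨t, χ, hχ, hsum⟩ := exists_smooth_partition hK (U := U)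
    (fun i => by by_cases h : (i : Rn n) ∈ Ω <;> simp [U, h, hΩ.isOpen])
    (fun i => by by_cases h : (i : Rn n) ∈ Ω <;> simp [U, h, hΩ.isBounded, Metric.isBounded_ball])
    (fun i => by by_cases h : (i : Rn n) ∈ Ω <;> simp [U, h, hρ])
  choose v hv using fun i => Hs.exists_mul hs (hχ i).1 (hχ i).2.1 u
  have huv : u = ∑ i ∈ t, v i := by
    apply Hs.ext_val
    ext1
    filter_upwards [Hs.coeFn_sum t v (fun i x => χ i x * u.val x) (fun i _ => hv i), hu']
      with x h1 h2
    rw [h1, ← Finset.sum_mul]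
    by_cases hx : x ∈ closure Ω
    · rw [hsum x hx, one_mul]
    · rw [h2 hx, mul_zero]
  rw [huv]
  refine Submodule.sum_mem _ fun i _ => ?_
  have hvi : ∀ᵐ x, x ∉ closure Ω ∩ tsupport (χ i) → (v i).val x = 0 := by
    filter_upwards [hv i, hu'] with x h1 h2 h3
    rw [h1]
    by_cases hx : x ∈ closure Ω
    · rw [image_eq_zero_of_notMem_tsupport fun h => h3 ⟨hx, h⟩, zero_mul]
    · rw [h2 hx, mul_zero]
  have hsupp := (hχ i).2.2
  by_cases h : (i : Rn n) ∈ Ω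
  · simp only [U, h, dite_true] at hsupp
    refine mem_Htilde_of_isCompact hΩ.isOpen (hχ i).2.1 hsupp _ ?_
    filter_upwards [hvi] with x h1 h2
    exact h1 fun h3 => h2 h3.2
  · simp only [U, h, dite_false] at hsupp
    have hi := hfr i i.2 h
    exact mem_Htilde_of_graph hΩ.isOpen (hν i hi) (hγ i hi).continuous (hgraph i hi) (hχ i).2.1
      hsupp _ hvi

/-- Restriction to the complement of Ω is continuous into L², so its kernel is closed; it contains
the test functions. -/
theorem Htilde.ae_eq_zero {Ω : Set (Rn n)} (hΩ : IsOpen Ω) {u : Hs n s} (hu : u ∈ Htilde s Ω) :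
    ∀ᵐ x, x ∉ Ω → u.val x = 0 := by
  let P : L2 n →L[ℝ] Lp ℝ 2 (volume.restrict Ωᶜ) := LpToLpRestrictCLM (Rn n) ℝ ℝ volume 2 Ωᶜ
  have hP : ∀ u : Hs n s, P u.val = 0 ↔ ∀ᵐ x, x ∉ Ω → u.val x = 0 := by
    intro u
    rw [Lp.eq_zero_iff_ae_eq_zero]
    have h1 : P u.val =ᵐ[volume.restrict Ωᶜ] u.val := LpToLpRestrictCLM_coeFn ℝ Ωᶜ u.val
    rw [show (∀ᵐ x, x ∉ Ω → u.val x = 0) ↔ ∀ᵐ x ∂(volume.restrict Ωᶜ), u.val x = 0 from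
      (ae_restrict_iff' hΩ.measurableSet.compl).symm]
    constructor
    · intro h; filter_upwards [h, h1] with x h2 h3; rw [← h3, h2]; rfl
    · intro h; filter_upwards [h, h1] with x h2 h3; rw [h3, h2]; rfl
  rw [← hP]
  let Q : Hs n s →L[ℝ] Lp ℝ 2 (volume.restrict Ωᶜ) := P.comp (Hs.valL n s)
  have hle : Htilde s Ω ≤ Q.ker := by
    refine Submodule.topologicalClosure_minimal _ ?_ Q.isClosed_ker
    rw [Submodule.span_le]
    rintro w ⟨g, hg, hwg⟩
    change P w.val = 0
    rw [hP]
    filter_upwards [hwg] with x h1 h2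
    rw [h1, CcInfty.eq_zero hg h2]
  exact hle hu

end Density

/-! ### Test functions as curves in `H^s(ℝⁿ)` -/

section TestFunctions

open scoped FourierTransform

variable {n : ℕ} {s : ℝ}

/-- Powers of ξ cost L¹ norms of derivatives, which a common support ball bounds by sup norms. The
constant does not depend on g, so differences of time slices can be inserted. -/
theorem pow_mul_norm_fourier_le (k : ℕ) (R : ℝ) : ∃ C : ℝ, 0 ≤ C ∧ ∀ (g : Rn n → ℝ) (M : ℝ),
    ContDiff ℝ ∞ g → tsupport g ⊆ Metric.closedBall 0 R →
    (∀ j ≤ k, ∀ x, ‖iteratedFDeriv ℝ j g x‖ ≤ M) →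
    ∀ ξ, ‖ξ‖ ^ k * ‖𝓕 (fun x => (g x : ℂ)) ξ‖ ≤ C * M := by
  have hKfin : volume (Metric.closedBall (0 : Rn n) R) ≠ ⊤ := measure_closedBall_lt_top.ne
  refine ⟨2 ^ k * ((k + 1) * volume.real (Metric.closedBall (0 : Rn n) R)), by positivity,
    fun g M hg hsupp hM ξ => ?_⟩
  have hgc : ContDiff ℝ ∞ fun x => (g x : ℂ) := Complex.ofRealCLM.contDiff.comp hg
  have hcs : HasCompactSupport g :=
    HasCompactSupport.intro (isCompact_closedBall 0 R) fun x hx =>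
      image_eq_zero_of_notMem_tsupport fun h => hx (hsupp h)
  have hcs' : HasCompactSupport fun x => (g x : ℂ) :=
    hcs.comp_left (g := Complex.ofReal) Complex.ofReal_zero
  have hnorm : ∀ j x, ‖iteratedFDeriv ℝ j (fun x => (g x : ℂ)) x‖ = ‖iteratedFDeriv ℝ j g x‖ :=
    fun j x => Complex.ofRealLI.norm_iteratedFDeriv_comp_left (hg.contDiffAt (x := x))
      (i := j) (by exact_mod_cast le_top)
  have h := Real.pow_mul_norm_iteratedFDeriv_fourier_le (K := 0) (N := k) (k := 0) (n := k)
    (f := fun x => (g x : ℂ)) (hgc.of_le (by exact_mod_cast le_top)) (fun i j _ _ => by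
      refine Continuous.integrable_of_hasCompactSupport ?_ ?_
      · exact (continuous_norm.pow _).mul (hgc.continuous_iteratedFDeriv (by exact_mod_cast le_top)).norm
      · exact ((hcs'.iteratedFDeriv j).norm).mul_left) le_rfl le_rfl ξ
  rw [norm_iteratedFDeriv_zero] at h
  refine h.trans ?_
  have hsum : ∑ p ∈ Finset.range (0 + 1) ×ˢ Finset.range (k + 1),
      ∫ v, ‖v‖ ^ p.1 * ‖iteratedFDeriv ℝ p.2 (fun x => (g x : ℂ)) v‖ ≤
      ∑ p ∈ Finset.range (0 + 1) ×ˢ Finset.range (k + 1),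
        M * volume.real (Metric.closedBall (0 : Rn n) R) := by
    refine Finset.sum_le_sum fun p hp => ?_
    simp only [zero_add, Finset.mem_product, Finset.mem_range, Nat.lt_succ_iff] at hp
    simp only [Nat.le_zero.mp hp.1, pow_zero, one_mul, hnorm]
    rw [← setIntegral_eq_integral_of_forall_compl_eq_zero (s := Metric.closedBall (0 : Rn n) R)]
    · have h1 := norm_setIntegral_le_of_norm_le_const (μ := volume) hKfin.lt_top
        (f := fun v => ‖iteratedFDeriv ℝ p.2 g v‖) (C := M) (fun x _ => by
          rw [norm_norm]; exact hM _ hp.2 x)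
      exact (Real.le_norm_self _).trans h1
    · intro x hx
      rw [norm_eq_zero]
      exact Function.notMem_support.mp fun h2 => hx (hsupp (support_iteratedFDeriv_subset _ h2))
  simp only [Finset.sum_const, Finset.card_product, Finset.card_range, nsmul_eq_mul] at hsum
  have h2 : (2 * Real.pi) ^ 0 * (2 * ((0 : ℕ) : ℝ) + 2) ^ k = 2 ^ k := by simp
  rw [h2, mul_assoc (2 ^ k)]
  refine mul_le_mul_of_nonneg_left (hsum.trans_eq ?_) (by positivity)
  push_cast
  ring

/-- Some m ≥ s derivatives outweigh the symbol, and n + 1 further ones leave a square integrable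
factor. -/
theorem one_add_lapSymbol_mul_norm_fourier_le (hs : 0 < s) (R : ℝ) :
    ∃ (k : ℕ) (C : ℝ), 0 ≤ C ∧ ∀ (g : Rn n → ℝ) (M : ℝ),
    ContDiff ℝ ∞ g → tsupport g ⊆ Metric.closedBall 0 R →
    (∀ j ≤ k, ∀ x, ‖iteratedFDeriv ℝ j g x‖ ≤ M) →
    ∀ ξ, (1 + lapSymbol s ξ) * ‖𝓕 (fun x => (g x : ℂ)) ξ‖ ≤
      C * M * (1 + ‖ξ‖) ^ (-(n + 1 : ℝ)) := by
  obtain ⟨m, hm⟩ := lapSymbol_le_pow (n := n) hs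
  obtain ⟨C₀, hC₀, h₀⟩ := pow_mul_norm_fourier_le (n := n) 0 R
  obtain ⟨C₁, hC₁, h₁⟩ := pow_mul_norm_fourier_le (n := n) (m + (n + 1)) R
  refine ⟨m + (n + 1), (2 + (2 * Real.pi) ^ m) * 2 ^ (m + (n + 1)) * (C₀ + C₁), by positivity,
    fun g M hg hsupp hM ξ => ?_⟩
  have e₀ := h₀ g M hg hsupp (fun j hj => hM j (by omega)) ξ
  have e₁ := h₁ g M hg hsupp hM ξ
  rw [pow_zero, one_mul] at e₀
  have hM0 : 0 ≤ M := (norm_nonneg _).trans (hM 0 (Nat.zero_le _) 0)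
  set a := ‖𝓕 (fun x => (g x : ℂ)) ξ‖ with ha
  have ha0 : 0 ≤ a := norm_nonneg _
  have hx : 0 ≤ ‖ξ‖ := norm_nonneg ξ
  have h2 : 1 + lapSymbol s ξ ≤ (2 + (2 * Real.pi) ^ m) * (1 + ‖ξ‖) ^ m := by
    have e1 : ‖ξ‖ ^ m ≤ (1 + ‖ξ‖) ^ m := by gcongr; linarith
    have e2 : 1 ≤ (1 + ‖ξ‖) ^ m := one_le_pow₀ (by linarith)
    have e3 : (2 * Real.pi) ^ m * ‖ξ‖ ^ m ≤ (2 * Real.pi) ^ m * (1 + ‖ξ‖) ^ m := by gcongr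
    linarith [hm ξ]
  have h3 : (1 + ‖ξ‖) ^ (m + (n + 1)) ≤ 2 ^ (m + (n + 1)) * (1 + ‖ξ‖ ^ (m + (n + 1))) := by
    have e1 : 1 + ‖ξ‖ ≤ 2 * max 1 ‖ξ‖ := by linarith [le_max_left 1 ‖ξ‖, le_max_right 1 ‖ξ‖]
    have e2 : (max 1 ‖ξ‖) ^ (m + (n + 1)) ≤ 1 + ‖ξ‖ ^ (m + (n + 1)) := by
      rcases max_cases 1 ‖ξ‖ with h | h <;> rw [h.1]
      · rw [one_pow]; linarith [pow_nonneg hx (m + (n + 1))]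
      · linarith
    calc (1 + ‖ξ‖) ^ (m + (n + 1)) ≤ (2 * max 1 ‖ξ‖) ^ (m + (n + 1)) := by gcongr
      _ = 2 ^ (m + (n + 1)) * (max 1 ‖ξ‖) ^ (m + (n + 1)) := mul_pow _ _ _
      _ ≤ _ := by gcongr
  rw [Real.rpow_neg (by positivity), ← div_eq_mul_inv, le_div_iff₀ (by positivity)]
  have h4 : (1 + ‖ξ‖) ^ (n + 1 : ℝ) = (1 + ‖ξ‖) ^ (n + 1) := by
    rw [← Real.rpow_natCast]; push_cast; rfl
  rw [h4]
  calc (1 + lapSymbol s ξ) * a * (1 + ‖ξ‖) ^ (n + 1)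
      ≤ (2 + (2 * Real.pi) ^ m) * (1 + ‖ξ‖) ^ m * a * (1 + ‖ξ‖) ^ (n + 1) := by gcongr
    _ = (2 + (2 * Real.pi) ^ m) * a * (1 + ‖ξ‖) ^ (m + (n + 1)) := by rw [pow_add]; ring
    _ ≤ (2 + (2 * Real.pi) ^ m) * a * (2 ^ (m + (n + 1)) * (1 + ‖ξ‖ ^ (m + (n + 1)))) := by gcongr
    _ = (2 + (2 * Real.pi) ^ m) * 2 ^ (m + (n + 1)) * (a + ‖ξ‖ ^ (m + (n + 1)) * a) := by ring
    _ ≤ (2 + (2 * Real.pi) ^ m) * 2 ^ (m + (n + 1)) * (C₀ * M + C₁ * M) := by gcongr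
    _ = _ := by ring

theorem memLp_one_add_norm_rpow :
    MemLp (fun ξ : Rn n => (((1 + ‖ξ‖) ^ (-(n + 1 : ℝ)) : ℝ) : ℂ)) 2 volume := by
  refine MemLp.ofReal (f := fun ξ : Rn n => (1 + ‖ξ‖) ^ (-(n + 1 : ℝ))) ?_
  have h1 : Integrable fun ξ : Rn n => (1 + ‖ξ‖) ^ (-(n + 1 : ℝ)) :=
    integrable_one_add_norm (by simp)
  rw [memLp_two_iff_integrable_sq h1.1]
  refine h1.mono' (h1.1.pow 2) (Filter.Eventually.of_forall fun ξ => ?_)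
  have h2 : (1 + ‖ξ‖) ^ (-(n + 1 : ℝ)) ≤ 1 :=
    Real.rpow_le_one_of_one_le_of_nonpos (by linarith [norm_nonneg ξ]) (by linarith [n.cast_nonneg (α := ℝ)])
  have h3 : 0 ≤ (1 + ‖ξ‖) ^ (-(n + 1 : ℝ)) := by positivity
  rw [Real.norm_of_nonneg (by positivity)]
  nlinarith

/-- Test functions belong to `H^s(ℝⁿ)`, with norm controlled by finitely many derivatives. -/
theorem Hs.exists_testFunction (hs : 0 < s) (R : ℝ) :
    ∃ (k : ℕ) (C : ℝ), 0 ≤ C ∧ ∀ (g : Rn n → ℝ) (M : ℝ),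
    ContDiff ℝ ∞ g → tsupport g ⊆ Metric.closedBall 0 R →
    (∀ j ≤ k, ∀ x, ‖iteratedFDeriv ℝ j g x‖ ≤ M) →
    ∃ u : Hs n s, u.val =ᵐ[volume] g ∧ ‖u‖ ≤ C * M := by
  obtain ⟨k, C, hC, h⟩ := one_add_lapSymbol_mul_norm_fourier_le (n := n) hs R
  set D := memLp_one_add_norm_rpow (n := n).toLp _ with hD
  refine ⟨k, 2 * (C * ‖D‖), by positivity, fun g M hg hsupp hM => ?_⟩
  have hM0 : 0 ≤ M := (norm_nonneg _).trans (hM 0 (Nat.zero_le _) 0)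
  have hcs : HasCompactSupport g :=
    HasCompactSupport.intro (isCompact_closedBall 0 R) fun x hx =>
      image_eq_zero_of_notMem_tsupport fun h => hx (hsupp h)
  have hg2 : MemLp g 2 volume := hg.continuous.memLp_of_hasCompactSupport hcs
  have hgi : Integrable (fun x => (g x : ℂ)) :=
    (hg.continuous.integrable_of_hasCompactSupport hcs).ofReal
  set w : L2 n := hg2.toLp g with hw
  have hwc : cplx w = (hg2.ofReal (K := ℂ)).toLp _ := by
    ext1
    filter_upwards [coeFn_cplx w, (hg2.ofReal (K := ℂ)).coeFn_toLp, hg2.coeFn_toLp] with x h3 h4 h5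
    rw [h3, h4, hw, h5]; rfl
  have hF : ∀ᵐ ξ, fourierL2 w ξ = 𝓕 (fun x => (g x : ℂ)) ξ := by
    have h1 := fourier_L2_toLp hgi (hg2.ofReal (K := ℂ))
    rw [fourierL2_eq, hwc]
    exact h1
  have hDc := memLp_one_add_norm_rpow (n := n).coeFn_toLp
  have hDb : ∀ᵐ ξ, (1 + lapSymbol s ξ) * ‖fourierL2 w ξ‖ ≤ C * M * ‖D ξ‖ := by
    filter_upwards [hF, hDc] with ξ h1 h2
    rw [h1, hD, h2, Complex.norm_real, Real.norm_of_nonneg (by positivity)]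
    exact h g M hg hsupp hM ξ
  have hb1 : ∀ᵐ ξ, ‖fourierL2 w ξ‖ ≤ C * M * ‖D ξ‖ := by
    filter_upwards [hDb] with ξ h1
    refine le_trans ?_ h1
    exact le_mul_of_one_le_left (norm_nonneg _) (by linarith [lapSymbol_nonneg (s := s) ξ])
  have hb2 : ∀ᵐ ξ, ‖(lapSymbol s ξ : ℂ) * fourierL2 w ξ‖ ≤ C * M * ‖D ξ‖ := by
    filter_upwards [hDb] with ξ h1
    rw [norm_mul, Complex.norm_real, Real.norm_of_nonneg (lapSymbol_nonneg ξ)]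
    refine le_trans ?_ h1
    gcongr
    linarith
  have hmem : MemLp (fun ξ => (lapSymbol s ξ : ℂ) * fourierL2 w ξ) 2 :=
    (Lp.memLp D).of_le_mul
      (((Complex.continuous_ofReal.comp (continuous_lapSymbol hs)).aestronglyMeasurable).mul
        (Lp.aestronglyMeasurable _)) hb2
  obtain ⟨u, hu⟩ := Hs.exists_val_eq w hmem
  refine ⟨u, by rw [hu]; exact hg2.coeFn_toLp, ?_⟩
  have n1 : ‖u.val‖ ≤ C * M * ‖D‖ := by
    rw [← norm_fourierL2, hu]
    exact Lp.norm_le_mul_norm_of_ae_le_mul hb1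
  have n2 : ‖u.lap‖ ≤ C * M * ‖D‖ := by
    rw [← norm_fourierL2]
    refine Lp.norm_le_mul_norm_of_ae_le_mul ?_
    filter_upwards [hb2, u.fourier_lap] with ξ h1 h2
    rw [h2, hu]; exact h1
  calc ‖u‖ ≤ ‖u.val‖ + ‖u.lap‖ := u.norm_le
    _ ≤ _ := by linarith

theorem Hs.ofFun_spec {g : Rn n → ℝ} {u : Hs n s} (hu : u.val =ᵐ[volume] g) :
    Hs.ofFun s g = u := by
  have h : ∃ u : Hs n s, u.val =ᵐ[volume] g := ⟨u, hu⟩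
  rw [Hs.ofFun, dif_pos h]
  apply Hs.ext_val
  ext1
  exact h.choose_spec.trans hu.symm

end TestFunctions

/-! ### Time slices of space-time test functions -/

section Slices

variable {n : ℕ} {s T : ℝ} {A : Set (Rn n)} {φ : Rn n × ℝ → ℝ}

theorem Hs.exists_val_eq_testFunction (hs : 0 < s) {g : Rn n → ℝ} (hg : ContDiff ℝ ∞ g)
    (hc : HasCompactSupport g) : ∃ u : Hs n s, u.val =ᵐ[volume] g := by
  obtain ⟨R, hR⟩ := hc.isCompact.isBounded.subset_closedBall 0
  obtain ⟨k, C, -, h⟩ := Hs.exists_testFunction (n := n) hs R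
  have hb : ∀ j, ∃ M, ∀ x, ‖iteratedFDeriv ℝ j g x‖ ≤ M := fun j =>
    (hc.iteratedFDeriv j).exists_bound_of_continuous
      (hg.continuous_iteratedFDeriv (by exact_mod_cast le_top))
  choose M hM using hb
  obtain ⟨u, hu, -⟩ := h g (∑ j ∈ Finset.range (k + 1), M j) hg hR fun j hj x =>
    (hM j x).trans (Finset.single_le_sum (f := M)
      (fun i _ => (norm_nonneg _).trans (hM i 0)) (Finset.mem_range.mpr (by omega)))
  exact ⟨u, hu⟩

theorem contDiff_slice (hφ : ContDiff ℝ ∞ φ) (t : ℝ) : ContDiff ℝ ∞ fun y => φ (y, t) :=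
  hφ.comp (contDiff_id.prodMk contDiff_const)

theorem tsupport_slice_subset {R : ℝ} (hR : tsupport φ ⊆ Metric.closedBall 0 R) (t : ℝ) :
    tsupport (fun y => φ (y, t)) ⊆ Metric.closedBall 0 R := by
  refine closure_minimal (fun y hy => ?_) Metric.isClosed_closedBall
  have h := hR (subset_tsupport φ (Function.mem_support.mpr hy))
  rw [mem_closedBall_zero_iff] at h ⊢
  exact (norm_fst_le (y, t)).trans h

theorem hasCompactSupport_slice (hφ : HasCompactSupport φ) (t : ℝ) :
    HasCompactSupport fun y => φ (y, t) := by
  obtain ⟨R, hR⟩ := hφ.isCompact.isBounded.subset_closedBall 0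
  exact HasCompactSupport.intro (isCompact_closedBall 0 R) fun x hx =>
    image_eq_zero_of_notMem_tsupport (f := fun y => φ (y, t))
      fun h => hx (tsupport_slice_subset hR t h)

/-- A slice is a time shift of φ composed with the inclusion y ↦ (y, 0), which has norm at most 1.
-/
theorem norm_iteratedFDeriv_slice_sub_le (hφ : ContDiff ℝ ∞ φ) (j : ℕ) (t t₀ : ℝ) (x : Rn n) :
    ‖iteratedFDeriv ℝ j (fun y => φ (y, t) - φ (y, t₀)) x‖ ≤
      ‖iteratedFDeriv ℝ j φ (x, t) - iteratedFDeriv ℝ j φ (x, t₀)‖ := by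
  have hj : (j : WithTop ℕ∞) ≤ ((⊤ : ℕ∞) : WithTop ℕ∞) := by exact_mod_cast le_top
  have h1 : ∀ r : ℝ, ContDiff ℝ ∞ fun z : Rn n × ℝ => φ (z + (0, r)) := fun r =>
    hφ.comp (contDiff_id.add contDiff_const)
  have h2 : (fun y => φ (y, t) - φ (y, t₀)) =
      (fun z : Rn n × ℝ => φ (z + (0, t)) - φ (z + (0, t₀))) ∘
        (ContinuousLinearMap.inl ℝ (Rn n) ℝ) := by
    ext y; simp
  rw [h2, ContinuousLinearMap.iteratedFDeriv_comp_right _ ((h1 t).sub (h1 t₀)) x hj]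
  refine (ContinuousMultilinearMap.norm_compContinuousLinearMap_le _ _).trans ?_
  rw [fun_iteratedFDeriv_sub_apply ((h1 t).contDiffAt.of_le hj) ((h1 t₀).contDiffAt.of_le hj),
    iteratedFDeriv_comp_add_right, iteratedFDeriv_comp_add_right]
  simp only [ContinuousLinearMap.inl_apply, Prod.mk_add_mk, add_zero, zero_add]
  refine mul_le_of_le_one_right (norm_nonneg _) (Finset.prod_le_one (fun _ _ => norm_nonneg _)
    fun _ _ => ContinuousLinearMap.norm_inl_le_one ℝ (Rn n) ℝ)

/-- The curve `t ↦ φ(·,t)` in `H^s(ℝⁿ)`. -/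
noncomputable def slice (s : ℝ) (φ : Rn n × ℝ → ℝ) (t : ℝ) : Hs n s := Hs.ofFun s fun y => φ (y, t)

theorem slice_val (hs : 0 < s) (hφ : φ ∈ CcInfty (cyl A T)) (t : ℝ) :
    (slice s φ t).val =ᵐ[volume] fun y => φ (y, t) := by
  obtain ⟨u, hu⟩ := Hs.exists_val_eq_testFunction hs (contDiff_slice hφ.1 t)
    (hasCompactSupport_slice hφ.2.1 t)
  rwa [slice, Hs.ofFun_spec hu]

/-- The H^s distance of two slices is controlled by finitely many derivatives of their difference,
and these are uniformly small because the derivatives of φ, having compact support, are uniformly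
continuous. -/
theorem continuous_slice (hs : 0 < s) (hφ : φ ∈ CcInfty (cyl A T)) :
    Continuous (slice s φ) := by
  obtain ⟨R, hR⟩ := hφ.2.1.isCompact.isBounded.subset_closedBall 0
  obtain ⟨k, C, hC, h⟩ := Hs.exists_testFunction (n := n) hs R
  rw [continuous_iff_continuousAt]
  intro t₀
  rw [Metric.continuousAt_iff']
  intro ε hε
  -- Dividing by C + 1 instead of C covers C = 0 and makes the final inequality strict.
  have hε' : 0 < ε / (C + 1) := by positivity
  have hev : ∀ᶠ t in nhds t₀, ∀ j ∈ Finset.range (k + 1), ∀ x : Rn n,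
      ‖iteratedFDeriv ℝ j φ (x, t) - iteratedFDeriv ℝ j φ (x, t₀)‖ ≤ ε / (C + 1) := by
    rw [Filter.eventually_all_finset]
    intro j _
    have huc : UniformContinuous (iteratedFDeriv ℝ j φ) :=
      (hφ.1.continuous_iteratedFDeriv (by exact_mod_cast le_top)).uniformContinuous_of_tendsto_cocompact
        (x := 0) (hφ.2.1.iteratedFDeriv j).is_zero_at_infty
    obtain ⟨δ, hδ, hδε⟩ := Metric.uniformContinuous_iff.mp huc _ hε'
    filter_upwards [Metric.ball_mem_nhds t₀ hδ] with t ht x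
    rw [← dist_eq_norm]
    refine (hδε ?_).le
    rw [Prod.dist_eq, dist_self, max_eq_right dist_nonneg]
    exact ht
  filter_upwards [hev] with t ht
  obtain ⟨u, hu, hun⟩ := h (fun y => φ (y, t) - φ (y, t₀)) (ε / (C + 1))
    ((contDiff_slice hφ.1 t).sub (contDiff_slice hφ.1 t₀))
    ((tsupport_sub _ _).trans (union_subset (tsupport_slice_subset hR t)
      (tsupport_slice_subset hR t₀)))
    (fun j hj x => (norm_iteratedFDeriv_slice_sub_le hφ.1 j t t₀ x).trans
      (ht j (Finset.mem_range.mpr (by omega)) x))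
  have huv : slice s φ t - slice s φ t₀ = u := by
    apply Hs.ext_val
    ext1
    filter_upwards [hu, slice_val hs hφ t, slice_val hs hφ t₀,
      Lp.coeFn_sub (slice s φ t).val (slice s φ t₀).val] with x h1 h2 h3 h4
    rw [h1, Hs.val_sub, h4, Pi.sub_apply, h2, h3]
  rw [dist_eq_norm, huv]
  refine hun.trans_lt ?_
  rw [mul_div_assoc', div_lt_iff₀ (by positivity)]
  nlinarith

theorem fderiv_snd_mem (hφ : φ ∈ CcInfty (cyl A T)) :
    (fun z => fderiv ℝ φ z (0, 1)) ∈ CcInfty (cyl A T) := by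
  refine ⟨?_, hφ.2.1.fderiv_apply ℝ (0, 1), (tsupport_fderiv_apply_subset ℝ (0, 1)).trans hφ.2.2⟩
  exact (hφ.1.fderiv_right (m := ∞) (by simp)).clm_apply contDiff_const

/-- An element of H^s is determined by its L² function, so the identity reduces to the scalar
fundamental theorem of calculus at almost every x. -/
theorem slice_eq_integral (hs : 0 < s) (hφ : φ ∈ CcInfty (cyl A T)) {t : ℝ} (ht : 0 ≤ t) :
    slice s φ t = ∫ τ in Ioo 0 t, slice s (fun z => fderiv ℝ φ z (0, 1)) τ := by
  have hφ' := fderiv_snd_mem hφ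
  have hint : IntegrableOn (slice s (fun z => fderiv ℝ φ z (0, 1))) (Ioo 0 t) :=
    ((continuous_slice hs hφ').continuousOn.integrableOn_compact isCompact_Icc).mono_set
      Ioo_subset_Icc_self
  apply Hs.ext_val
  ext1
  have h1 := (Hs.valL n s).integral_comp_comm hint
  simp only [Hs.valL_apply] at h1
  rw [← h1]
  have h2 := coeFn_integral_L2 (μ := volume.restrict (Ioo 0 t))
    (f := fun x τ => fderiv ℝ φ (x, τ) (0, 1)) ((Hs.valL n s).integrable_comp hint) (by
      have h3 := (CcInfty.integrable (μ := volume) hφ').integrableOn (s := univ ×ˢ Ioo 0 t)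
      rw [IntegrableOn, Measure.volume_eq_prod, ← Measure.prod_restrict, Measure.restrict_univ] at h3
      exact h3)
    (Filter.Eventually.of_forall fun τ => slice_val hs hφ' τ)
  filter_upwards [h2, slice_val hs hφ t] with x h3 h4
  refine h4.trans (Eq.trans ?_ h3.symm)
  rw [← integral_Ioc_eq_integral_Ioo, ← intervalIntegral.integral_of_le ht]
  have hd : ∀ τ, HasDerivAt (fun τ => φ (x, τ)) (fderiv ℝ φ (x, τ) (0, 1)) τ := fun τ =>
    ((hφ.1.differentiable (by simp)).differentiableAt.hasFDerivAt (x := (x, τ))).comp_hasDerivAt τ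
      ((hasDerivAt_const τ x).prodMk (hasDerivAt_id τ))
  rw [intervalIntegral.integral_eq_sub_of_hasDerivAt (fun τ _ => hd τ)]
  -- There is no boundary term: time 0 lies outside the open interval that contains the times of the
  -- support.
  · rw [CcInfty.eq_zero hφ (x := (x, 0)) fun h => lt_irrefl _ h.2.1, sub_zero]
  · exact (hφ'.1.continuous.comp (by fun_prop)).intervalIntegrable _ _

end Slices

/-! ### An abstract duality identity for damped second order equations -/

section Duality

variable {E F G : Type*} [NormedAddCommGroup E] [NormedSpace ℝ E]
  [NormedAddCommGroup F] [NormedSpace ℝ F] [NormedAddCommGroup G] [NormedSpace ℝ G]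

theorem integrableOn_bilin (B : E →L[ℝ] F →L[ℝ] G) {a : ℝ → E} {b : ℝ → F} {T : ℝ}
    (ha : IntegrableOn a (Ioo 0 T)) (hb : ContinuousOn b (Icc 0 T)) :
    IntegrableOn (fun t => B (a t) (b t)) (Ioo 0 T) := by
  obtain ⟨C, hC⟩ := isCompact_Icc.exists_bound_of_continuousOn hb
  have hbm : AEStronglyMeasurable b (volume.restrict (Ioo 0 T)) :=
    (hb.mono Ioo_subset_Icc_self).aestronglyMeasurable measurableSet_Ioo
  refine (ha.norm.const_mul (‖B‖ * C)).mono' (B.aestronglyMeasurable_comp₂ ha.1 hbm) ?_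
  filter_upwards [ae_restrict_mem measurableSet_Ioo] with t ht
  calc ‖B (a t) (b t)‖ ≤ ‖B‖ * ‖a t‖ * ‖b t‖ := B.le_opNorm₂ _ _
    _ ≤ ‖B‖ * ‖a t‖ * C := by gcongr; exact hC t (Ioo_subset_Icc_self ht)
    _ = _ := by ring

omit [NormedSpace ℝ F] in
theorem continuousOn_comp_sub {b : ℝ → F} {T : ℝ} (hb : ContinuousOn b (Icc 0 T)) :
    ContinuousOn (fun t => b (T - t)) (Icc 0 T) :=
  hb.comp (by fun_prop) fun t ht => ⟨by linarith [ht.2], by linarith [ht.1]⟩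

theorem integral_Ioo_reflect (T : ℝ) (b : ℝ → E) :
    ∫ t in Ioo 0 T, b (T - t) = ∫ t in Ioo 0 T, b t := by
  rw [integral_Ioo_comp_sub, sub_self, sub_zero]

/-- Here d and a are the velocities of U and u₂, c that of the exterior datum, N the nonlinear
difference, and P encodes the test space. Pairing the integrated equation of U with (a - c)(T - t),
and that of u₂ with d(T - t), gives the same mass term. Equating the other sides, the energy terms
in u₂ cancel by symmetry of B under convolution; only N and the terms in c remain. -/
theorem duality_identity [CompleteSpace E] {T : ℝ} (M B : E →L[ℝ] E →L[ℝ] ℝ) (P : E →L[ℝ] E)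
    (hM : ∀ u v, M u v = M v u) (hB : ∀ u v, B u v = B v u)
    {d a c : ℝ → E} {N : ℝ → E →L[ℝ] ℝ}
    (hd : IntegrableOn d (Ioo 0 T)) (ha : IntegrableOn a (Ioo 0 T))
    (hc : IntegrableOn c (Ioo 0 T)) (hN : IntegrableOn N (Ioo 0 T))
    (hPd : ∀ᵐ t ∂(volume.restrict (Ioo 0 T)), P (d t) = d t)
    (hPac : ∀ᵐ t ∂(volume.restrict (Ioo 0 T)), P (a t - c t) = a t - c t)
    (hMc : ∀ t v, P v = v → M (c t) v = 0)
    (hPU : ∀ᵐ t ∂(volume.restrict (Ioo 0 T)), P (∫ τ in Ioo 0 t, d τ) = ∫ τ in Ioo 0 t, d τ)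
    (hPw : ∀ᵐ t ∂(volume.restrict (Ioo 0 T)),
      P (∫ τ in Ioo 0 t, (a τ - c τ)) = ∫ τ in Ioo 0 t, (a τ - c τ))
    (heqd : ∀ᵐ t ∂(volume.restrict (Ioo 0 T)), (M (d t)).comp P =
      -∫ τ in Ioo 0 t, (B (d τ) + B (∫ r in Ioo 0 τ, d r) + N τ).comp P)
    (heqa : ∀ᵐ t ∂(volume.restrict (Ioo 0 T)), (M (a t)).comp P =
      -∫ τ in Ioo 0 t, (B (a τ) + B (∫ r in Ioo 0 τ, a r)).comp P) :
    ∫ t in Ioo 0 T, N t (∫ τ in Ioo 0 (T - t), (a τ - c τ)) =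
      (∫ t in Ioo 0 T, B (∫ τ in Ioo 0 t, d τ) (∫ τ in Ioo 0 (T - t), c τ)) +
        ∫ t in Ioo 0 T, B (d t) (∫ τ in Ioo 0 (T - t), c τ) := by
  have hac : IntegrableOn (fun t => a t - c t) (Ioo 0 T) := ha.sub hc
  have hU := continuous_primitive hd
  have hA := continuous_primitive ha
  have hC := continuous_primitive hc
  have hw := continuous_primitive hac
  have hw_eq : ∀ t ∈ Ioo 0 T, ∫ τ in Ioo 0 (T - t), (a τ - c τ) =
      (∫ τ in Ioo 0 (T - t), a τ) - ∫ τ in Ioo 0 (T - t), c τ := fun t ht =>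
    integral_sub (ha.mono_set (Ioo_subset_Ioo_right (by linarith [ht.1])))
      (hc.mono_set (Ioo_subset_Ioo_right (by linarith [ht.1])))
  let R : (E →L[ℝ] ℝ) →L[ℝ] (E →L[ℝ] ℝ) := (ContinuousLinearMap.compL ℝ E E ℝ).flip P
  have hBU := B.integrable_comp (integrableOn_primitive hd)
  have hBA := B.integrable_comp (integrableOn_primitive ha)
  have hBd := B.integrable_comp hd
  have hBa := B.integrable_comp ha
  have hGd : IntegrableOn (fun τ => (B (d τ) + B (∫ r in Ioo 0 τ, d r) + N τ).comp P) (Ioo 0 T) :=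
    R.integrable_comp ((hBd.add hBU).add hN)
  have hGa : IntegrableOn (fun τ => (B (a τ) + B (∫ r in Ioo 0 τ, a r)).comp P) (Ioo 0 T) :=
    R.integrable_comp (hBa.add hBA)
  have s1 := integral_bilin_primitive_sub (ContinuousLinearMap.id ℝ (E →L[ℝ] ℝ)) hGd hac
  have s2 := integral_bilin_primitive_sub (ContinuousLinearMap.id ℝ (E →L[ℝ] ℝ)) hGa hd
  simp only [ContinuousLinearMap.id_apply] at s1 s2
  have s1l : ∫ t in Ioo 0 T, (∫ τ in Ioo 0 t, (B (d τ) + B (∫ r in Ioo 0 τ, d r) + N τ).comp P)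
      (a (T - t) - c (T - t)) = -∫ t in Ioo 0 T, M (d t) (a (T - t) - c (T - t)) := by
    rw [← integral_neg]
    refine integral_congr_ae ?_
    filter_upwards [heqd, ae_comp_sub hPac] with t h1 h2
    have h3 := congrArg (fun L => L (a (T - t) - c (T - t))) h1
    simp only [ContinuousLinearMap.comp_apply, neg_apply, h2] at h3
    rw [h3, neg_neg]
  -- The mass term is brought to the form of `s1l` by reflecting time and using symmetry of M;
  -- subtracting c is harmless because M (c t) vanishes on vectors fixed by P.
  have s2l : ∫ t in Ioo 0 T, (∫ τ in Ioo 0 t, (B (a τ) + B (∫ r in Ioo 0 τ, a r)).comp P)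
      (d (T - t)) = -∫ t in Ioo 0 T, M (d t) (a (T - t) - c (T - t)) := by
    rw [← integral_Ioo_reflect T fun t => M (d t) (a (T - t) - c (T - t)), ← integral_neg]
    refine integral_congr_ae ?_
    filter_upwards [heqa, ae_comp_sub hPd] with t h1 h2
    have h3 := congrArg (fun L => L (d (T - t))) h1
    simp only [ContinuousLinearMap.comp_apply, neg_apply, h2] at h3
    rw [sub_sub_cancel, hM (d (T - t)), map_sub, sub_apply, hMc _ _ h2,
      sub_zero, h3, neg_neg]
  have s1r : ∫ t in Ioo 0 T, ((B (d t) + B (∫ r in Ioo 0 t, d r) + N t).comp P)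
      (∫ τ in Ioo 0 (T - t), (a τ - c τ)) =
      (((∫ t in Ioo 0 T, B (d t) (∫ τ in Ioo 0 (T - t), a τ)) -
          ∫ t in Ioo 0 T, B (d t) (∫ τ in Ioo 0 (T - t), c τ)) +
        ((∫ t in Ioo 0 T, B (∫ τ in Ioo 0 t, d τ) (∫ τ in Ioo 0 (T - t), a τ)) -
          ∫ t in Ioo 0 T, B (∫ τ in Ioo 0 t, d τ) (∫ τ in Ioo 0 (T - t), c τ))) +
      ∫ t in Ioo 0 T, N t (∫ τ in Ioo 0 (T - t), (a τ - c τ)) := by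
    have i1 := integrableOn_bilin B hd (continuousOn_comp_sub hA)
    have i2 := integrableOn_bilin B hd (continuousOn_comp_sub hC)
    have i3 := integrableOn_bilin B (integrableOn_primitive hd) (continuousOn_comp_sub hA)
    have i4 := integrableOn_bilin B (integrableOn_primitive hd) (continuousOn_comp_sub hC)
    have i5 := integrableOn_bilin (ContinuousLinearMap.id ℝ (E →L[ℝ] ℝ)) hN
      (continuousOn_comp_sub hw)
    have j1 := i1.fun_sub i2
    have j2 := i3.fun_sub i4
    rw [← integral_sub i1 i2, ← integral_sub i3 i4, ← integral_add j1 j2]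
    refine Eq.trans ?_ (integral_add (j1.fun_add j2) i5)
    refine integral_congr_ae ?_
    filter_upwards [ae_comp_sub hPw, ae_restrict_mem measurableSet_Ioo] with t h1 h2
    rw [ContinuousLinearMap.comp_apply, h1, add_apply,
      add_apply, hw_eq t h2, map_sub (B _), map_sub (B _)]
  have s2r : ∫ t in Ioo 0 T, ((B (a t) + B (∫ r in Ioo 0 t, a r)).comp P)
      (∫ τ in Ioo 0 (T - t), d τ) =
      (∫ t in Ioo 0 T, B (d t) (∫ τ in Ioo 0 (T - t), a τ)) +
        ∫ t in Ioo 0 T, B (∫ τ in Ioo 0 t, d τ) (∫ τ in Ioo 0 (T - t), a τ) := by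
    have i1 := integrableOn_bilin B ha (continuousOn_comp_sub hU)
    have i2 := integrableOn_bilin B (integrableOn_primitive ha) (continuousOn_comp_sub hU)
    -- In convolution notation, d ∗ (1 ∗ a) = (1 ∗ d) ∗ a, combined with symmetry of B.
    have e1 : ∫ t in Ioo 0 T, B (d t) (∫ τ in Ioo 0 (T - t), a τ) =
        ∫ t in Ioo 0 T, B (a t) (∫ τ in Ioo 0 (T - t), d τ) := by
      rw [← integral_bilin_primitive_sub B ha hd, ← integral_Ioo_reflect T fun t =>
        B (∫ τ in Ioo 0 t, a τ) (d (T - t))]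
      simp only [sub_sub_cancel, hB (d _)]
    have e2 : ∫ t in Ioo 0 T, B (∫ τ in Ioo 0 t, d τ) (∫ τ in Ioo 0 (T - t), a τ) =
        ∫ t in Ioo 0 T, B (∫ τ in Ioo 0 t, a τ) (∫ τ in Ioo 0 (T - t), d τ) := by
      rw [← integral_Ioo_reflect]
      simp only [sub_sub_cancel]
      exact integral_congr_ae (Filter.Eventually.of_forall fun t => hB _ _)
    rw [e1, e2, ← integral_add i1 i2]
    refine integral_congr_ae ?_
    filter_upwards [ae_comp_sub hPU] with t h1
    rw [ContinuousLinearMap.comp_apply, h1]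
    rfl
  rw [s1l, s1r] at s1
  rw [s2l, s2r] at s2
  linarith

end Duality

/-! ### From the weak equations to the abstract duality identity -/

section AbstractEquation

variable {E F Y : Type*} [NormedAddCommGroup E] [NormedSpace ℝ E]
  [NormedAddCommGroup F] [NormedSpace ℝ F] [NormedAddCommGroup Y] [NormedSpace ℝ Y] {T : ℝ}

theorem HasInitialValue.comp {X Z : Type*} [TopologicalSpace X] [TopologicalSpace Z] {g : ℝ → X}
    {x : X} (hg : HasInitialValue T g x) {L : X → Z} (hL : Continuous L) :
    HasInitialValue T (fun t => L (g t)) (L x) := by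
  obtain ⟨h, h1, h2, h3⟩ := hg
  exact ⟨fun t => L (h t), hL.comp_continuousOn h1, h2.fun_comp L, by simp only [h3]⟩

/-- If the primitive of `a` is fixed by `P`, so is `a`. -/
theorem ae_fixed_of_primitive [CompleteSpace E]
    (P : E →L[ℝ] E) {a : ℝ → E} (ha : IntegrableOn a (Ioo 0 T))
    (h : ∀ᵐ t ∂(volume.restrict (Ioo (0 : ℝ) T)), P (∫ τ in Ioo 0 t, a τ) = ∫ τ in Ioo 0 t, a τ) :
    ∀ᵐ t ∂(volume.restrict (Ioo (0 : ℝ) T)), P (a t) = a t := by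
  have hb : IntegrableOn (fun t => P (a t) - a t) (Ioo 0 T) := (P.integrable_comp ha).sub ha
  have h1 := ae_eq_zero_of_testFunctions hb fun η hη => by
    -- P commutes with the Bochner integral, so the primitive of P a - a is zero, and so is its weak
    -- derivative.
    rw [← neg_eq_zero, ← weakDeriv_primitive hb hη]
    refine integral_eq_zero_of_ae ?_
    filter_upwards [h, ae_restrict_mem measurableSet_Ioo] with t h1 h2
    have h3 : IntegrableOn a (Ioo 0 t) := ha.mono_set (Ioo_subset_Ioo_right h2.2.le)
    rw [integral_sub (P.integrable_comp h3) h3, P.integral_comp_comm h3, h1, sub_self, smul_zero]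
    rfl
  filter_upwards [h1] with t ht
  exact sub_eq_zero.mp ht

theorem integrableOn_form [CompleteSpace E] (B : E →L[ℝ] E →L[ℝ] ℝ) (P : E →L[ℝ] E) {a : ℝ → E}
    (ha : IntegrableOn a (Ioo 0 T)) {N : E → E →L[ℝ] ℝ} (hN : Continuous N) :
    IntegrableOn (fun τ => (B (a τ) + B (∫ r in Ioo 0 τ, a r) + N (∫ r in Ioo 0 τ, a r)).comp P)
      (Ioo 0 T) := by
  have h1 := hN.comp_continuousOn (continuous_primitive ha)
  exact ((ContinuousLinearMap.compL ℝ E E ℝ).flip P).integrable_comp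
    (((B.integrable_comp ha).add (B.integrable_comp (integrableOn_primitive ha))).add
      ((h1.integrableOn_compact isCompact_Icc).mono_set Ioo_subset_Icc_self))

/-- The time integrated form of a weak damped second order equation. -/
theorem ae_integrated_equation [CompleteSpace E] (hT : 0 < T) (ι : E →L[ℝ] F)
    (M : F →L[ℝ] E →L[ℝ] ℝ) (B : E →L[ℝ] E →L[ℝ] ℝ) (P : E →L[ℝ] E) {a u : ℝ → E}
    {N : E → E →L[ℝ] ℝ} (hN : Continuous N) (ha : IntegrableOn a (Ioo 0 T))
    (hu : ∀ᵐ t ∂(volume.restrict (Ioo (0 : ℝ) T)), u t = ∫ τ in Ioo 0 t, a τ)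
    (h0 : HasInitialValue T (fun t => ι (a t)) 0)
    (heq : ∀ v, ∀ η ∈ CcInfty (Ioo (0 : ℝ) T),
      -(∫ t in Ioo (0 : ℝ) T, deriv η t * M (ι (a t)) (P v)) +
        ∫ t in Ioo (0 : ℝ) T, η t * (B (a t) (P v) + B (u t) (P v) + N (u t) (P v)) = 0) :
    ∀ᵐ t ∂(volume.restrict (Ioo (0 : ℝ) T)), (M (ι (a t))).comp P = -∫ τ in Ioo 0 t,
      (B (a τ) + B (∫ r in Ioo 0 τ, a r) + N (∫ r in Ioo 0 τ, a r)).comp P := by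
  have hG := integrableOn_form B P ha hN
  let R := (ContinuousLinearMap.compL ℝ E E ℝ).flip P
  have hM : IntegrableOn (fun t => (M (ι (a t))).comp P) (Ioo 0 T) :=
    (R.comp (M.comp ι)).integrable_comp ha
  simp only [← integral_neg]
  -- The primitive lemma is applied to functions with values in the dual of E. The weak form is
  -- checked on each v, yet the resulting null set of times does not depend on v.
  refine ae_eq_primitive_of_weakDeriv hT hM hG.neg (fun η hη => ?_) ?_
  · ext v
    have h1 := CcInfty.integrable_smul (CcInfty.deriv_mem hη) hM
    have h2 := CcInfty.integrable_smul hη hG.fun_neg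
    rw [neg_apply, ContinuousLinearMap.integral_apply h1, ContinuousLinearMap.integral_apply h2,
      ← integral_neg]
    have h3 : ∫ t in Ioo (0 : ℝ) T, η t * (B (a t) (P v) + B (u t) (P v) + N (u t) (P v)) =
        ∫ t in Ioo (0 : ℝ) T, -(η t • -((B (a t) + B (∫ r in Ioo 0 t, a r) +
          N (∫ r in Ioo 0 t, a r)).comp P)) v := by
      refine integral_congr_ae ?_
      filter_upwards [hu] with t ht
      rw [ht]
      simp only [smul_apply, neg_apply, ContinuousLinearMap.comp_apply, add_apply, smul_eq_mul,
        mul_neg, neg_neg]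
    have h4 := heq v η hη
    rw [h3] at h4
    exact (sub_eq_zero.mp ((sub_eq_neg_add _ _).trans h4)).symm
  · have h1 := h0.comp (R.comp M).continuous
    rwa [map_zero] at h1

/-- The duality identity for two nonlinear equations and a linear adjoint equation. -/
theorem nonlinear_duality_identity [CompleteSpace E] (hT : 0 < T) (ι : E →L[ℝ] F)
    (M : F →L[ℝ] E →L[ℝ] ℝ) (B : E →L[ℝ] E →L[ℝ] ℝ) (P : E →L[ℝ] E)
    (hM : ∀ u v, M (ι u) v = M (ι v) u) (hB : ∀ u v, B u v = B v u)
    {J₁ J₂ : E → E →L[ℝ] Y} (l : Y →L[ℝ] ℝ) (hJ₁ : Continuous J₁) (hJ₂ : Continuous J₂)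
    {a₁ a₂ a u₁ u₂ u c C : ℝ → E}
    (ha₁ : IntegrableOn a₁ (Ioo 0 T)) (ha₂ : IntegrableOn a₂ (Ioo 0 T))
    (ha : IntegrableOn a (Ioo 0 T)) (hc : IntegrableOn c (Ioo 0 T))
    (hu₁ : ∀ᵐ t ∂(volume.restrict (Ioo (0 : ℝ) T)), u₁ t = ∫ τ in Ioo 0 t, a₁ τ)
    (hu₂ : ∀ᵐ t ∂(volume.restrict (Ioo (0 : ℝ) T)), u₂ t = ∫ τ in Ioo 0 t, a₂ τ)
    (hu : ∀ᵐ t ∂(volume.restrict (Ioo (0 : ℝ) T)), u t = ∫ τ in Ioo 0 t, a τ)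
    (hC : ∀ᵐ t ∂(volume.restrict (Ioo (0 : ℝ) T)), C t = ∫ τ in Ioo 0 t, c τ)
    (h0₁ : HasInitialValue T (fun t => ι (a₁ t)) 0) (h0₂ : HasInitialValue T (fun t => ι (a₂ t)) 0)
    (h0 : HasInitialValue T (fun t => ι (a t)) 0)
    (hP : ∀ᵐ t ∂(volume.restrict (Ioo (0 : ℝ) T)), P (u₁ t - u₂ t) = u₁ t - u₂ t)
    (hPC : ∀ᵐ t ∂(volume.restrict (Ioo (0 : ℝ) T)), P (u t - C t) = u t - C t)
    (hMc : ∀ t v, P v = v → M (ι (c t)) v = 0)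
    (heq₁ : ∀ v, ∀ η ∈ CcInfty (Ioo (0 : ℝ) T),
      -(∫ t in Ioo (0 : ℝ) T, deriv η t * M (ι (a₁ t)) (P v)) +
        ∫ t in Ioo (0 : ℝ) T,
          η t * (B (a₁ t) (P v) + B (u₁ t) (P v) + l (J₁ (u₁ t) (P v))) = 0)
    (heq₂ : ∀ v, ∀ η ∈ CcInfty (Ioo (0 : ℝ) T),
      -(∫ t in Ioo (0 : ℝ) T, deriv η t * M (ι (a₂ t)) (P v)) +
        ∫ t in Ioo (0 : ℝ) T,
          η t * (B (a₂ t) (P v) + B (u₂ t) (P v) + l (J₂ (u₂ t) (P v))) = 0)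
    (heq : ∀ v, ∀ η ∈ CcInfty (Ioo (0 : ℝ) T),
      -(∫ t in Ioo (0 : ℝ) T, deriv η t * M (ι (a t)) (P v)) +
        ∫ t in Ioo (0 : ℝ) T, η t * (B (a t) (P v) + B (u t) (P v)) = 0) :
    IntegrableOn (fun t => (J₁ (u₁ t) - J₂ (u₂ t)) (u (T - t) - C (T - t))) (Ioo 0 T) ∧
    ((∫ t in Ioo 0 T, B (u₁ t) (C (T - t))) + ∫ t in Ioo 0 T, B (a₁ t) (C (T - t))) -
      ((∫ t in Ioo 0 T, B (u₂ t) (C (T - t))) + ∫ t in Ioo 0 T, B (a₂ t) (C (T - t))) =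
      ∫ t in Ioo 0 T, l ((J₁ (u₁ t) - J₂ (u₂ t)) (u (T - t) - C (T - t))) := by
  have hd : IntegrableOn (fun t => a₁ t - a₂ t) (Ioo 0 T) := ha₁.sub ha₂
  have hac : IntegrableOn (fun t => a t - c t) (Ioo 0 T) := ha.sub hc
  have hint : ∀ {f g : ℝ → E}, IntegrableOn f (Ioo 0 T) → IntegrableOn g (Ioo 0 T) →
      ∀ t ∈ Ioo 0 T, ∫ τ in Ioo 0 t, (f τ - g τ) = (∫ τ in Ioo 0 t, f τ) - ∫ τ in Ioo 0 t, g τ :=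
    fun hf hg t ht => integral_sub (hf.mono_set (Ioo_subset_Ioo_right ht.2.le))
      (hg.mono_set (Ioo_subset_Ioo_right ht.2.le))
  have hmem := ae_restrict_mem (μ := (volume : Measure ℝ)) (s := Ioo 0 T) measurableSet_Ioo
  have hPU : ∀ᵐ t ∂(volume.restrict (Ioo 0 T)),
      P (∫ τ in Ioo 0 t, (a₁ τ - a₂ τ)) = ∫ τ in Ioo 0 t, (a₁ τ - a₂ τ) := by
    filter_upwards [hP, hu₁, hu₂, hmem] with t h1 h2 h3 h4
    rwa [hint ha₁ ha₂ t h4, ← h2, ← h3]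
  have hw : ∀ᵐ t ∂(volume.restrict (Ioo 0 T)), u t - C t = ∫ τ in Ioo 0 t, (a τ - c τ) := by
    filter_upwards [hu, hC, hmem] with t h2 h3 h4
    rw [hint ha hc t h4, ← h2, ← h3]
  have hPw : ∀ᵐ t ∂(volume.restrict (Ioo 0 T)),
      P (∫ τ in Ioo 0 t, (a τ - c τ)) = ∫ τ in Ioo 0 t, (a τ - c τ) := by
    filter_upwards [hPC, hw] with t h1 h2
    rwa [← h2]
  have hlJ : ∀ {J : E → E →L[ℝ] Y}, Continuous J → Continuous fun v => l.comp (J v) := fun hJ =>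
    (ContinuousLinearMap.compL ℝ E Y ℝ l).continuous.comp hJ
  have q₁ := ae_integrated_equation hT ι M B P (hlJ hJ₁) ha₁ hu₁ h0₁ heq₁
  have q₂ := ae_integrated_equation hT ι M B P (hlJ hJ₂) ha₂ hu₂ h0₂ heq₂
  -- The linear equation is the case N = 0 of the same statement.
  have q := ae_integrated_equation hT ι M B P (N := fun _ => 0) continuous_const ha hu h0
    (by simpa using heq)
  simp only [add_zero] at q
  have f₁ := integrableOn_form B P ha₁ (hlJ hJ₁)
  have f₂ := integrableOn_form B P ha₂ (hlJ hJ₂)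
  have hJint : ∀ {J : E → E →L[ℝ] Y}, Continuous J → ∀ {b : ℝ → E}, IntegrableOn b (Ioo 0 T) →
      IntegrableOn (fun t => J (∫ τ in Ioo 0 t, b τ)) (Ioo 0 T) := fun hJ _ hb =>
    ((hJ.comp_continuousOn (continuous_primitive hb)).integrableOn_compact
      isCompact_Icc).mono_set Ioo_subset_Icc_self
  have hN : IntegrableOn (fun t => l.comp (J₁ (∫ τ in Ioo 0 t, a₁ τ)) -
      l.comp (J₂ (∫ τ in Ioo 0 t, a₂ τ))) (Ioo 0 T) :=
    (((ContinuousLinearMap.compL ℝ E Y ℝ l).integrable_comp (hJint hJ₁ ha₁)).sub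
      ((ContinuousLinearMap.compL ℝ E Y ℝ l).integrable_comp (hJint hJ₂ ha₂)))
  have heqd : ∀ᵐ t ∂(volume.restrict (Ioo 0 T)), (M (ι (a₁ t - a₂ t))).comp P =
      -∫ τ in Ioo 0 t, (B (a₁ τ - a₂ τ) + B (∫ r in Ioo 0 τ, (a₁ r - a₂ r)) +
        (l.comp (J₁ (∫ r in Ioo 0 τ, a₁ r)) - l.comp (J₂ (∫ r in Ioo 0 τ, a₂ r)))).comp P := by
    filter_upwards [q₁, q₂, hmem] with t h1 h2 h3
    rw [map_sub, map_sub, ContinuousLinearMap.sub_comp, h1, h2, neg_sub_neg, ← neg_sub,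
      ← integral_sub (f₁.mono_set (Ioo_subset_Ioo_right h3.2.le))
        (f₂.mono_set (Ioo_subset_Ioo_right h3.2.le))]
    congr 1
    refine setIntegral_congr_fun measurableSet_Ioo fun τ hτ => ?_
    rw [hint ha₁ ha₂ τ ⟨hτ.1, hτ.2.trans h3.2⟩, map_sub, map_sub, ← ContinuousLinearMap.sub_comp]
    congr 1
    abel
  -- Along the given solutions the nonlinear difference is merely an integrable curve of
  -- functionals. That the velocities d and a - c are fixed by P is inherited from their primitives.
  have key := duality_identity (M.comp ι) B P hM hB hd ha hc hN
    (ae_fixed_of_primitive P hd hPU) (ae_fixed_of_primitive P hac hPw) hMc hPU hPw heqd q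
  constructor
  -- Integrability is proved with values in Y, before applying l; with Y = L¹(Ω) this controls
  -- absolute values.
  · refine (integrableOn_bilin (ContinuousLinearMap.id ℝ (E →L[ℝ] Y))
      ((hJint hJ₁ ha₁).sub (hJint hJ₂ ha₂)) (continuousOn_comp_sub
        (continuous_primitive hac))).congr ?_
    filter_upwards [hu₁, hu₂, ae_comp_sub hw] with t h1 h2 h3
    rw [h1, h2, h3]
    rfl
  · have hCc := continuousOn_comp_sub (continuous_primitive hc)
    have c₁ : ∀ {b v : ℝ → E}, (∀ᵐ t ∂(volume.restrict (Ioo (0 : ℝ) T)), v t = b t) →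
        ∫ t in Ioo 0 T, B (v t) (C (T - t)) =
          ∫ t in Ioo 0 T, B (b t) (∫ τ in Ioo 0 (T - t), c τ) := fun h => by
      refine integral_congr_ae ?_
      filter_upwards [h, ae_comp_sub hC] with t h1 h2
      rw [h1, h2]
    rw [c₁ hu₁, c₁ hu₂, c₁ (Filter.Eventually.of_forall fun t => rfl),
      c₁ (Filter.Eventually.of_forall fun t => rfl)]
    have e₁ : ∫ t in Ioo 0 T, B (∫ τ in Ioo 0 t, (a₁ τ - a₂ τ)) (∫ τ in Ioo 0 (T - t), c τ) =
        (∫ t in Ioo 0 T, B (∫ τ in Ioo 0 t, a₁ τ) (∫ τ in Ioo 0 (T - t), c τ)) -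
          ∫ t in Ioo 0 T, B (∫ τ in Ioo 0 t, a₂ τ) (∫ τ in Ioo 0 (T - t), c τ) := by
      rw [← integral_sub (integrableOn_bilin B (integrableOn_primitive ha₁) hCc)
        (integrableOn_bilin B (integrableOn_primitive ha₂) hCc)]
      refine setIntegral_congr_fun measurableSet_Ioo fun t ht => ?_
      rw [hint ha₁ ha₂ t ht, map_sub, sub_apply]
    have e₂ : ∫ t in Ioo 0 T, B (a₁ t - a₂ t) (∫ τ in Ioo 0 (T - t), c τ) =
        (∫ t in Ioo 0 T, B (a₁ t) (∫ τ in Ioo 0 (T - t), c τ)) -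
          ∫ t in Ioo 0 T, B (a₂ t) (∫ τ in Ioo 0 (T - t), c τ) := by
      rw [← integral_sub (integrableOn_bilin B ha₁ hCc) (integrableOn_bilin B ha₂ hCc)]
      refine integral_congr_ae (Filter.Eventually.of_forall fun t => ?_)
      simp only
      rw [map_sub, sub_apply]
    have e₃ : ∫ t in Ioo 0 T, l ((J₁ (u₁ t) - J₂ (u₂ t)) (u (T - t) - C (T - t))) =
        ∫ t in Ioo 0 T, (l.comp (J₁ (∫ τ in Ioo 0 t, a₁ τ)) -
          l.comp (J₂ (∫ τ in Ioo 0 t, a₂ τ))) (∫ τ in Ioo 0 (T - t), (a τ - c τ)) := by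
      refine integral_congr_ae ?_
      filter_upwards [hu₁, hu₂, ae_comp_sub hw] with t h1 h2 h3
      rw [h1, h2, h3, sub_apply, sub_apply, map_sub]
      rfl
    rw [e₃, key, e₁, e₂]
    ring

end AbstractEquation

/-! ### Properties of solutions -/

section Solutions

variable {n : ℕ} {s T : ℝ} {Ω : Set (Rn n)}

theorem inner_L2_eq (f g : L2 n) : inner ℝ f g = ∫ x, f x * g x := by
  rw [L2.inner_def]
  exact integral_congr_ae (Filter.Eventually.of_forall fun x => mul_comm _ _)

/-- The bilinear form `⟨g, v⟩_{L²}` for `g ∈ L²(ℝⁿ)` and `v ∈ H^s(ℝⁿ)`. -/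
noncomputable def Hs.massForm (n : ℕ) (s : ℝ) : L2 n →L[ℝ] Hs n s →L[ℝ] ℝ :=
  (innerSL ℝ : L2 n →L[ℝ] L2 n →L[ℝ] ℝ).bilinearComp (ContinuousLinearMap.id ℝ _) (Hs.valL n s)

/-- The bilinear form `⟨(-Δ)^{s/2} u, (-Δ)^{s/2} v⟩_{L²}` on `H^s(ℝⁿ)`. -/
noncomputable def Hs.energyForm (n : ℕ) (s : ℝ) : Hs n s →L[ℝ] Hs n s →L[ℝ] ℝ :=
  (innerSL ℝ : L2 n →L[ℝ] L2 n →L[ℝ] ℝ).bilinearComp (Hs.lapL n s) (Hs.lapL n s)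

theorem Hs.massForm_apply (g : L2 n) (v : Hs n s) : massForm n s g v = ∫ x, g x * v.val x :=
  inner_L2_eq _ _

theorem Hs.energyForm_apply (u v : Hs n s) : energyForm n s u v = ∫ x, u.lap x * v.lap x :=
  inner_L2_eq _ _

theorem Hs.massForm_comm (u v : Hs n s) :
    massForm n s (valL n s u) v = massForm n s (valL n s v) u := by
  simp only [massForm_apply, valL_apply, mul_comm]

theorem Hs.energyForm_comm (u v : Hs n s) : energyForm n s u v = energyForm n s v u := by
  simp only [energyForm_apply, mul_comm]

theorem L2T.integrableOn (u : L2T n s T) : IntegrableOn u (Ioo 0 T) :=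
  (Lp.memLp u).integrable (by norm_num)

theorem IsTimeDeriv.add {u v u' v' : L2T n s T} (hu : IsTimeDeriv u u') (hv : IsTimeDeriv v v') :
    IsTimeDeriv (u + v) (u' + v') := by
  intro η hη
  have h1 : ∀ {η : ℝ → ℝ}, η ∈ CcInfty (Ioo (0 : ℝ) T) → ∀ a b : L2T n s T,
      ∫ t in Ioo (0 : ℝ) T, η t • (a + b) t =
        (∫ t in Ioo (0 : ℝ) T, η t • a t) + ∫ t in Ioo (0 : ℝ) T, η t • b t := by
    intro η hη a b
    rw [← integral_add (CcInfty.integrable_smul hη (L2T.integrableOn a))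
      (CcInfty.integrable_smul hη (L2T.integrableOn b))]
    refine integral_congr_ae ?_
    filter_upwards [Lp.coeFn_add a b] with t ht
    rw [ht, Pi.add_apply, smul_add]
  rw [h1 (CcInfty.deriv_mem hη), h1 hη, hu η hη, hv η hη, neg_add]

/-- `dt` is defined by choice, so a witness is needed: the sum of the derivatives of the two
components. -/
theorem isTimeDeriv_dt {u : L2T n s T} (hu : u ∈ WExt s T Ω) : IsTimeDeriv u (dt u) := by
  obtain ⟨v, ⟨-, v', hv, -⟩, ψ, ⟨⟨-, ψ', hψ, -⟩, -⟩, rfl⟩ := hu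
  exact Classical.epsilon_spec (p := IsTimeDeriv (v + ψ)) ⟨_, hv.add hψ⟩

theorem IsSolution.ae_eq_primitive {f : Rn n → ℝ → ℝ} {φ : ExtData Ω T} {u : L2T n s T}
    (hT : 0 < T) (hu : IsSolution Ω f φ u) :
    ∀ᵐ t ∂(volume.restrict (Ioo (0 : ℝ) T)), u t = ∫ τ in Ioo 0 t, dt u τ :=
  ae_eq_primitive_of_weakDeriv hT (L2T.integrableOn u) (L2T.integrableOn _)
    (isTimeDeriv_dt hu.mem) hu.initial

/-- Allows the mass term of the equation, an integral over Ω, to be replaced by the form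
`Hs.massForm` on the whole space. -/
theorem Htilde.setIntegral_mul (hΩ : IsOpen Ω) (u : L2 n) {v : Hs n s} (hv : v ∈ Htilde s Ω) :
    ∫ x in Ω, u x * v.val x = ∫ x, u x * v.val x := by
  refine setIntegral_eq_integral_of_ae_compl_eq_zero ?_
  filter_upwards [Htilde.ae_eq_zero hΩ hv] with x hx h
  rw [hx h, mul_zero]

theorem IsSolution.weak_form {f : Rn n → ℝ → ℝ} {φ : ExtData Ω T} {u : L2T n s T}
    (hΩ : IsOpen Ω) (hu : IsSolution Ω f φ u) {v : Hs n s} (hv : v ∈ Htilde s Ω) {η : ℝ → ℝ}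
    (hη : η ∈ CcInfty (Ioo (0 : ℝ) T)) :
    -(∫ t in Ioo (0 : ℝ) T, deriv η t * Hs.massForm n s (Hs.valL n s (dt u t)) v) +
      ∫ t in Ioo (0 : ℝ) T, η t * (Hs.energyForm n s (dt u t) v + Hs.energyForm n s (u t) v +
        ∫ x in Ω, f x ((u t).val x) * v.val x) = 0 := by
  have h := hu.equation v hv η hη
  simp only [Htilde.setIntegral_mul hΩ _ hv] at h
  simpa only [Hs.energyForm_apply, Hs.massForm_apply, Hs.valL_apply] using h

/-- Almost everywhere equality on the cylinder passes to almost every slice by Fubini; the swap is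
needed because time is the second coordinate. -/
theorem coeFn_toExtData (φ : CcInfty (cyl (exterior Ω) T)) :
    ∀ᵐ t ∂(volume.restrict (Ioo (0 : ℝ) T)), ∀ᵐ x ∂(volume.restrict (exterior Ω)),
      toExtData φ (x, t) = φ.1 (x, t) := by
  have h : ∀ᵐ z ∂((volume.restrict (exterior Ω)).prod (volume.restrict (Ioo (0 : ℝ) T))),
      toExtData φ z = φ.1 z := by
    have h1 : ∀ᵐ z ∂(volume.restrict (cyl (exterior Ω) T)), toExtData φ z = φ.1 z :=
      AEEqFun.coeFn_mk _ φ.2.1.continuous.aestronglyMeasurable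
    rw [Measure.prod_restrict]
    exact h1
  exact Measure.ae_ae_of_ae_prod
    ((Measure.measurePreserving_swap (μ := volume.restrict (Ioo (0 : ℝ) T))
      (ν := volume.restrict (exterior Ω))).quasiMeasurePreserving.ae h)

theorem mem_Htilde_of_ae_eq_exterior (hs : 0 < s) (hΩ : IsBoundedLipschitzDomain Ω) {u v : Hs n s}
    (h : ∀ᵐ x ∂(volume.restrict (exterior Ω)), u.val x = v.val x) : u - v ∈ Htilde s Ω := by
  refine mem_Htilde_of_eq_zero_exterior hs hΩ _ ?_
  filter_upwards [h, ae_restrict_of_ae (Lp.coeFn_sub u.val v.val)] with x h1 h2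
  rw [Hs.val_sub, h2, Pi.sub_apply, h1, sub_self]

theorem solutionMap_eq {f : Rn n → ℝ → ℝ} {U : Set (L2T n s T)} {φ : ExtData Ω T} {u : L2T n s T}
    (h : ∃! u : L2T n s T, u ∈ U ∧ IsSolution Ω f φ u) (hu : u ∈ U ∧ IsSolution Ω f φ u) :
    solutionMap Ω f U φ = u :=
  h.unique (Classical.epsilon_spec (p := fun u => u ∈ U ∧ IsSolution Ω f φ u) ⟨u, hu⟩) hu

end Solutions

end ViscousWave

/-! ### The integral identity for the DN maps -/

theorem lemma5p2 {n : ℕ} (hn : 0 < n) {s T : ℝ} (hs : 0 < s) (hs_int : ∀ m : ℤ, s ≠ m)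
    (hT : 0 < T) {Ω : Set (Rn n)} (hΩ : IsBoundedLipschitzDomain Ω)
    (f₁ f₂ : Rn n → ℝ → ℝ) (a₁ a₂ : Rn n → ℝ) (p₁ p₂ : ℝ≥0∞) (r₁ r₂ : ℝ)
    (hf₁ : GrowthAssumption Ω s f₁ a₁ p₁ r₁) (hf₂ : GrowthAssumption Ω s f₂ a₂ p₂ r₂)
    (hr₁ : 0 < r₁) (hr₂ : 0 < r₂)
    (ha₁ : MemLp a₁ ∞ (volume.restrict Ω)) (ha₂ : MemLp a₂ ∞ (volume.restrict Ω))
    (hf₁_zero : ∀ᵐ x ∂(volume.restrict Ω), f₁ x 0 = 0)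
    (hf₂_zero : ∀ᵐ x ∂(volume.restrict Ω), f₂ x 0 = 0)
    -- neighborhoods of the origin on which the nonlinear problems are uniquely solvable
    (U₀₁ U₀₂ : Set (ExtData Ω T)) (U₁₁ U₁₂ : Set (L2T n s T))
    (hU₀₁ : IsNhdZero (WRest s T Ω) (restNorm s) U₀₁)
    (hU₀₂ : IsNhdZero (WRest s T Ω) (restNorm s) U₀₂)
    (hU₁₁ : IsNhdZero (WExt s T Ω) (extNorm Ω) U₁₁)
    (hU₁₂ : IsNhdZero (WExt s T Ω) (extNorm Ω) U₁₂)
    (hsolv₁ : ∀ φ ∈ U₀₁, ∃! u : L2T n s T, u ∈ U₁₁ ∧ IsSolution Ω f₁ φ u)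
    (hsolv₂ : ∀ φ ∈ U₀₂, ∃! u : L2T n s T, u ∈ U₁₂ ∧ IsSolution Ω f₂ φ u)
    (φ₁ φ₂ : CcInfty (cyl (exterior Ω) T))
    (hφ₁ : toExtData φ₁ ∈ U₀₁ ∩ U₀₂)
    -- the solutions `u₁^{(1)}`, `u₁^{(2)}` of the nonlinear problems with datum `φ₁`
    (u₁₁ u₁₂ : L2T n s T)
    (hu₁₁ : u₁₁ ∈ U₁₁ ∧ IsSolution Ω f₁ (toExtData φ₁) u₁₁)
    (hu₁₂ : u₁₂ ∈ U₁₂ ∧ IsSolution Ω f₂ (toExtData φ₁) u₁₂)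
    -- the solution `u₂` of the linear problem with datum `φ₂`
    (u₂ : L2T n s T) (hu₂ : IsSolution Ω (fun _ _ => 0) (toExtData φ₂) u₂) :
    -- the integral over `Ω_T` converges absolutely ...
    ((∀ᵐ t ∂(volume.restrict (Ioo (0 : ℝ) T)), IntegrableOn (fun x =>
        (f₁ x ((u₁₁ t).val x) - f₂ x ((u₁₂ t).val x)) *
          ((u₂ (T - t)).val x - timeReversal T φ₂.1 (x, t))) Ω) ∧
      IntegrableOn (fun t => ∫ x in Ω,
        |(f₁ x ((u₁₁ t).val x) - f₂ x ((u₁₂ t).val x)) *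
          ((u₂ (T - t)).val x - timeReversal T φ₂.1 (x, t))|) (Ioo (0 : ℝ) T)) ∧
    -- ... and the integral identity holds
    dnMap Ω f₁ U₁₁ (toExtData φ₁) (timeReversal T φ₂.1) -
        dnMap Ω f₂ U₁₂ (toExtData φ₁) (timeReversal T φ₂.1) =
      ∫ t in Ioo (0 : ℝ) T, ∫ x in Ω,
        (f₁ x ((u₁₁ t).val x) - f₂ x ((u₁₂ t).val x)) *
          ((u₂ (T - t)).val x - timeReversal T φ₂.1 (x, t)) := by
  have hvol : volume Ω ≠ ⊤ := hΩ.isBounded.measure_lt_top.ne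
  obtain ⟨J₁, hJ₁, hJ₁'⟩ := hf₁.exists_nemytskii hn hs hr₁ ha₁ hf₁_zero hvol
  obtain ⟨J₂, hJ₂, hJ₂'⟩ := hf₂.exists_nemytskii hn hs hr₂ ha₂ hf₂_zero hvol
  have hV : CompleteSpace (Htilde s Ω) := (Htilde.isClosed s Ω).completeSpace_coe
  -- The fixed vectors of this orthogonal projection are exactly H̃^s(Ω). Testing with P v for all v
  -- in H^s is therefore testing with H̃^s(Ω), while all functionals stay in the dual of the whole
  -- space.
  let P : Hs n s →L[ℝ] Hs n s := (Htilde s Ω).starProjection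
  have hPmem : ∀ v, P v ∈ Htilde s Ω := fun v => Submodule.starProjection_apply_mem _ v
  have hPfix : ∀ {v}, v ∈ Htilde s Ω → P v = v := fun hv =>
    Submodule.starProjection_eq_self_iff.mpr hv
  have hPmem' : ∀ {v}, P v = v → v ∈ Htilde s Ω := fun hv => hv ▸ hPmem _
  let l : Lp ℝ 1 (volume.restrict Ω) →L[ℝ] ℝ := L1.integralCLM
  have hl : ∀ g : Lp ℝ 1 (volume.restrict Ω), l g = ∫ x in Ω, g x := fun g =>
    (L1.integral_eq g).symm.trans (L1.integral_eq_integral g)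
  have hlJ : ∀ {J : Hs n s → Hs n s →L[ℝ] Lp ℝ 1 (volume.restrict Ω)} {f : Rn n → ℝ → ℝ},
      (∀ u v, ∀ᵐ x ∂(volume.restrict Ω), J u v x = f x (u.val x) * v.val x) → ∀ u v,
      l (J u v) = ∫ x in Ω, f x (u.val x) * v.val x := fun h u v =>
    (hl _).trans (integral_congr_ae (h u v))
  have hφ' := fderiv_snd_mem φ₂.2
  have key := nonlinear_duality_identity hT (Hs.valL n s) (Hs.massForm n s) (Hs.energyForm n s) P
    Hs.massForm_comm Hs.energyForm_comm l hJ₁ hJ₂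
    (L2T.integrableOn (dt u₁₁)) (L2T.integrableOn (dt u₁₂)) (L2T.integrableOn (dt u₂))
    (c := slice s fun z => fderiv ℝ φ₂.1 z (0, 1)) (C := slice s φ₂.1)
    (((continuous_slice hs hφ').continuousOn.integrableOn_compact isCompact_Icc).mono_set
      Ioo_subset_Icc_self)
    (hu₁₁.2.ae_eq_primitive hT) (hu₁₂.2.ae_eq_primitive hT) (hu₂.ae_eq_primitive hT)
    (by
      filter_upwards [ae_restrict_mem measurableSet_Ioo] with t ht
      exact slice_eq_integral hs φ₂.2 ht.1.le)
    hu₁₁.2.initial_deriv hu₁₂.2.initial_deriv hu₂.initial_deriv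
    (by
      filter_upwards [hu₁₁.2.exterior, hu₁₂.2.exterior] with t h1 h2
      refine hPfix (mem_Htilde_of_ae_eq_exterior hs hΩ ?_)
      filter_upwards [h1, h2] with x h3 h4
      rw [h3, h4])
    (by
      filter_upwards [hu₂.exterior, coeFn_toExtData φ₂] with t h1 h2
      refine hPfix (mem_Htilde_of_ae_eq_exterior hs hΩ ?_)
      filter_upwards [h1, h2, ae_restrict_of_ae (slice_val hs φ₂.2 t)] with x h3 h4 h5
      rw [h3, h4, h5])
    (by
      -- ∂_t φ₂ vanishes over Ω and v vanishes outside Ω, so their L² pairing is zero.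
      intro t v hv
      rw [Hs.massForm_apply, Hs.valL_apply]
      refine integral_eq_zero_of_ae ?_
      filter_upwards [Htilde.ae_eq_zero hΩ.isOpen (hPmem' hv), slice_val hs hφ' t] with x h1 h2
      by_cases hx : x ∈ Ω
      · rw [h2, CcInfty.eq_zero hφ' fun h => h.1 (subset_closure hx), zero_mul]
        rfl
      · rw [h1 hx, mul_zero]
        rfl)
    (fun v η hη => by
      simpa only [hlJ hJ₁'] using hu₁₁.2.weak_form hΩ.isOpen (hPmem v) hη)
    (fun v η hη => by
      simpa only [hlJ hJ₂'] using hu₁₂.2.weak_form hΩ.isOpen (hPmem v) hη)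
    (fun v η hη => by
      simpa only [zero_mul, integral_zero, add_zero] using hu₂.weak_form hΩ.isOpen (hPmem v) hη)
  have hpt : ∀ t, ∀ᵐ x ∂(volume.restrict Ω),
      (J₁ (u₁₁ t) - J₂ (u₁₂ t)) (u₂ (T - t) - slice s φ₂.1 (T - t)) x =
        (f₁ x ((u₁₁ t).val x) - f₂ x ((u₁₂ t).val x)) *
          ((u₂ (T - t)).val x - timeReversal T φ₂.1 (x, t)) := fun t => by
    filter_upwards [hJ₁' (u₁₁ t) (u₂ (T - t) - slice s φ₂.1 (T - t)),
      hJ₂' (u₁₂ t) (u₂ (T - t) - slice s φ₂.1 (T - t)),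
      Lp.coeFn_sub (J₁ (u₁₁ t) (u₂ (T - t) - slice s φ₂.1 (T - t)))
        (J₂ (u₁₂ t) (u₂ (T - t) - slice s φ₂.1 (T - t))),
      ae_restrict_of_ae (Lp.coeFn_sub (u₂ (T - t)).val (slice s φ₂.1 (T - t)).val),
      ae_restrict_of_ae (slice_val hs φ₂.2 (T - t))] with x h1 h2 h3 h4 h5
    rw [sub_apply, h3, Pi.sub_apply, h1, h2, Hs.val_sub, h4, Pi.sub_apply, h5, timeReversal]
    ring
  refine ⟨⟨Filter.Eventually.of_forall fun t => ?_, ?_⟩, ?_⟩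
  · exact (L1.integrable_coeFn _).congr (hpt t)
  -- The L¹(Ω) norm of the integrand at time t is the inner integral of the absolute value.
  · refine key.1.norm.congr (Filter.Eventually.of_forall fun t => ?_)
    simp only
    rw [L1.norm_eq_integral_norm]
    refine integral_congr_ae ?_
    filter_upwards [hpt t] with x hx
    rw [hx, Real.norm_eq_abs]
  · rw [dnMap, dnMap, solutionMap_eq (hsolv₁ _ hφ₁.1) hu₁₁, solutionMap_eq (hsolv₂ _ hφ₁.2) hu₁₂]
    have h1 := key.2
    simp only [Hs.energyForm_apply] at h1
    -- The element of H^s paired in `dnMap` at time t is by definition `slice s φ₂.1 (T - t)`, so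
    -- the abstract identity matches the DN maps without rewriting.
    refine h1.trans (integral_congr_ae (Filter.Eventually.of_forall fun t => ?_))
    exact (hl _).trans (integral_congr_ae (hpt t))
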